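/- Let $\mathbb{G}=(C(\mathbb{G}),\Delta)$ be a compact quantum group in the sense of Woronowicz: $C(\mathbb{G})\neq 0$ is a unital $C^*$-algebra and $\Delta:C(\mathbb{G})\to C(\mathbb{G})\otimes_{\min}C(\mathbb{G})$ is a unital coassociative $*$-homomorphism such that $\Delta(C(\mathbb{G}))(C(\mathbb{G})\otimes 1)$ and $\Delta(C(\mathbb{G}))(1\otimes C(\mathbb{G}))$ are linearly dense. For a finite dimensional irreducible unitary representation $u^\alpha=(u^\alpha_{ij})\in M_{n_\alpha}(C(\mathbb{G}))$ of $\mathbb{G}$, $n_\alpha\ge 1$, let $Q_\alpha$ be the unique positive definite matrix with ${\rm Tr}(Q_\alpha)={\rm Tr}(Q_\alpha^{-1})$ such that, with $(u^{\alpha})^c=((u^\alpha_{ij})^*)_{i,j}$, the conjugate representation $u^{\overline\alpha}=(Q_\alpha^{1/2}\otimes 1)(u^\alpha)^c(Q_\alpha^{-1/2}\otimes 1)$ is unitary; put $d_\alpha={\rm Tr}(Q_\alpha)$ and let $\|Q_\alpha\|$ be the operator norm. Let $\alpha\mathbin{\top}\beta$ be the tensor product representation with entries $u^\alpha_{ij}u^\beta_{kl}$,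 and call a representation multiplicity-free if it is equivalent to a direct sum of pairwise inequivalent irreducible unitary representations. A linear map $\Phi:M_{n_\alpha}(\mathbb{C})\to M_{n_\beta}(\mathbb{C})$ is $\mathbb{G}_{(\alpha,\beta)}$-covariant if $(\Phi\otimes{\rm id})[u^\alpha(X\otimes 1)(u^\alpha)^*]=u^\beta(\Phi(X)\otimes 1)(u^\beta)^*$ for all $X$, and CPTP means completely positive and trace preserving. If $\overline\gamma$ is a subrepresentation of $\overline\alpha\mathbin{\top}\beta$, a Clebsch--Gordan map is $\Phi^{\alpha\to\beta}_\gamma(X)=({\rm id}\otimes{\rm Tr}_{Q_\gamma})(vXv^*)$, where $v$ is an isometric intertwiner from $\alpha$ to $\beta\mathbin{\top}\gamma$ and ${\rm Tr}_{Q_\gamma}(Y)={\rm Tr}(Q_\gamma^{t}\,Y)$ (which is ${\rm Tr}(Q_\gamma Y)$ in an orthonormal basis in which $Q_\gamma$ is diagonal). 1. Let $\alpha,\beta$ be irreducible unitary representations such that $\overline\alpha\mathbin{\top}\beta$ is multiplicity-free. If there exists a CPTP $\mathbb{G}_{(\alpha,\beta)}$-covariant map, then $$\frac{n_\alpha\|Q_\alpha\|}{d_\alpha}\le\frac{n_\beta\|Q_\beta\|}{d_\beta}.$$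 2. Let $\alpha$ be an irreducible unitary representation such that $\overline\alpha\mathbin{\top}\alpha$ is multiplicity-free. Then every CPTP $\mathbb{G}_{(\alpha,\alpha)}$-covariant map is a convex combination of Clebsch--Gordan maps $\Phi^{\alpha\to\alpha}_\gamma$ with $\overline\gamma\subseteq\overline\alpha\mathbin{\top}\alpha$ and $Q_\gamma=I_\gamma$. -/

import Mathlib

open scoped TensorProduct ENNReal ComplexOrder InnerProductSpace Kronecker

noncomputable section

/-! ### The minimal tensor product of two unital C*-algebras -/

namespace CStarMin

/-- The Hilbert space tensor product of two Hilbert spaces. -/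
def HilbertTensor (H K : Type*) [NormedAddCommGroup H] [InnerProductSpace ℂ H]
    [NormedAddCommGroup K] [InnerProductSpace ℂ K] : Type _ :=
  UniformSpace.Completion (H ⊗[ℂ] K)

section HilbertTensor

variable {H K : Type*} [NormedAddCommGroup H] [InnerProductSpace ℂ H]
  [NormedAddCommGroup K] [InnerProductSpace ℂ K]

instance : NormedAddCommGroup (HilbertTensor H K) :=
  inferInstanceAs (NormedAddCommGroup (UniformSpace.Completion (H ⊗[ℂ] K)))

instance : InnerProductSpace ℂ (HilbertTensor H K) :=
  inferInstanceAs (InnerProductSpace ℂ (UniformSpace.Completion (H ⊗[ℂ] K)))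

instance : CompleteSpace (HilbertTensor H K) :=
  inferInstanceAs (CompleteSpace (UniformSpace.Completion (H ⊗[ℂ] K)))

/-- The elementary tensor `x ⊗ y` of two vectors. -/
def vecTensor (x : H) (y : K) : HilbertTensor H K :=
  ((x ⊗ₜ[ℂ] y : H ⊗[ℂ] K) : UniformSpace.Completion (H ⊗[ℂ] K))

theorem inner_vecTensor (x x' : H) (y y' : K) :
    ⟪vecTensor x y, vecTensor x' y'⟫_ℂ = ⟪x, x'⟫_ℂ * ⟪y, y'⟫_ℂ :=
  (UniformSpace.Completion.inner_coe _ _).trans (TensorProduct.inner_tmul (𝕜 := ℂ) x x' y y')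

theorem norm_vecTensor (x : H) (y : K) : ‖vecTensor x y‖ = ‖x‖ * ‖y‖ :=
  (UniformSpace.Completion.norm_coe _).trans (TensorProduct.norm_tmul _ _)

/-- The operator `S ⊗ T` on the Hilbert space tensor product. -/
def opTensor (S : H →L[ℂ] H) (T : K →L[ℂ] K) : HilbertTensor H K →L[ℂ] HilbertTensor H K :=
  (TensorProduct.mapL S T).completion

theorem opTensor_vecTensor (S : H →L[ℂ] H) (T : K →L[ℂ] K) (x : H) (y : K) :
    opTensor S T (vecTensor x y) = vecTensor (S x) (T y) :=
  ContinuousLinearMap.completion_apply_coe _ _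

theorem norm_opTensor_le (S : H →L[ℂ] H) (T : K →L[ℂ] K) : ‖opTensor S T‖ ≤ ‖S‖ * ‖T‖ := by
  have h (x : UniformSpace.Completion (H ⊗[ℂ] K)) :
      ‖(TensorProduct.mapL S T).completion x‖ ≤ ‖S‖ * ‖T‖ * ‖x‖ := by
    induction x using UniformSpace.Completion.induction_on with
    | hp => exact isClosed_le (by fun_prop) (by fun_prop)
    | ih x =>
      rw [ContinuousLinearMap.completion_apply_coe, UniformSpace.Completion.norm_coe,
        UniformSpace.Completion.norm_coe]
      exact (ContinuousLinearMap.le_opNorm _ x).trans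
        (mul_le_mul_of_nonneg_right (TensorProduct.norm_mapL_le S T) (norm_nonneg x))
  exact ContinuousLinearMap.opNorm_le_bound _ (by positivity) h

end HilbertTensor

/-- The states (positive normalized linear functionals) of a unital C*-algebra. -/
abbrev State (A : Type*) [CStarAlgebra A] [PartialOrder A] : Type _ :=
  {φ : A →ₚ[ℂ] ℂ // φ 1 = 1}

variable {A : Type*} [CStarAlgebra A] [PartialOrder A] [StarOrderedRing A]
variable {B : Type*} [CStarAlgebra B] [PartialOrder B] [StarOrderedRing B]

/-- The Hilbert space `H_φ` of the GNS representation of a state. -/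
def HSpace (φ : State A) : Type _ := φ.1.GNS

instance (φ : State A) : NormedAddCommGroup (HSpace φ) :=
  inferInstanceAs (NormedAddCommGroup φ.1.GNS)

instance (φ : State A) : InnerProductSpace ℂ (HSpace φ) :=
  inferInstanceAs (InnerProductSpace ℂ φ.1.GNS)

instance (φ : State A) : CompleteSpace (HSpace φ) :=
  inferInstanceAs (CompleteSpace φ.1.GNS)

/-- The GNS representation `π_φ` of a state. -/
def rep (φ : State A) : A →⋆ₐ[ℂ] (HSpace φ →L[ℂ] HSpace φ) := φ.1.gnsStarAlgHom

/-- The canonical cyclic vector of the GNS representation of a state. -/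
def cyc (φ : State A) : HSpace φ := ((φ.1.toPreGNS 1 : φ.1.PreGNS) : φ.1.GNS)

theorem norm_cyc (φ : State A) : ‖cyc φ‖ = 1 := by
  have h : ‖cyc φ‖ = ‖φ.1.toPreGNS 1‖ := UniformSpace.Completion.norm_coe _
  rw [h, PositiveLinearMap.preGNS_norm_def]
  simp [φ.2]

theorem inner_cyc (φ : State A) (a : A) : ⟪cyc φ, rep φ a (cyc φ)⟫_ℂ = φ.1 a := by
  have h : rep φ a (cyc φ) = ((φ.1.toPreGNS a : φ.1.PreGNS) : φ.1.GNS) := by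
    refine (PositiveLinearMap.gnsNonUnitalStarAlgHom_apply_coe φ.1).trans ?_
    simp
  rw [h]
  refine (UniformSpace.Completion.inner_coe _ _).trans ?_
  rw [PositiveLinearMap.preGNS_inner_def]
  simp

/-- The Hilbert space tensor product `H_φ ⊗ H_ψ` of the GNS spaces of two states. -/
abbrev GNSTensor (φ : State A) (ψ : State B) : Type _ := HilbertTensor (HSpace φ) (HSpace ψ)

/-- The tensor product of the two cyclic vectors. -/
def cycTensor (φ : State A) (ψ : State B) : GNSTensor φ ψ := vecTensor (cyc φ) (cyc ψ)

theorem norm_cycTensor (φ : State A) (ψ : State B) : ‖cycTensor φ ψ‖ = 1 := by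
  rw [cycTensor, norm_vecTensor, norm_cyc, norm_cyc, one_mul]

instance (φ : State A) (ψ : State B) : Nontrivial (GNSTensor φ ψ) :=
  ⟨cycTensor φ ψ, 0, fun h => by simpa [h] using norm_cycTensor φ ψ⟩

variable (A B) in
/-- The C*-algebra of bounded families `(T_{φ,ψ})` of bounded operators on the spaces
`H_φ ⊗ H_ψ`, where `φ` and `ψ` run over the states of `A` and of `B`. -/
abbrev Ambient : Type _ :=
  lp (fun p : State A × State B => GNSTensor p.1 p.2 →L[ℂ] GNSTensor p.1 p.2) ∞

instance : CStarAlgebra (Ambient A B) where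

/-- The family `(π_φ(a) ⊗ π_ψ(b))` of bounded operators. -/
def tmulFun (a : A) (b : B) (p : State A × State B) : GNSTensor p.1 p.2 →L[ℂ] GNSTensor p.1 p.2 :=
  opTensor (rep p.1 a) (rep p.2 b)

theorem norm_tmulFun_le (a : A) (b : B) (p : State A × State B) :
    ‖tmulFun a b p‖ ≤ ‖a‖ * ‖b‖ :=
  (norm_opTensor_le _ _).trans (mul_le_mul (NonUnitalStarAlgHom.norm_apply_le _ a)
    (NonUnitalStarAlgHom.norm_apply_le _ b) (norm_nonneg _) (norm_nonneg _))

theorem memlp_tmulFun (a : A) (b : B) : Memℓp (tmulFun a b) ∞ :=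
  memℓp_infty ⟨‖a‖ * ‖b‖, by rintro _ ⟨p, rfl⟩; exact norm_tmulFun_le a b p⟩

variable (A B) in
/-- The C*-algebra generated by the operators `π(a) ⊗ ρ(b)`, where `π = ⨁ π_φ` and `ρ = ⨁ π_ψ` are
the universal representations of `A` and of `B`. -/
def minSubalgebra : StarSubalgebra ℂ (Ambient A B) :=
  (StarAlgebra.adjoin ℂ
    {x : Ambient A B | ∃ (a : A) (b : B), x = ⟨tmulFun a b, memlp_tmulFun a b⟩}).topologicalClosure

theorem isClosed_minSubalgebra : IsClosed (minSubalgebra A B : Set (Ambient A B)) :=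
  StarSubalgebra.isClosed_topologicalClosure _

variable (A B) in
/-- The minimal (spatial) C*-tensor product of `A` and `B`. -/
def MinTensor : Type _ := minSubalgebra A B

instance : CStarAlgebra (MinTensor A B) :=
  StarSubalgebra.cstarAlgebra (minSubalgebra A B) (h_closed := isClosed_minSubalgebra)

/-- The elementary tensor `a ⊗ b` in the minimal tensor product. -/
def tmul (a : A) (b : B) : MinTensor A B :=
  ⟨⟨tmulFun a b, memlp_tmulFun a b⟩,
    StarSubalgebra.le_topologicalClosure _ (StarAlgebra.subset_adjoin ℂ _ ⟨a, b, rfl⟩)⟩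

/-- The component of an element of the minimal tensor product at the pair `(φ, ψ)`, i.e. its
image under `π_φ ⊗ π_ψ`. -/
def component (φ : State A) (ψ : State B) (x : MinTensor A B) :
    GNSTensor φ ψ →L[ℂ] GNSTensor φ ψ :=
  x.1.1 (φ, ψ)

theorem component_tmul (φ : State A) (ψ : State B) (a : A) (b : B) :
    component φ ψ (tmul a b) =
      opTensor (rep φ a) (rep ψ b) := by
  unfold component tmul
  unfold tmulFun
  with_reducible rfl

theorem component_add (φ : State A) (ψ : State B) (x y : MinTensor A B) :
    component φ ψ (x + y) = component φ ψ x + component φ ψ y :=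
  congrFun (lp.coeFn_add x.1 y.1) (φ, ψ)

theorem component_smul (φ : State A) (ψ : State B) (c : ℂ) (x : MinTensor A B) :
    component φ ψ (c • x) = c • component φ ψ x :=
  congrFun (lp.coeFn_smul c x.1) (φ, ψ)

theorem component_one (φ : State A) (ψ : State B) :
    component φ ψ (1 : MinTensor A B) = 1 :=
  congrFun lp.infty_coeFn_one (φ, ψ)

theorem component_mul (φ : State A) (ψ : State B) (x y : MinTensor A B) :
    component φ ψ (x * y) = component φ ψ x * component φ ψ y :=
  congrFun (lp.infty_coeFn_mul x.1 y.1) (φ, ψ)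

theorem component_star (φ : State A) (ψ : State B) (x : MinTensor A B) :
    component φ ψ (star x) = star (component φ ψ x) :=
  lp.star_apply x.1 (φ, ψ)

/-- The product functional `φ ⊗ ψ` of two states on the minimal tensor product, as the vector
functional of the tensor product of the two cyclic vectors. -/
def prodState (φ : State A) (ψ : State B) (x : MinTensor A B) : ℂ :=
  ⟪cycTensor φ ψ, component φ ψ x (cycTensor φ ψ)⟫_ℂ

theorem prodState_add (φ : State A) (ψ : State B) (x y : MinTensor A B) :
    prodState φ ψ (x + y) = prodState φ ψ x + prodState φ ψ y := by
  rw [prodState, prodState, prodState, component_add, add_apply, inner_add_right]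

theorem prodState_smul (φ : State A) (ψ : State B) (c : ℂ) (x : MinTensor A B) :
    prodState φ ψ (c • x) = c * prodState φ ψ x := by
  rw [prodState, prodState, component_smul, smul_apply, inner_smul_right]

theorem prodState_one (φ : State A) (ψ : State B) : prodState φ ψ 1 = 1 := by
  rw [prodState, component_one, one_apply_eq_self, inner_self_eq_norm_sq_to_K,
    norm_cycTensor]
  simp

theorem prodState_star_mul_self_nonneg (φ : State A) (ψ : State B) (x : MinTensor A B) :
    0 ≤ prodState φ ψ (star x * x) := by
  rw [prodState, component_mul, component_star, mul_apply_eq_comp,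
    ContinuousLinearMap.star_eq_adjoint, ContinuousLinearMap.adjoint_inner_right,
    inner_self_eq_norm_sq_to_K]
  rw [← RCLike.ofReal_pow]
  exact RCLike.ofReal_nonneg.mpr (sq_nonneg _)

/-- The convolution `(φ ⊗ ψ) ∘ Δ` of two states along a unital *-homomorphism
`Δ : A → A ⊗ A`; it is again a state. -/
def conv (Δ : A →⋆ₐ[ℂ] MinTensor A A) (φ ψ : State A) : State A :=
  ⟨PositiveLinearMap.mk₀
    { toFun := fun a => prodState φ ψ (Δ a)
      map_add' := fun a b => by rw [map_add, prodState_add]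
      map_smul' := fun c a => by rw [map_smul, prodState_smul, RingHom.id_apply, smul_eq_mul] }
    (fun a ha => by
      obtain ⟨b, rfl⟩ := CStarAlgebra.nonneg_iff_eq_star_mul_self.mp ha
      have h : 0 ≤ prodState φ ψ (Δ (star b * b)) := by
        rw [map_mul, map_star]
        exact prodState_star_mul_self_nonneg φ ψ (Δ b)
      exact h),
   (by
      have h : prodState φ ψ (Δ 1) = 1 := by rw [map_one, prodState_one]
      exact h)⟩

theorem conv_apply (Δ : A →⋆ₐ[ℂ] MinTensor A A) (φ ψ : State A) (a : A) :
    (conv Δ φ ψ).1 a = prodState φ ψ (Δ a) := rfl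

theorem prodState_tmul (φ : State A) (ψ : State B) (a : A) (b : B) :
    prodState φ ψ (tmul a b) = φ.1 a * ψ.1 b := by
  rw [prodState, component_tmul, cycTensor, opTensor_vecTensor, inner_vecTensor, inner_cyc,
    inner_cyc]

end CStarMin

open CStarMin

/-! ### Compact quantum groups and their representations -/

/-- A compact quantum group with underlying unital C*-algebra `A = C(𝔾)`: a coassociative unital
*-homomorphism `Δ : A → A ⊗ A` into the minimal tensor product with the two density properties. -/
structure CompactQuantumGroup (A : Type*) [CStarAlgebra A] [PartialOrder A]
    [StarOrderedRing A] where
  /-- The comultiplication `Δ`. -/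
  comul : A →⋆ₐ[ℂ] MinTensor A A
  /-- Coassociativity `(Δ ⊗ id)Δ = (id ⊗ Δ)Δ`, tested against the product functionals `φ ⊗ ψ ⊗ χ`
  of states. These separate the points of the threefold minimal tensor product, and
  `(φ ⊗ ψ ⊗ χ)(Δ ⊗ id)Δ = ((φ ⊗ ψ)Δ ⊗ χ)Δ`, `(φ ⊗ ψ ⊗ χ)(id ⊗ Δ)Δ = (φ ⊗ (ψ ⊗ χ)Δ)Δ`. -/
  coassoc : ∀ φ ψ χ : State A, conv comul (conv comul φ ψ) χ = conv comul φ (conv comul ψ χ)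
  /-- `Δ(A)(A ⊗ 1)` is linearly dense. -/
  dense_left : Dense
    (Submodule.span ℂ {x | ∃ a b : A, x = comul a * tmul b 1} : Set (MinTensor A A))
  /-- `Δ(A)(1 ⊗ A)` is linearly dense. -/
  dense_right : Dense
    (Submodule.span ℂ {x | ∃ a b : A, x = comul a * tmul 1 b} : Set (MinTensor A A))

namespace CompactQuantumGroup

variable {A : Type*} [CStarAlgebra A] [PartialOrder A] [StarOrderedRing A]

/-- The operator `T ⊗ 1`: a scalar matrix viewed as a matrix over `A`. -/
def amp {ι κ : Type*} (T : Matrix ι κ ℂ) : Matrix ι κ A := T.map (algebraMap ℂ A)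

/-- The contragredient matrix `u^c = (u_{ij}^*)`. -/
def contra {ι : Type*} (u : Matrix ι ι A) : Matrix ι ι A := u.map star

/-- A finite dimensional representation: an invertible matrix `u` over `A` with
`Δ(u_{ij}) = ∑_k u_{ik} ⊗ u_{kj}`. -/
structure IsRep (G : CompactQuantumGroup A) {ι : Type*} [Fintype ι] [DecidableEq ι]
    (u : Matrix ι ι A) : Prop where
  isUnit : IsUnit u
  comul_apply : ∀ i j, G.comul (u i j) = ∑ k, tmul (u i k) (u k j)

/-- The intertwiners `Hom(u, v) = {T : v(T ⊗ 1) = (T ⊗ 1)u}`. -/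
def Hom {ι κ : Type*} [Fintype ι] [Fintype κ] (u : Matrix ι ι A) (v : Matrix κ κ A) :
    Set (Matrix κ ι ℂ) :=
  {T | v * amp T = amp T * u}

/-- Equivalence of representations: there is an invertible intertwiner. -/
def Equivalent {ι κ : Type*} [Fintype ι] [DecidableEq ι] [Fintype κ] [DecidableEq κ]
    (u : Matrix ι ι A) (v : Matrix κ κ A) : Prop :=
  ∃ T ∈ Hom u v, ∃ S : Matrix ι κ ℂ, S * T = 1 ∧ T * S = 1

/-- `u` is irreducible: it acts on a nonzero space and `Hom(u, u) = ℂ · Id`. -/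
def IsIrreducible {ι : Type*} [Fintype ι] [DecidableEq ι] (u : Matrix ι ι A) : Prop :=
  Nonempty ι ∧ ∀ T ∈ Hom u u, ∃ c : ℂ, T = c • (1 : Matrix ι ι ℂ)

/-- An irreducible unitary representation on `ℂⁿ`. -/
structure Irrep (G : CompactQuantumGroup A) where
  /-- The classical dimension. -/
  n : ℕ
  /-- The matrix of the representation. -/
  u : Matrix (Fin n) (Fin n) A
  isRep : G.IsRep u
  unitary : u ∈ unitary (Matrix (Fin n) (Fin n) A)
  irreducible : IsIrreducible u

/-- `u` is a subrepresentation of `v`: there is a representation `w` with `u ⊕ w ≅ v`. -/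
def IsSubrep (G : CompactQuantumGroup A) {ι κ : Type*} [Fintype ι] [DecidableEq ι] [Fintype κ]
    [DecidableEq κ] (u : Matrix ι ι A) (v : Matrix κ κ A) : Prop :=
  ∃ (m : ℕ) (w : Matrix (Fin m) (Fin m) A),
    G.IsRep w ∧ Equivalent (Matrix.fromBlocks u 0 0 w) v

/-- `u` has a multiplicity-free irreducible decomposition: it is equivalent to a direct sum of
pairwise inequivalent irreducible unitary representations. -/
def MultiplicityFree (G : CompactQuantumGroup A) {ι : Type*} [Fintype ι] [DecidableEq ι]
    (u : Matrix ι ι A) : Prop :=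
  ∃ (N : ℕ) (δ : Fin N → G.Irrep),
    (∀ j k, j ≠ k → ¬ Equivalent (δ j).u (δ k).u) ∧
    Equivalent u (Matrix.blockDiagonal' fun j => (δ j).u)

/-- `R` is the positive square root `Q^{1/2}` of the modular matrix `Q` of `u`: `R` is positive
definite, `(Q^{1/2} ⊗ 1) u^c (Q^{-1/2} ⊗ 1)` is unitary, and the functionals `Tr(Q ·)` and
`Tr(Q⁻¹ ·)` coincide on the intertwiners of `u^c`. -/
structure IsQSqrt {ι : Type*} [Fintype ι] [DecidableEq ι] (u : Matrix ι ι A)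
    (R : Matrix ι ι ℂ) : Prop where
  posDef : R.PosDef
  unitary : amp R * contra u * amp R⁻¹ ∈ unitary (Matrix ι ι A)
  trace_eq : ∀ X ∈ Hom (contra u) (contra u), (R ^ 2 * X).trace = ((R ^ 2)⁻¹ * X).trace

open Classical in
/-- The matrix `Q_u^{1/2}`, i.e. the unique `R` with `IsQSqrt u R`. -/
def qSqrt {ι : Type*} [Fintype ι] [DecidableEq ι] (u : Matrix ι ι A) : Matrix ι ι ℂ :=
  if h : ∃ R, IsQSqrt u R then h.choose else 0

/-- The modular matrix `Q_u`, a positive operator on the conjugate space `H̄_u`. -/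
def qMatrix {ι : Type*} [Fintype ι] [DecidableEq ι] (u : Matrix ι ι A) : Matrix ι ι ℂ :=
  qSqrt u ^ 2

/-- The quantum dimension `d_u = Tr(Q_u)`. -/
def qDim {ι : Type*} [Fintype ι] [DecidableEq ι] (u : Matrix ι ι A) : ℝ := (qMatrix u).trace.re

/-- The operator norm of `Q_u`. -/
def qNorm {ι : Type*} [Fintype ι] [DecidableEq ι] (u : Matrix ι ι A) : ℝ :=
  ‖Matrix.toEuclideanCLM (𝕜 := ℂ) (qMatrix u)‖

/-- The conjugate representation `ū = (Q_u^{1/2} ⊗ 1) u^c (Q_u^{-1/2} ⊗ 1)`. -/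
def conj {ι : Type*} [Fintype ι] [DecidableEq ι] (u : Matrix ι ι A) : Matrix ι ι A :=
  amp (qSqrt u) * contra u * amp (qSqrt u)⁻¹

/-! ### Covariant maps and Clebsch-Gordan maps -/

/-- The amplification `Φ ⊗ id : B(ℂ^ι) ⊗ A → B(ℂ^κ) ⊗ A` of a linear map `Φ`. -/
def mapAmp {ι κ : Type*} [Fintype ι] [DecidableEq ι]
    (Φ : Matrix ι ι ℂ →ₗ[ℂ] Matrix κ κ ℂ) (Y : Matrix ι ι A) : Matrix κ κ A :=
  Matrix.of fun k l => ∑ i, ∑ j, Φ (Matrix.single i j 1) k l • Y i j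

/-- `Φ` is `𝔾_{(u,v)}`-covariant: `(Φ ⊗ id)[u(X ⊗ 1)u*] = v(Φ(X) ⊗ 1)v*` for all `X`. -/
def IsCovariant {ι κ : Type*} [Fintype ι] [DecidableEq ι] [Fintype κ]
    (u : Matrix ι ι A) (v : Matrix κ κ A) (Φ : Matrix ι ι ℂ →ₗ[ℂ] Matrix κ κ ℂ) : Prop :=
  ∀ X, mapAmp Φ (u * amp X * star u) = v * amp (Φ X) * star v

/-- Completely positive and trace preserving maps between matrix algebras: every `id_k ⊗ Φ` maps
positive semidefinite matrices to positive semidefinite ones, and `Tr ∘ Φ = Tr`. -/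
structure IsCPTP {ι κ : Type*} [Fintype ι] [Fintype κ]
    (Φ : Matrix ι ι ℂ →ₗ[ℂ] Matrix κ κ ℂ) : Prop where
  cp : ∀ (k : ℕ) (Y : Matrix (Fin k × ι) (Fin k × ι) ℂ), Y.PosSemidef →
    (Matrix.of fun p q : Fin k × κ =>
      Φ (Matrix.of fun i j => Y (p.1, i) (q.1, j)) p.2 q.2).PosSemidef
  tp : ∀ X, (Φ X).trace = X.trace

/-- The partial quantum trace `(id ⊗ Tr_{Q_w})(Y)` with respect to the representation `w`. As the
matrix `Q_w` acts on the conjugate space, the operator on the space of `w` itself which it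
represents is its transpose, so `Tr_{Q_w}(X) = Tr(Q_wᵗ X)`. -/
def partialQTrace {κ μ : Type*} [Fintype μ] [DecidableEq μ] (w : Matrix μ μ A)
    (Y : Matrix (κ × μ) (κ × μ) ℂ) : Matrix κ κ ℂ :=
  Matrix.of fun i j => ((qMatrix w).transpose * Matrix.of fun k l => Y (i, k) (j, l)).trace

/-- `Φ` is a Clebsch-Gordan map `Φ^{α→β}_γ`, i.e. `Φ(X) = (id ⊗ Tr_{Q_γ})(V X V*)` for an
isometric intertwiner `V ∈ Hom(α, β ⊗ γ)`. -/
def IsCGMap {G : CompactQuantumGroup A} (α β γ : G.Irrep)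
    (Φ : Matrix (Fin α.n) (Fin α.n) ℂ →ₗ[ℂ] Matrix (Fin β.n) (Fin β.n) ℂ) : Prop :=
  ∃ V ∈ Hom α.u (β.u ⊗ₖ γ.u), V.conjTranspose * V = 1 ∧
    ∀ X, Φ X = partialQTrace γ.u (V * X * V.conjTranspose)

end CompactQuantumGroup

end

/-! Write Q for the modular matrix of a representation, R for its positive square root and C for the
Choi matrix of the covariant channel Φ.

The inequality. The functional X ↦ Tr(Q_βᵗ Φ(X)) is invariant under the contragredient of α. By
irreducibility such a functional is a multiple c of X ↦ Tr(Q_αᵗ X) (`IsQSqrt.eq_smul_of_invariant`).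
Since Φ(1) intertwines β with itself, it is the scalar n_α/n_β, and evaluation at X = 1 gives c =
n_α d_β / (n_β d_α) (`IsCovariant.trace_qMatrix_mul`). For X ≥ 0 it follows that c Tr(Q_αᵗ X) =
Tr(Q_βᵗ Φ(X)) ≤ ‖Q_β‖ Tr X, that is, c‖Q_α‖ ≤ ‖Q_β‖.

The convex decomposition. For β = α the constant c is 1, so Φ preserves Tr, the unit and Tr(Qᵗ ·).
Together these give Tr(L²C) = 0 for the Hermitian matrix L = Q⁻¹ ⊗ Rᵗ − 1 ⊗ (R⁻¹)ᵗ
(`IsCovariant.trace_sq_mul_choi`). Covariance makes (R⁻¹ ⊗ 1)C(R⁻¹ ⊗ 1) a positive intertwiner of ᾱ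
⊗ α, so multiplicity-freeness and Schur's lemma give C = ∑ d_j W_j W_j* with W_j = (R ⊗ 1)V_j, where
the V_j are isometric intertwiners from the summands δ_j. Hence L W_j = 0 whenever d_j ≠ 0, which
says that Q⁻¹ ⊗ Qᵗ fixes V_j. Then the contragredient of δ_j is unitary, so γ_j = δ_j^c has trivial
modular matrix and its conjugate is δ_j itself. Frobenius reciprocity turns V_j into an intertwiner
from α to α ⊗ γ_j whose Clebsch-Gordan map has a Choi matrix proportional to W_j W_j*. Comparing Tr
Φ(1) shows that the weights add up to 1.

The existence of Q is proved from the axioms. The Haar state h is a limit of states invariant under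
finitely many others. A finite dimensional left coideal carries a unitary corepresentation on its
image in L²(h). Applied to the matrix coefficients of u, this gives intertwiners from a unitary ζ to
u^c, and a second application leads back to u. Schur's lemma then yields a positive definite P
preserved by u^c (`exists_posDef_contra`), and Q is a multiple of P⁻¹. -/

set_option linter.unusedSectionVars false

noncomputable section

open CStarMin

/-! ### States and GNS vectors -/

namespace CStarMin

section States

variable {A : Type*} [CStarAlgebra A] [PartialOrder A] [StarOrderedRing A]

/-- A linear functional which is positive and unital, as a state. -/
def State.mk' (f : A →ₗ[ℂ] ℂ) (hf : ∀ x, 0 ≤ f (star x * x)) (h1 : f 1 = 1) : State A :=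
  ⟨PositiveLinearMap.mk₀ f fun a ha => by
    obtain ⟨b, rfl⟩ := CStarAlgebra.nonneg_iff_eq_star_mul_self.mp ha
    exact hf b, h1⟩

theorem State.mk'_apply (f : A →ₗ[ℂ] ℂ) (hf : ∀ x, 0 ≤ f (star x * x)) (h1 : f 1 = 1) (a : A) :
    (State.mk' f hf h1).1 a = f a := rfl

theorem State.apply_star_mul_self_nonneg (φ : State A) (a : A) : 0 ≤ φ.1 (star a * a) :=
  φ.1.map_nonneg (star_mul_self_nonneg a)

theorem State.apply_star (φ : State A) (a : A) : φ.1 (star a) = star (φ.1 a) :=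
  map_star φ.1 a

/-- The spectrum of a lies in [0, ‖a‖], and x ↦ 2x − ‖a‖ maps this interval into [−‖a‖, ‖a‖]. The
bound forces a functional that attains the norm at a to be unital. -/
theorem norm_two_smul_sub_le (a : A) (ha : 0 ≤ a) :
    ‖(2 : ℂ) • a - algebraMap ℂ A ‖a‖‖ ≤ ‖a‖ := by
  have hsa : IsSelfAdjoint a := .of_nonneg ha
  have h : cfc (fun x : ℝ => 2 * x - ‖a‖) a = (2 : ℂ) • a - algebraMap ℂ A ‖a‖ := by
    rw [cfc_sub (fun x : ℝ => 2 * x) (fun _ => ‖a‖) a, cfc_const_mul_id (2 : ℝ) a, cfc_const ‖a‖ a]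
    rw [two_smul, two_smul]; rfl
  rw [← h]
  refine norm_cfc_le (norm_nonneg a) fun x hx => ?_
  have h0 : 0 ≤ x := spectrum_nonneg_of_nonneg ha hx
  have h1 : ‖x‖ ≤ ‖a‖ * ‖(1 : A)‖ := spectrum.norm_le_norm_mul_of_mem hx
  have h2 : ‖(1 : A)‖ ≤ 1 := by
    rcases subsingleton_or_nontrivial A with _ | _
    · rw [Subsingleton.elim (1 : A) 0, norm_zero]; exact zero_le_one
    · exact CStarRing.norm_one.le
  have h3 : ‖x‖ ≤ ‖a‖ := h1.trans (mul_le_of_le_one_right (norm_nonneg a) h2)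
  rw [Real.norm_eq_abs, abs_of_nonneg h0] at h3
  rw [Real.norm_eq_abs, abs_le]
  constructor <;> linarith

/-- A contractive unital functional is a state. -/
theorem exists_state_of_norm_le_one [Nontrivial A] (g : StrongDual ℂ A) (hg : ‖g‖ ≤ 1)
    (h1 : g 1 = 1) : ∃ φ : State A, ∀ a, φ.1 a = g a := by
  have hle (x : A) : ‖g x‖ ≤ ‖x‖ :=
    (g.le_opNorm x).trans (mul_le_of_le_one_left (norm_nonneg x) hg)
  have him (x : A) (hx : IsSelfAdjoint x) : (g x).im = 0 := by
    -- Test g on x + it: the imaginary part of the value grows by t, while the squared norm grows by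
    -- at most t².
    have key (t : ℝ) : 2 * t * (g x).im + (g x).im ^ 2 ≤ ‖x‖ ^ 2 := by
      set y : A := x + (Complex.I * t) • (1 : A) with hy
      have hyy : star y * y = x * x + ((t ^ 2 : ℝ) : ℂ) • (1 : A) := by
        rw [hy, star_add, hx.star_eq, star_smul, star_one]
        simp only [add_mul, mul_add, smul_mul_assoc, mul_smul_comm, one_mul, mul_one, star_mul',
          RCLike.star_def, Complex.conj_I, Complex.conj_ofReal, smul_add]
        have : -Complex.I * (t : ℂ) * (Complex.I * t) = ((t ^ 2 : ℝ) : ℂ) := by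
          push_cast; linear_combination (-(t : ℂ) ^ 2) * Complex.I_mul_I
        rw [smul_smul, mul_comm (Complex.I * (t : ℂ)), this]
        have h2 : (-Complex.I * (t : ℂ)) • x = -((Complex.I * (t : ℂ)) • x) := by
          rw [← neg_smul, neg_mul]
        rw [h2]; abel
      have hn : ‖y‖ ^ 2 ≤ ‖x‖ ^ 2 + t ^ 2 := by
        rw [sq, ← CStarRing.norm_star_mul_self, hyy]
        refine (norm_add_le _ _).trans (add_le_add ?_ ?_)
        · rw [sq]; exact norm_mul_le x x
        · rw [norm_smul, CStarRing.norm_one, mul_one, Complex.norm_real, Real.norm_eq_abs, abs_sq]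
      have hgy : (g y).im = (g x).im + t := by
        rw [hy, map_add, map_smul, h1]; simp
      have h3 : ((g x).im + t) ^ 2 ≤ ‖y‖ ^ 2 := by
        rw [← hgy, ← sq_abs]
        exact pow_le_pow_left₀ (abs_nonneg _) ((Complex.abs_im_le_norm _).trans (hle y)) 2
      nlinarith
    by_contra hne
    -- This t makes the linear term equal to ‖x‖² + 1.
    have hk := key ((‖x‖ ^ 2 + 1) / (2 * (g x).im))
    have : 2 * ((‖x‖ ^ 2 + 1) / (2 * (g x).im)) * (g x).im = ‖x‖ ^ 2 + 1 := by field_simp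
    rw [this] at hk
    nlinarith [sq_nonneg (g x).im]
  refine ⟨State.mk' g (fun x => ?_) h1, fun a => rfl⟩
  have hpos : 0 ≤ star x * x := star_mul_self_nonneg x
  set y := star x * x
  rw [Complex.nonneg_iff]
  refine ⟨?_, (him y (.of_nonneg hpos)).symm⟩
  -- Since 0 ≤ ‖y‖ − y ≤ ‖y‖, contractivity bounds Re(‖y‖ − g y) by ‖y‖, so Re g y ≥ 0.
  have h2 : ‖(algebraMap ℂ A ‖y‖) - y‖ ≤ ‖y‖ := by
    have h3 : y ≤ algebraMap ℝ A ‖y‖ := IsSelfAdjoint.le_algebraMap_norm_self (.of_nonneg hpos)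
    have h4 : (algebraMap ℂ A ‖y‖) = algebraMap ℝ A ‖y‖ := rfl
    have h5 : ‖algebraMap ℝ A ‖y‖‖ = ‖y‖ := by
      rw [norm_algebraMap', norm_norm]
    rw [h4]
    refine (CStarAlgebra.norm_le_norm_of_nonneg_of_le (sub_nonneg.mpr h3)
      (sub_le_self _ hpos)).trans h5.le
  have h3 := (Complex.re_le_norm _).trans ((hle _).trans h2)
  rw [map_sub, Algebra.algebraMap_eq_smul_one, map_smul, h1] at h3
  simp at h3
  exact h3

/-- For every nonzero positive element there is a state attaining its norm. -/
theorem exists_state_apply_eq_norm [Nontrivial A] (a : A) (ha : 0 ≤ a) (ha0 : a ≠ 0) :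
    ∃ φ : State A, φ.1 a = (‖a‖ : ℂ) := by
  obtain ⟨g, hg, hga⟩ := exists_dual_vector ℂ a (norm_ne_zero_iff.mpr ha0)
  have hle (x : A) : ‖g x‖ ≤ ‖x‖ := (g.le_opNorm x).trans (by rw [hg, one_mul])
  have hpos : 0 < ‖a‖ := norm_pos_iff.mpr ha0
  have h2 : ‖g 1‖ ≤ 1 := (hle 1).trans CStarRing.norm_one.le
  have h3 : ‖(‖a‖ : ℂ) * (2 - g 1)‖ ≤ ‖a‖ := by
    refine le_trans (le_of_eq ?_) ((hle _).trans (norm_two_smul_sub_le a ha))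
    rw [map_sub, map_smul, Algebra.algebraMap_eq_smul_one, map_smul, hga]
    congr 1
    simp only [smul_eq_mul, Complex.coe_algebraMap]
    ring
  rw [norm_mul, Complex.norm_real, norm_norm] at h3
  have h4 : ‖2 - g 1‖ ≤ 1 := by
    by_contra h; push Not at h; nlinarith
  -- The closed unit discs around 0 and 2 meet only at 1.
  have h5 : g 1 = 1 := by
    have e1 := (Complex.abs_re_le_norm _).trans h2
    have e2 := (Complex.re_le_norm _).trans h4
    rw [Complex.sub_re, Complex.re_ofNat] at e2
    have e3 : (g 1).re = 1 := by have := (abs_le.mp e1).2; linarith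
    have e4 : Complex.normSq (g 1) ≤ 1 := by
      rw [Complex.normSq_eq_norm_sq]; nlinarith [norm_nonneg (g 1)]
    rw [Complex.normSq_apply, e3] at e4
    have e5 : (g 1).im = 0 := by nlinarith [sq_nonneg (g 1).im]
    exact Complex.ext e3 e5
  obtain ⟨φ, hφ⟩ := exists_state_of_norm_le_one g hg.le h5
  exact ⟨φ, by rw [hφ, hga]; rfl⟩

instance [Nontrivial A] : Nonempty (State A) :=
  (exists_state_apply_eq_norm (1 : A) zero_le_one one_ne_zero).nonempty

/-- States separate the points of a C*-algebra: first for positive elements. -/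
theorem eq_zero_of_state_star_mul_self [Nontrivial A] (a : A)
    (h : ∀ φ : State A, φ.1 (star a * a) = 0) : a = 0 := by
  by_contra ha
  have h0 : star a * a ≠ 0 := fun h => ha (CStarRing.star_mul_self_eq_zero_iff a |>.mp h)
  obtain ⟨φ, hφ⟩ := exists_state_apply_eq_norm _ (star_mul_self_nonneg a) h0
  rw [h φ] at hφ
  exact h0 (norm_eq_zero.mp (by exact_mod_cast hφ.symm))

end States

section Vectors

variable {A : Type*} [CStarAlgebra A] [PartialOrder A] [StarOrderedRing A]

/-- The vector `π_φ(a) Ω_φ` of the GNS space of the state `φ`. -/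
def gnsVec (φ : State A) : A →ₗ[ℂ] HSpace φ where
  toFun a := rep φ a (cyc φ)
  map_add' a b := by rw [map_add]; rfl
  map_smul' c a := by rw [map_smul]; rfl

theorem gnsVec_apply (φ : State A) (a : A) : gnsVec φ a = rep φ a (cyc φ) := rfl

theorem gnsVec_one (φ : State A) : gnsVec φ 1 = cyc φ := by
  rw [gnsVec_apply, map_one]; rfl

theorem rep_gnsVec (φ : State A) (a b : A) : rep φ a (gnsVec φ b) = gnsVec φ (a * b) := by
  rw [gnsVec_apply, gnsVec_apply, map_mul]; rfl

theorem inner_rep_left (φ : State A) (a : A) (x y : HSpace φ) :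
    ⟪rep φ a x, y⟫_ℂ = ⟪x, rep φ (star a) y⟫_ℂ := by
  rw [map_star, ContinuousLinearMap.star_eq_adjoint, ContinuousLinearMap.adjoint_inner_right]

theorem inner_gnsVec (φ : State A) (a b : A) :
    ⟪gnsVec φ a, gnsVec φ b⟫_ℂ = φ.1 (star a * b) := by
  rw [gnsVec_apply φ a, inner_rep_left, rep_gnsVec, gnsVec_apply, inner_cyc]

theorem norm_gnsVec_sq (φ : State A) (a : A) : ((‖gnsVec φ a‖ : ℂ)) ^ 2 = φ.1 (star a * a) := by
  rw [← inner_gnsVec]; exact (inner_self_eq_norm_sq_to_K (𝕜 := ℂ) (gnsVec φ a)).symm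

theorem gnsVec_eq_coe (φ : State A) (a : A) :
    gnsVec φ a = ((φ.1.toPreGNS a : φ.1.PreGNS) : φ.1.GNS) := by
  refine (PositiveLinearMap.gnsNonUnitalStarAlgHom_apply_coe φ.1).trans ?_
  simp

theorem denseRange_gnsVec (φ : State A) : DenseRange (gnsVec φ) := by
  have h : DenseRange ((↑) : φ.1.PreGNS → φ.1.GNS) := UniformSpace.Completion.denseRange_coe
  have h2 : (gnsVec φ : A → HSpace φ) = ((↑) : φ.1.PreGNS → φ.1.GNS) ∘ φ.1.toPreGNS :=
    funext (gnsVec_eq_coe φ)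
  rw [h2]
  exact h.comp φ.1.toPreGNS.surjective.denseRange (UniformSpace.Completion.continuous_coe _)

theorem norm_state_apply_le (φ : State A) (a : A) : ‖φ.1 a‖ ≤ ‖a‖ := by
  rw [← inner_cyc]
  refine (norm_inner_le_norm _ _).trans ?_
  rw [norm_cyc, one_mul]
  refine ((rep φ a).le_opNorm _).trans ?_
  rw [norm_cyc, mul_one]
  exact NonUnitalStarAlgHom.norm_apply_le _ a

/-- The norm of an element is attained in a GNS representation. -/
theorem exists_norm_gnsVec_eq [Nontrivial A] (a : A) : ∃ φ : State A, ‖gnsVec φ a‖ = ‖a‖ := by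
  rcases eq_or_ne a 0 with rfl | ha
  · exact ⟨Classical.arbitrary _, by simp⟩
  have h0 : star a * a ≠ 0 := fun h => ha (CStarRing.star_mul_self_eq_zero_iff a |>.mp h)
  obtain ⟨φ, hφ⟩ := exists_state_apply_eq_norm _ (star_mul_self_nonneg a) h0
  refine ⟨φ, ?_⟩
  have h2 : ‖gnsVec φ a‖ ^ 2 = ‖a‖ ^ 2 := by
    have := (norm_gnsVec_sq φ a).trans hφ
    rw [CStarRing.norm_star_mul_self, ← sq] at this
    exact_mod_cast this
  exact (pow_left_inj₀ (norm_nonneg _) (norm_nonneg _) two_ne_zero).mp h2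

theorem eq_zero_of_state [Nontrivial A] (a : A) (h : ∀ φ : State A, gnsVec φ a = 0) : a = 0 := by
  obtain ⟨φ, hφ⟩ := exists_norm_gnsVec_eq a
  rw [h φ, norm_zero] at hφ
  exact norm_eq_zero.mp hφ.symm

end Vectors

end CStarMin

/-! ### Elementary tensors in the Hilbert space and minimal tensor products -/

namespace CStarMin

section HilbertTensorDense

variable {H K : Type*} [NormedAddCommGroup H] [InnerProductSpace ℂ H]
  [NormedAddCommGroup K] [InnerProductSpace ℂ K]

theorem vecTensor_add_left (x x' : H) (y : K) :
    vecTensor (x + x') y = vecTensor x y + vecTensor x' y := by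
  unfold vecTensor
  rw [TensorProduct.add_tmul]; exact UniformSpace.Completion.coe_add _ _

theorem vecTensor_add_right (x : H) (y y' : K) :
    vecTensor x (y + y') = vecTensor x y + vecTensor x y' := by
  unfold vecTensor
  rw [TensorProduct.tmul_add]; exact UniformSpace.Completion.coe_add _ _

theorem vecTensor_smul_left (c : ℂ) (x : H) (y : K) :
    vecTensor (c • x) y = c • vecTensor x y := by
  unfold vecTensor
  rw [← TensorProduct.smul_tmul']; exact UniformSpace.Completion.coe_smul _ _

theorem vecTensor_smul_right (c : ℂ) (x : H) (y : K) :
    vecTensor x (c • y) = c • vecTensor x y := by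
  unfold vecTensor
  rw [TensorProduct.tmul_smul]; exact UniformSpace.Completion.coe_smul _ _

/-- The bilinear map `(x, y) ↦ x ⊗ y`. -/
def vecTensorₗ : H →ₗ[ℂ] K →ₗ[ℂ] HilbertTensor H K :=
  LinearMap.mk₂ ℂ vecTensor vecTensor_add_left vecTensor_smul_left vecTensor_add_right
    vecTensor_smul_right

theorem vecTensorₗ_apply (x : H) (y : K) : vecTensorₗ x y = vecTensor x y := rfl

/-- `y ↦ x ⊗ y` as a bounded map. -/
def vecTensorL (x : H) : K →L[ℂ] HilbertTensor H K :=
  LinearMap.mkContinuous (vecTensorₗ x) ‖x‖ fun y => (norm_vecTensor x y).le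

/-- `x ↦ x ⊗ y` as a bounded map. -/
def vecTensorR (y : K) : H →L[ℂ] HilbertTensor H K :=
  LinearMap.mkContinuous (vecTensorₗ.flip y) ‖y‖ fun x =>
    (norm_vecTensor x y).le.trans (mul_comm _ _).le

theorem vecTensorR_apply (x : H) (y : K) : vecTensorR y x = vecTensor x y := rfl

theorem dense_span_vecTensor {s : Set H} {t : Set K} (hs : Dense s) (ht : Dense t) :
    Dense (Submodule.span ℂ {z : HilbertTensor H K | ∃ x ∈ s, ∃ y ∈ t, z = vecTensor x y} :
      Set (HilbertTensor H K)) := by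
  set S := Submodule.span ℂ {z : HilbertTensor H K | ∃ x ∈ s, ∃ y ∈ t, z = vecTensor x y} with hS
  have h1 (x : H) (hx : x ∈ s) (y : K) : vecTensor x y ∈ S.topologicalClosure := by
    have hc : IsClosed {y : K | vecTensorL x y ∈ S.topologicalClosure} :=
      S.isClosed_topologicalClosure.preimage (vecTensorL x).continuous
    have hsub : t ⊆ {y : K | vecTensorL x y ∈ S.topologicalClosure} := fun y hy =>
      S.le_topologicalClosure (Submodule.subset_span ⟨x, hx, y, hy, rfl⟩)
    exact closure_minimal hsub hc (ht y)
  have h2 (x : H) (y : K) : vecTensor x y ∈ S.topologicalClosure := by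
    have hc : IsClosed {x : H | vecTensorR y x ∈ S.topologicalClosure} :=
      S.isClosed_topologicalClosure.preimage (vecTensorR y).continuous
    exact closure_minimal (fun x hx => h1 x hx y) hc (hs x)
  rw [Submodule.dense_iff_topologicalClosure_eq_top, Submodule.eq_top_iff']
  intro z
  refine UniformSpace.Completion.induction_on z (S.isClosed_topologicalClosure) fun w => ?_
  induction w using TensorProduct.induction_on with
  | zero => exact (UniformSpace.Completion.coe_zero (α := H ⊗[ℂ] K)).symm ▸ zero_mem _
  | tmul x y => exact h2 x y
  | add x y hx hy =>
    have : ((x + y : H ⊗[ℂ] K) : UniformSpace.Completion (H ⊗[ℂ] K)) = x + y :=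
      UniformSpace.Completion.coe_add _ _
    rw [this]
    exact add_mem hx hy

theorem HilbertTensor.clm_ext {E : Type*} [NormedAddCommGroup E] [NormedSpace ℂ E]
    {f g : HilbertTensor H K →L[ℂ] E} (h : ∀ x y, f (vecTensor x y) = g (vecTensor x y)) :
    f = g := by
  refine ContinuousLinearMap.ext_on (dense_span_vecTensor dense_univ dense_univ) ?_
  rintro _ ⟨x, _, y, _, rfl⟩
  exact h x y

theorem opTensor_mul (S S' : H →L[ℂ] H) (T T' : K →L[ℂ] K) :
    opTensor (S * S') (T * T') = opTensor S T * opTensor S' T' :=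
  HilbertTensor.clm_ext fun x y => by
    rw [mul_apply_eq_comp, opTensor_vecTensor, opTensor_vecTensor, opTensor_vecTensor]; rfl

theorem opTensor_one : opTensor (1 : H →L[ℂ] H) (1 : K →L[ℂ] K) = 1 :=
  HilbertTensor.clm_ext fun x y => by rw [opTensor_vecTensor]; rfl

theorem opTensor_add_left (S S' : H →L[ℂ] H) (T : K →L[ℂ] K) :
    opTensor (S + S') T = opTensor S T + opTensor S' T :=
  HilbertTensor.clm_ext fun x y => by
    rw [add_apply, opTensor_vecTensor, opTensor_vecTensor, opTensor_vecTensor,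
      add_apply, vecTensor_add_left]

theorem opTensor_add_right (S : H →L[ℂ] H) (T T' : K →L[ℂ] K) :
    opTensor S (T + T') = opTensor S T + opTensor S T' :=
  HilbertTensor.clm_ext fun x y => by
    rw [add_apply, opTensor_vecTensor, opTensor_vecTensor, opTensor_vecTensor,
      add_apply, vecTensor_add_right]

theorem opTensor_smul_left (c : ℂ) (S : H →L[ℂ] H) (T : K →L[ℂ] K) :
    opTensor (c • S) T = c • opTensor S T :=
  HilbertTensor.clm_ext fun x y => by
    rw [smul_apply, opTensor_vecTensor, opTensor_vecTensor, smul_apply, vecTensor_smul_left]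

theorem opTensor_smul_right (c : ℂ) (S : H →L[ℂ] H) (T : K →L[ℂ] K) :
    opTensor S (c • T) = c • opTensor S T :=
  HilbertTensor.clm_ext fun x y => by
    rw [smul_apply, opTensor_vecTensor, opTensor_vecTensor, smul_apply, vecTensor_smul_right]

theorem star_opTensor [CompleteSpace H] [CompleteSpace K] (S : H →L[ℂ] H) (T : K →L[ℂ] K) :
    star (opTensor S T) = opTensor (star S) (star T) := by
  rw [ContinuousLinearMap.star_eq_adjoint]
  refine HilbertTensor.clm_ext fun x y => ?_
  refine (dense_span_vecTensor (H := H) (K := K) dense_univ dense_univ).eq_of_inner_right ℂ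
    fun z hz => ?_
  induction hz using Submodule.span_induction with
  | mem z hz =>
    obtain ⟨x', _, y', _, rfl⟩ := hz
    rw [ContinuousLinearMap.adjoint_inner_right, opTensor_vecTensor, opTensor_vecTensor,
      inner_vecTensor, inner_vecTensor, ContinuousLinearMap.star_eq_adjoint,
      ContinuousLinearMap.star_eq_adjoint, ContinuousLinearMap.adjoint_inner_right,
      ContinuousLinearMap.adjoint_inner_right]
  | zero => rw [inner_zero_left, inner_zero_left]
  | add z w _ _ h1 h2 => rw [inner_add_left, inner_add_left, h1, h2]
  | smul c z _ h => rw [inner_smul_left, inner_smul_left, h]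

end HilbertTensorDense

section MinTensorBasic

variable {A : Type*} [CStarAlgebra A] [PartialOrder A] [StarOrderedRing A]
variable {B : Type*} [CStarAlgebra B] [PartialOrder B] [StarOrderedRing B]

theorem MinTensor.ext {x y : MinTensor A B} (h : ∀ φ ψ, component φ ψ x = component φ ψ y) :
    x = y :=
  Subtype.ext (Subtype.ext (funext fun p => h p.1 p.2))

theorem norm_component_le (φ : State A) (ψ : State B) (x : MinTensor A B) :
    ‖component φ ψ x‖ ≤ ‖x‖ :=
  lp.norm_apply_le_norm ENNReal.top_ne_zero x.1 (φ, ψ)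

/-- The component at a pair of states as a bounded linear map. -/
def componentL (φ : State A) (ψ : State B) :
    MinTensor A B →L[ℂ] (GNSTensor φ ψ →L[ℂ] GNSTensor φ ψ) :=
  LinearMap.mkContinuous
    { toFun := component φ ψ
      map_add' := component_add φ ψ
      map_smul' := component_smul φ ψ } 1 fun x => by
    rw [one_mul]; exact norm_component_le φ ψ x

/-- The map `x ↦ x v` for a vector `v` of `H_φ ⊗ H_ψ`. -/
def actL (φ : State A) (ψ : State B) (v : GNSTensor φ ψ) : MinTensor A B →L[ℂ] GNSTensor φ ψ :=
  (ContinuousLinearMap.apply ℂ (GNSTensor φ ψ) v).comp (componentL φ ψ)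

theorem actL_apply (φ : State A) (ψ : State B) (v : GNSTensor φ ψ) (x : MinTensor A B) :
    actL φ ψ v x = component φ ψ x v := rfl

theorem tmul_add_left (a a' : A) (b : B) : tmul (a + a') b = tmul a b + tmul a' b :=
  MinTensor.ext fun φ ψ => by
    rw [component_add, component_tmul, component_tmul, component_tmul, map_add, opTensor_add_left]

theorem tmul_add_right (a : A) (b b' : B) : tmul a (b + b') = tmul a b + tmul a b' :=
  MinTensor.ext fun φ ψ => by
    rw [component_add, component_tmul, component_tmul, component_tmul, map_add, opTensor_add_right]

theorem tmul_smul_left (c : ℂ) (a : A) (b : B) : tmul (c • a) b = c • tmul a b :=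
  MinTensor.ext fun φ ψ => by
    rw [component_smul, component_tmul, component_tmul, map_smul, opTensor_smul_left]

theorem tmul_smul_right (c : ℂ) (a : A) (b : B) : tmul a (c • b) = c • tmul a b :=
  MinTensor.ext fun φ ψ => by
    rw [component_smul, component_tmul, component_tmul, map_smul, opTensor_smul_right]

theorem tmul_mul_tmul (a a' : A) (b b' : B) : tmul a b * tmul a' b' = tmul (a * a') (b * b') :=
  MinTensor.ext fun φ ψ => by
    rw [component_mul, component_tmul, component_tmul, component_tmul, map_mul, map_mul,
      opTensor_mul]

theorem tmul_one_one : tmul (1 : A) (1 : B) = 1 :=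
  MinTensor.ext fun φ ψ => by
    rw [component_tmul, component_one, map_one, map_one, opTensor_one]

theorem star_tmul (a : A) (b : B) : star (tmul a b) = tmul (star a) (star b) :=
  MinTensor.ext fun φ ψ => by
    rw [component_star, component_tmul, component_tmul, map_star, map_star, star_opTensor]

/-- The bilinear map `(a, b) ↦ a ⊗ b`. -/
def tmulₗ : A →ₗ[ℂ] B →ₗ[ℂ] MinTensor A B :=
  LinearMap.mk₂ ℂ tmul tmul_add_left tmul_smul_left tmul_add_right tmul_smul_right

theorem tmulₗ_apply (a : A) (b : B) : tmulₗ a b = tmul a b := rfl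

variable (A B) in
/-- The algebraic tensor product inside the minimal one. -/
def algTensor : Submodule ℂ (MinTensor A B) :=
  Submodule.span ℂ {x | ∃ (a : A) (b : B), x = tmul a b}

theorem tmul_mem_algTensor (a : A) (b : B) : tmul a b ∈ algTensor A B :=
  Submodule.subset_span ⟨a, b, rfl⟩

theorem mul_mem_algTensor {x y : MinTensor A B} (hx : x ∈ algTensor A B)
    (hy : y ∈ algTensor A B) : x * y ∈ algTensor A B := by
  induction hx using Submodule.span_induction with
  | mem x hx =>
    obtain ⟨a, b, rfl⟩ := hx
    induction hy using Submodule.span_induction with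
    | mem y hy =>
      obtain ⟨a', b', rfl⟩ := hy
      rw [tmul_mul_tmul]; exact tmul_mem_algTensor _ _
    | zero => rw [mul_zero]; exact zero_mem _
    | add x y _ _ h1 h2 => rw [mul_add]; exact add_mem h1 h2
    | smul c x _ h => rw [mul_smul_comm]; exact Submodule.smul_mem _ _ h
  | zero => rw [zero_mul]; exact zero_mem _
  | add x y _ _ h1 h2 => rw [add_mul]; exact add_mem h1 h2
  | smul c x _ h => rw [smul_mul_assoc]; exact Submodule.smul_mem _ _ h

theorem star_mem_algTensor {x : MinTensor A B} (hx : x ∈ algTensor A B) :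
    star x ∈ algTensor A B := by
  induction hx using Submodule.span_induction with
  | mem x hx => obtain ⟨a, b, rfl⟩ := hx; rw [star_tmul]; exact tmul_mem_algTensor _ _
  | zero => rw [star_zero]; exact zero_mem _
  | add x y _ _ h1 h2 => rw [star_add]; exact add_mem h1 h2
  | smul c x _ h => rw [star_smul]; exact Submodule.smul_mem _ _ h

/-- The span of the elementary tensors is already closed under products and adjoints, so it contains
the whole *-algebra they generate, which is dense by definition. -/
theorem dense_algTensor : Dense (algTensor A B : Set (MinTensor A B)) := by
  let S : StarSubalgebra ℂ (MinTensor A B) :=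
    { carrier := algTensor A B
      mul_mem' := mul_mem_algTensor
      add_mem' := add_mem
      algebraMap_mem' := fun r => by
        rw [Algebra.algebraMap_eq_smul_one, ← tmul_one_one]
        exact Submodule.smul_mem _ _ (tmul_mem_algTensor _ _)
      star_mem' := star_mem_algTensor }
  have key : ∀ y ∈ StarAlgebra.adjoin ℂ
      {x : Ambient A B | ∃ (a : A) (b : B), x = ⟨tmulFun a b, memlp_tmulFun a b⟩},
      ∃ x ∈ algTensor A B, x.1 = y := by
    intro y hy
    have hle : StarAlgebra.adjoin ℂ
        {x : Ambient A B | ∃ (a : A) (b : B), x = ⟨tmulFun a b, memlp_tmulFun a b⟩} ≤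
        S.map (minSubalgebra A B).subtype := by
      refine StarAlgebra.adjoin_le ?_
      rintro _ ⟨a, b, rfl⟩
      exact ⟨tmul a b, tmul_mem_algTensor a b, rfl⟩
    obtain ⟨x, hx, rfl⟩ := hle hy
    exact ⟨x, hx, rfl⟩
  intro x
  have hx : x.1 ∈ closure (StarAlgebra.adjoin ℂ
      {x : Ambient A B | ∃ (a : A) (b : B), x = ⟨tmulFun a b, memlp_tmulFun a b⟩} :
      Set (Ambient A B)) := x.2
  rw [Metric.mem_closure_iff] at hx ⊢
  intro ε hε
  obtain ⟨y, hy, hxy⟩ := hx ε hε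
  obtain ⟨z, hz, rfl⟩ := key y hy
  exact ⟨z, hz, hxy⟩

/-- Bounded maps on the minimal tensor product are determined by the elementary tensors. -/
theorem MinTensor.clm_ext {E : Type*} [NormedAddCommGroup E] [NormedSpace ℂ E]
    {f g : MinTensor A B →L[ℂ] E} (h : ∀ a b, f (tmul a b) = g (tmul a b)) : f = g := by
  refine ContinuousLinearMap.ext_on dense_algTensor ?_
  rintro _ ⟨a, b, rfl⟩
  exact h a b

theorem component_tmul_vec (φ : State A) (ψ : State B) (a p : A) (b q : B) :
    component φ ψ (tmul a b) (vecTensor (gnsVec φ p) (gnsVec ψ q)) =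
      vecTensor (gnsVec φ (a * p)) (gnsVec ψ (b * q)) := by
  rw [component_tmul, opTensor_vecTensor, rep_gnsVec, rep_gnsVec]

theorem cycTensor_eq (φ : State A) (ψ : State B) :
    cycTensor φ ψ = vecTensor (gnsVec φ 1) (gnsVec ψ 1) := by
  rw [gnsVec_one, gnsVec_one]; rfl

theorem inner_component_left (φ : State A) (ψ : State B) (x : MinTensor A B)
    (v w : GNSTensor φ ψ) :
    ⟪component φ ψ x v, w⟫_ℂ = ⟪v, component φ ψ (star x) w⟫_ℂ := by
  rw [component_star, ContinuousLinearMap.star_eq_adjoint,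
    ContinuousLinearMap.adjoint_inner_right]

theorem component_mul_apply (φ : State A) (ψ : State B) (x y : MinTensor A B)
    (v : GNSTensor φ ψ) : component φ ψ (x * y) v = component φ ψ x (component φ ψ y v) := by
  rw [component_mul]; rfl

/-- Every matrix coefficient between GNS vectors is a product functional of a two-sided multiple of
x. This is the bridge from vectors to slice maps. -/
theorem inner_vec_component_vec (φ : State A) (ψ : State B) (x : MinTensor A B) (c p : A)
    (d q : B) :
    ⟪vecTensor (gnsVec φ c) (gnsVec ψ d), component φ ψ x (vecTensor (gnsVec φ p) (gnsVec ψ q))⟫_ℂ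
      = prodState φ ψ (tmul (star c) (star d) * x * tmul p q) := by
  have h (a : A) (b : B) : vecTensor (gnsVec φ a) (gnsVec ψ b) =
      component φ ψ (tmul a b) (cycTensor φ ψ) := by
    rw [cycTensor_eq, component_tmul_vec, mul_one, mul_one]
  rw [h, h, inner_component_left, prodState, component_mul_apply, component_mul_apply, star_tmul]

theorem norm_component_cyc_sq (φ : State A) (ψ : State B) (x : MinTensor A B) :
    ((‖component φ ψ x (cycTensor φ ψ)‖ : ℂ)) ^ 2 = prodState φ ψ (star x * x) := by
  rw [prodState, component_mul_apply, ← inner_component_left]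
  exact (inner_self_eq_norm_sq_to_K (𝕜 := ℂ) (component φ ψ x (cycTensor φ ψ))).symm

/-- The product functional as a bounded functional. -/
def prodStateL (φ : State A) (ψ : State B) : MinTensor A B →L[ℂ] ℂ :=
  (innerSL ℂ (cycTensor φ ψ)).comp (actL φ ψ (cycTensor φ ψ))

theorem prodStateL_apply (φ : State A) (ψ : State B) (x : MinTensor A B) :
    prodStateL φ ψ x = prodState φ ψ x := rfl

end MinTensorBasic

end CStarMin

/-! ### Polarization and slice maps -/

namespace CStarMin

/-- Polarization of `(c, d) ↦ c* x d`. -/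
theorem star_mul_mul_eq_polarization {B : Type*} [Ring B] [StarRing B] [Algebra ℂ B]
    [StarModule ℂ B] (c x d : B) :
    star c * x * d = (4⁻¹ : ℂ) • (star (c + d) * x * (c + d)
      - Complex.I • (star (c + Complex.I • d) * x * (c + Complex.I • d))
      - star (c - d) * x * (c - d)
      + Complex.I • (star (c - Complex.I • d) * x * (c - Complex.I • d))) := by
  have hI : Complex.I * Complex.I = -1 := Complex.I_mul_I
  simp only [star_add, star_sub, star_smul, RCLike.star_def, Complex.conj_I, add_mul, mul_add,
    sub_mul, mul_sub, smul_mul_assoc, mul_smul_comm, smul_add, smul_sub, smul_smul, neg_smul,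
    smul_neg, neg_mul, hI]
  module

section

variable {A : Type*} [CStarAlgebra A] [PartialOrder A] [StarOrderedRing A]
variable {B : Type*} [CStarAlgebra B] [PartialOrder B] [StarOrderedRing B]

/-- The functional `φ(e* · e)` is a multiple of a state. -/
theorem State.exists_conjugate (φ : State A) (e : A) :
    ∃ (r : ℂ) (φ' : State A), ∀ a, φ.1 (star e * a * e) = r * φ'.1 a := by
  rcases eq_or_ne (φ.1 (star e * e)) 0 with h0 | h0
  · refine ⟨0, φ, fun a => ?_⟩
    have h1 : gnsVec φ e = 0 := by
      have := norm_gnsVec_sq φ e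
      rw [h0] at this
      exact norm_eq_zero.mp (by exact_mod_cast pow_eq_zero_iff two_ne_zero |>.mp this)
    rw [mul_assoc, ← inner_gnsVec, h1, inner_zero_left, zero_mul]
  · refine ⟨φ.1 (star e * e), State.mk' ((φ.1 (star e * e))⁻¹ •
      (φ.1.toLinearMap ∘ₗ LinearMap.mulRight ℂ e ∘ₗ LinearMap.mulLeft ℂ (star e))) ?_ ?_, ?_⟩
    · intro x
      have h2 : 0 ≤ (φ.1 (star e * e))⁻¹ := inv_nonneg.mpr (φ.apply_star_mul_self_nonneg e)
      have h3 := φ.apply_star_mul_self_nonneg (x * e)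
      rw [star_mul] at h3
      have h4 : star e * star x * (x * e) = star e * (star x * x) * e := by noncomm_ring
      rw [h4] at h3
      exact mul_nonneg h2 h3
    · change (φ.1 (star e * e))⁻¹ * φ.1 (star e * 1 * e) = 1
      rw [mul_one, inv_mul_cancel₀ h0]
    · intro a
      change _ = φ.1 (star e * e) * ((φ.1 (star e * e))⁻¹ * φ.1 (star e * a * e))
      rw [mul_inv_cancel_left₀ h0]

/-- States separate the points of a C*-algebra. -/
theorem eq_zero_of_state_apply [Nontrivial A] (a : A) (h : ∀ φ : State A, φ.1 a = 0) : a = 0 := by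
  refine eq_zero_of_state a fun φ => ?_
  have h1 (e : A) : φ.1 (star e * a * e) = 0 := by
    obtain ⟨r, φ', h'⟩ := φ.exists_conjugate e
    rw [h', h, mul_zero]
  have h2 : φ.1 (star a * a) = 0 := by
    have h3 := star_mul_mul_eq_polarization a a (1 : A)
    rw [mul_one] at h3
    rw [h3, map_smul, map_add, map_sub, map_sub, map_smul, map_smul, h1, h1, h1, h1]
    simp
  have := norm_gnsVec_sq φ a
  rw [h2] at this
  exact norm_eq_zero.mp (by exact_mod_cast pow_eq_zero_iff two_ne_zero |>.mp this)

theorem eq_of_state_apply [Nontrivial A] {a b : A} (h : ∀ φ : State A, φ.1 a = φ.1 b) : a = b :=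
  sub_eq_zero.mp (eq_zero_of_state_apply _ fun φ => by rw [map_sub, h, sub_self])

/-- The canonical map from the algebraic tensor product. -/
def algToMin : A ⊗[ℂ] B →ₗ[ℂ] MinTensor A B := TensorProduct.lift tmulₗ

theorem algToMin_tmul (a : A) (b : B) : algToMin (a ⊗ₜ[ℂ] b) = tmul a b :=
  TensorProduct.lift.tmul _ _

theorem denseRange_algToMin : DenseRange (algToMin : A ⊗[ℂ] B →ₗ[ℂ] MinTensor A B) := by
  refine dense_algTensor.mono ?_
  have : algTensor A B ≤ LinearMap.range (algToMin : A ⊗[ℂ] B →ₗ[ℂ] MinTensor A B) := by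
    refine Submodule.span_le.mpr ?_
    rintro _ ⟨a, b, rfl⟩
    exact ⟨a ⊗ₜ b, algToMin_tmul a b⟩
  exact this

/-- The algebraic slice map `a ⊗ b ↦ ψ(b) a`. -/
def algSliceR (ψ : State B) : A ⊗[ℂ] B →ₗ[ℂ] A :=
  TensorProduct.lift ((LinearMap.lsmul ℂ A).flip.compr₂ LinearMap.id |>.compl₂ ψ.1.toLinearMap)

theorem algSliceR_tmul (ψ : State B) (a : A) (b : B) :
    algSliceR ψ (a ⊗ₜ[ℂ] b) = ψ.1 b • a := rfl

/-- The algebraic slice map `a ⊗ b ↦ φ(a) b`. -/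
def algSliceL (φ : State A) : A ⊗[ℂ] B →ₗ[ℂ] B :=
  TensorProduct.lift ((LinearMap.lsmul ℂ B).comp φ.1.toLinearMap)

theorem algSliceL_tmul (φ : State A) (a : A) (b : B) :
    algSliceL φ (a ⊗ₜ[ℂ] b) = φ.1 a • b := rfl

/-- Choose φ whose GNS representation attains the norm of the slice. The inner products of Λ(c) with
the GNS vector of the slice are inner products of Λ(c) ⊗ Ω with t(Ω ⊗ Ω); Cauchy-Schwarz with c the
slice itself gives the bound that lets the slice map extend to the completion. -/
theorem norm_algSliceR_le [Nontrivial A] (ψ : State B) (t : A ⊗[ℂ] B) :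
    ‖algSliceR ψ t‖ ≤ ‖algToMin t‖ := by
  obtain ⟨φ, hφ⟩ := exists_norm_gnsVec_eq (algSliceR ψ t)
  have h (c : A) : ⟪vecTensor (gnsVec φ c) (cyc ψ), component φ ψ (algToMin t) (cycTensor φ ψ)⟫_ℂ
      = ⟪gnsVec φ c, gnsVec φ (algSliceR ψ t)⟫_ℂ := by
    rw [← actL_apply]
    clear hφ
    induction t using TensorProduct.induction_on with
    | zero => simp
    | tmul a b =>
      rw [algToMin_tmul, actL_apply, component_tmul, cycTensor, opTensor_vecTensor,
        inner_vecTensor, inner_cyc, algSliceR_tmul, map_smul, inner_smul_right, gnsVec_apply φ a,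
        mul_comm]
    | add x y hx hy => rw [map_add, map_add, map_add, map_add, inner_add_right, inner_add_right, hx, hy]
  have h1 := h (algSliceR ψ t)
  have h2 : ‖gnsVec φ (algSliceR ψ t)‖ ^ 2 ≤ ‖gnsVec φ (algSliceR ψ t)‖ * ‖algToMin t‖ := by
    have h3 : ((‖gnsVec φ (algSliceR ψ t)‖ ^ 2 : ℝ) : ℂ) =
        ⟪gnsVec φ (algSliceR ψ t), gnsVec φ (algSliceR ψ t)⟫_ℂ := by
      rw [inner_self_eq_norm_sq_to_K]; push_cast; rfl
    have h4 : ‖gnsVec φ (algSliceR ψ t)‖ ^ 2 =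
        ‖⟪gnsVec φ (algSliceR ψ t), gnsVec φ (algSliceR ψ t)⟫_ℂ‖ := by
      rw [← h3, Complex.norm_real, Real.norm_eq_abs, abs_sq]
    rw [h4, ← h1]
    refine (norm_inner_le_norm _ _).trans ?_
    rw [norm_vecTensor, norm_cyc, mul_one]
    refine mul_le_mul_of_nonneg_left ?_ (norm_nonneg _)
    refine ((component φ ψ (algToMin t)).le_opNorm _).trans ?_
    rw [norm_cycTensor, mul_one]
    exact norm_component_le φ ψ _
  rw [← hφ]
  rcases (norm_nonneg (gnsVec φ (algSliceR ψ t))).eq_or_lt with h0 | h0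
  · rw [← h0]; exact norm_nonneg _
  · rw [sq] at h2; exact le_of_mul_le_mul_left h2 h0

theorem norm_algSliceL_le [Nontrivial B] (φ : State A) (t : A ⊗[ℂ] B) :
    ‖algSliceL φ t‖ ≤ ‖algToMin t‖ := by
  obtain ⟨ψ, hψ⟩ := exists_norm_gnsVec_eq (algSliceL φ t)
  have h (c : B) : ⟪vecTensor (cyc φ) (gnsVec ψ c), component φ ψ (algToMin t) (cycTensor φ ψ)⟫_ℂ
      = ⟪gnsVec ψ c, gnsVec ψ (algSliceL φ t)⟫_ℂ := by
    rw [← actL_apply]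
    clear hψ
    induction t using TensorProduct.induction_on with
    | zero => simp
    | tmul a b =>
      rw [algToMin_tmul, actL_apply, component_tmul, cycTensor, opTensor_vecTensor,
        inner_vecTensor, inner_cyc, algSliceL_tmul, map_smul, inner_smul_right, gnsVec_apply ψ b]
    | add x y hx hy => rw [map_add, map_add, map_add, map_add, inner_add_right, inner_add_right, hx, hy]
  have h1 := h (algSliceL φ t)
  have h2 : ‖gnsVec ψ (algSliceL φ t)‖ ^ 2 ≤ ‖gnsVec ψ (algSliceL φ t)‖ * ‖algToMin t‖ := by
    have h3 : ((‖gnsVec ψ (algSliceL φ t)‖ ^ 2 : ℝ) : ℂ) =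
        ⟪gnsVec ψ (algSliceL φ t), gnsVec ψ (algSliceL φ t)⟫_ℂ := by
      rw [inner_self_eq_norm_sq_to_K]; push_cast; rfl
    have h4 : ‖gnsVec ψ (algSliceL φ t)‖ ^ 2 =
        ‖⟪gnsVec ψ (algSliceL φ t), gnsVec ψ (algSliceL φ t)⟫_ℂ‖ := by
      rw [← h3, Complex.norm_real, Real.norm_eq_abs, abs_sq]
    rw [h4, ← h1]
    refine (norm_inner_le_norm _ _).trans ?_
    rw [norm_vecTensor, norm_cyc, one_mul]
    refine mul_le_mul_of_nonneg_left ?_ (norm_nonneg _)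
    refine ((component φ ψ (algToMin t)).le_opNorm _).trans ?_
    rw [norm_cycTensor, mul_one]
    exact norm_component_le φ ψ _
  rw [← hψ]
  rcases (norm_nonneg (gnsVec ψ (algSliceL φ t))).eq_or_lt with h0 | h0
  · rw [← h0]; exact norm_nonneg _
  · rw [sq] at h2; exact le_of_mul_le_mul_left h2 h0

/-- The slice map `id ⊗ ψ`. -/
def sliceR (ψ : State B) : MinTensor A B →L[ℂ] A := (algSliceR ψ).extendOfNorm algToMin

/-- The slice map `φ ⊗ id`. -/
def sliceL (φ : State A) : MinTensor A B →L[ℂ] B := (algSliceL φ).extendOfNorm algToMin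

theorem sliceR_tmul [Nontrivial A] (ψ : State B) (a : A) (b : B) :
    sliceR ψ (tmul a b) = ψ.1 b • a := by
  rw [← algToMin_tmul]
  exact (LinearMap.extendOfNorm_eq denseRange_algToMin
    ⟨1, fun t => by rw [one_mul]; exact norm_algSliceR_le ψ t⟩ _).trans (algSliceR_tmul ψ a b)

theorem sliceL_tmul [Nontrivial B] (φ : State A) (a : A) (b : B) :
    sliceL φ (tmul a b) = φ.1 a • b := by
  rw [← algToMin_tmul]
  exact (LinearMap.extendOfNorm_eq denseRange_algToMin
    ⟨1, fun t => by rw [one_mul]; exact norm_algSliceL_le φ t⟩ _).trans (algSliceL_tmul φ a b)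

/-- A state as a bounded functional. -/
def State.clm (φ : State A) : A →L[ℂ] ℂ :=
  LinearMap.mkContinuous φ.1.toLinearMap 1 fun a => by
    rw [one_mul]; exact norm_state_apply_le φ a

theorem State.clm_apply (φ : State A) (a : A) : φ.clm a = φ.1 a := rfl

theorem state_sliceR [Nontrivial A] (φ : State A) (ψ : State B) (x : MinTensor A B) :
    φ.1 (sliceR ψ x) = prodState φ ψ x := by
  have h : φ.clm.comp (sliceR ψ) = prodStateL φ ψ := MinTensor.clm_ext fun a b => by
    rw [ContinuousLinearMap.comp_apply, sliceR_tmul, prodStateL_apply, prodState_tmul,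
      State.clm_apply, map_smul, smul_eq_mul, mul_comm]
  exact DFunLike.congr_fun h x

theorem state_sliceL [Nontrivial B] (φ : State A) (ψ : State B) (x : MinTensor A B) :
    ψ.1 (sliceL φ x) = prodState φ ψ x := by
  have h : ψ.clm.comp (sliceL φ) = prodStateL φ ψ := MinTensor.clm_ext fun a b => by
    rw [ContinuousLinearMap.comp_apply, sliceL_tmul, prodStateL_apply, prodState_tmul,
      State.clm_apply, map_smul, smul_eq_mul]
  exact DFunLike.congr_fun h x

/-- Left multiplication as a bounded map. -/
def mulLeftL {C : Type*} [NormedRing C] [NormedAlgebra ℂ C] (a : C) : C →L[ℂ] C :=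
  ContinuousLinearMap.mul ℂ C a

/-- Right multiplication as a bounded map. -/
def mulRightL {C : Type*} [NormedRing C] [NormedAlgebra ℂ C] (a : C) : C →L[ℂ] C :=
  (ContinuousLinearMap.mul ℂ C).flip a

theorem sliceR_mul [Nontrivial A] (ψ : State B) (a c : A) (x : MinTensor A B) :
    sliceR ψ (tmul a 1 * x * tmul c 1) = a * sliceR ψ x * c := by
  have h : (sliceR ψ).comp ((mulRightL (tmul c 1)).comp (mulLeftL (tmul a 1))) =
      (mulRightL c).comp ((mulLeftL a).comp (sliceR ψ)) := MinTensor.clm_ext fun p q => by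
    change sliceR ψ (tmul a 1 * tmul p q * tmul c 1) = a * sliceR ψ (tmul p q) * c
    rw [tmul_mul_tmul, tmul_mul_tmul, one_mul, mul_one, sliceR_tmul, sliceR_tmul, mul_smul_comm,
      smul_mul_assoc]
  exact DFunLike.congr_fun h x

theorem sliceL_mul [Nontrivial B] (φ : State A) (b d : B) (x : MinTensor A B) :
    sliceL φ (tmul 1 b * x * tmul 1 d) = b * sliceL φ x * d := by
  have h : (sliceL φ).comp ((mulRightL (tmul 1 d)).comp (mulLeftL (tmul 1 b))) =
      (mulRightL d).comp ((mulLeftL b).comp (sliceL φ)) := MinTensor.clm_ext fun p q => by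
    change sliceL φ (tmul 1 b * tmul p q * tmul 1 d) = b * sliceL φ (tmul p q) * d
    rw [tmul_mul_tmul, tmul_mul_tmul, one_mul, mul_one, sliceL_tmul, sliceL_tmul, mul_smul_comm,
      smul_mul_assoc]
  exact DFunLike.congr_fun h x

theorem sliceR_one [Nontrivial A] (ψ : State B) : sliceR ψ (1 : MinTensor A B) = 1 := by
  rw [← tmul_one_one, sliceR_tmul, ψ.2, one_smul]

theorem sliceL_one [Nontrivial B] (φ : State A) : sliceL φ (1 : MinTensor A B) = 1 := by
  rw [← tmul_one_one, sliceL_tmul, φ.2, one_smul]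

end

end CStarMin

/-! ### Limits and averages of states -/

namespace CStarMin

section

variable {A : Type*} [CStarAlgebra A] [PartialOrder A] [StarOrderedRing A]
variable {B : Type*} [CStarAlgebra B] [PartialOrder B] [StarOrderedRing B]

theorem State.ext {φ ψ : State A} (h : ∀ a, φ.1 a = ψ.1 a) : φ = ψ :=
  Subtype.ext (PositiveLinearMap.ext h)

/-- A pointwise limit of states along an ultrafilter is a state. -/
theorem State.exists_ultralimit {ι : Type*} (U : Ultrafilter ι) (ψ : ι → State A) :
    ∃ φ : State A, ∀ a, Filter.Tendsto (fun i => (ψ i).1 a) U (nhds (φ.1 a)) := by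
  have h (a : A) : ∃ z : ℂ, Filter.Tendsto (fun i => (ψ i).1 a) U (nhds z) := by
    have hc := (isCompact_closedBall (0 : ℂ) ‖a‖).ultrafilter_le_nhds
      (U.map fun i => (ψ i).1 a) (by
        rw [Filter.le_principal_iff]
        exact Filter.mem_map.mpr (Filter.univ_mem' fun i => by
          simpa using norm_state_apply_le (ψ i) a))
    obtain ⟨z, -, hz⟩ := hc
    exact ⟨z, hz⟩
  choose f hf using h
  refine ⟨State.mk'
    { toFun := f
      map_add' := fun a b => tendsto_nhds_unique (hf (a + b)) (by
        simpa only [map_add] using (hf a).add (hf b))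
      map_smul' := fun c a => tendsto_nhds_unique (hf (c • a)) (by
        simp only [map_smul]
        exact (hf a).const_smul c) } (fun x => ?_) ?_, hf⟩
  · exact ge_of_tendsto (hf (star x * x))
      (Filter.Eventually.of_forall fun i => (ψ i).apply_star_mul_self_nonneg x)
  · refine tendsto_nhds_unique (hf 1) ?_
    simp only [(ψ _).2]
    exact tendsto_const_nhds

/-- The average of finitely many states is a state. -/
theorem State.exists_average {ι : Type*} (s : Finset ι) (hs : s.Nonempty) (ψ : ι → State A) :
    ∃ φ : State A, ∀ a, φ.1 a = (s.card : ℂ)⁻¹ * ∑ i ∈ s, (ψ i).1 a := by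
  refine ⟨State.mk' ((s.card : ℂ)⁻¹ • ∑ i ∈ s, (ψ i).1.toLinearMap) (fun x => ?_) ?_, fun a => ?_⟩
  · rw [LinearMap.smul_apply, LinearMap.sum_apply]
    exact mul_nonneg (inv_nonneg.mpr (Nat.cast_nonneg _))
      (Finset.sum_nonneg fun i _ => (ψ i).apply_star_mul_self_nonneg x)
  · rw [LinearMap.smul_apply, LinearMap.sum_apply]
    have : ∀ i, (ψ i).1.toLinearMap 1 = 1 := fun i => (ψ i).2
    simp only [this, Finset.sum_const, nsmul_eq_mul, mul_one, smul_eq_mul]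
    exact inv_mul_cancel₀ (Nat.cast_ne_zero.mpr hs.card_pos.ne')
  · rw [State.mk'_apply, LinearMap.smul_apply, LinearMap.sum_apply]; rfl

theorem prodState_apply_star (φ : State A) (ψ : State B) (x : MinTensor A B) :
    prodState φ ψ (star x) = star (prodState φ ψ x) := by
  rw [prodState, ← inner_component_left, ← inner_conj_symm]; rfl

theorem sliceR_star [Nontrivial A] (ψ : State B) (x : MinTensor A B) :
    sliceR ψ (star x) = star (sliceR ψ x) :=
  eq_of_state_apply fun φ => by
    rw [state_sliceR, prodState_apply_star, φ.apply_star, state_sliceR]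

theorem sliceL_star [Nontrivial B] (φ : State A) (x : MinTensor A B) :
    sliceL φ (star x) = star (sliceL φ x) :=
  eq_of_state_apply fun ψ => by
    rw [state_sliceL, prodState_apply_star, ψ.apply_star, state_sliceL]

theorem dense_of_star_mem {s t : Set (MinTensor A B)} (hs : Dense s) (h : ∀ x ∈ s, star x ∈ t) :
    Dense t := by
  intro x
  have hx := hs (star x)
  rw [Metric.mem_closure_iff] at hx ⊢
  intro ε hε
  obtain ⟨y, hy, hxy⟩ := hx ε hε
  refine ⟨star y, h y hy, ?_⟩
  rwa [dist_eq_norm, ← norm_star, star_sub, star_star, ← dist_eq_norm]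

theorem component_cyc_eq_zero_iff (φ : State A) (ψ : State B) (x : MinTensor A B) :
    component φ ψ x (cycTensor φ ψ) = 0 ↔ prodState φ ψ (star x * x) = 0 := by
  rw [← norm_component_cyc_sq]
  simp

end

end CStarMin

/-! ### Convolution operators and the Haar state -/

namespace CompactQuantumGroup

variable {A : Type*} [CStarAlgebra A] [PartialOrder A] [StarOrderedRing A] [Nontrivial A]
  (G : CompactQuantumGroup A)

/-- The operator `(φ ⊗ id)Δ`. -/
def lop (φ : State A) : A →ₗ[ℂ] A := (sliceL φ).toLinearMap ∘ₗ G.comul.toAlgHom.toLinearMap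

/-- The operator `(id ⊗ ψ)Δ`. -/
def rop (ψ : State A) : A →ₗ[ℂ] A := (sliceR ψ).toLinearMap ∘ₗ G.comul.toAlgHom.toLinearMap

theorem lop_apply (φ : State A) (a : A) : G.lop φ a = sliceL φ (G.comul a) := rfl

theorem rop_apply (ψ : State A) (a : A) : G.rop ψ a = sliceR ψ (G.comul a) := rfl

theorem state_lop (φ ψ : State A) (a : A) : ψ.1 (G.lop φ a) = (conv G.comul φ ψ).1 a := by
  rw [lop_apply, state_sliceL, conv_apply]

theorem state_rop (φ ψ : State A) (a : A) : φ.1 (G.rop ψ a) = (conv G.comul φ ψ).1 a := by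
  rw [rop_apply, state_sliceR, conv_apply]

/-- Tested against states, this and the next two identities are instances of coassociativity. In
particular left and right convolution operators commute. -/
theorem rop_rop (φ ψ : State A) (a : A) :
    G.rop φ (G.rop ψ a) = G.rop (conv G.comul φ ψ) a :=
  eq_of_state_apply fun χ => by rw [state_rop, state_rop, state_rop, G.coassoc]

theorem lop_lop (φ ψ : State A) (a : A) :
    G.lop φ (G.lop ψ a) = G.lop (conv G.comul ψ φ) a :=
  eq_of_state_apply fun χ => by rw [state_lop, state_lop, state_lop, G.coassoc]

theorem lop_rop (φ ψ : State A) (a : A) : G.lop φ (G.rop ψ a) = G.rop ψ (G.lop φ a) :=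
  eq_of_state_apply fun χ => by rw [state_lop, state_rop, state_rop, state_lop, G.coassoc]

theorem rop_star (ψ : State A) (a : A) : G.rop ψ (star a) = star (G.rop ψ a) := by
  rw [rop_apply, map_star, sliceR_star, rop_apply]

theorem lop_star (φ : State A) (a : A) : G.lop φ (star a) = star (G.lop φ a) := by
  rw [lop_apply, map_star, sliceL_star, lop_apply]

theorem dense_left' : Dense
    (Submodule.span ℂ {x | ∃ a b : A, x = tmul b 1 * G.comul a} : Set (MinTensor A A)) := by
  refine dense_of_star_mem G.dense_left fun x hx => ?_
  induction hx using Submodule.span_induction with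
  | mem x hx =>
    obtain ⟨a, b, rfl⟩ := hx
    exact Submodule.subset_span ⟨star a, star b, by rw [star_mul, star_tmul, star_one, map_star]⟩
  | zero => rw [star_zero]; exact zero_mem _
  | add x y _ _ h1 h2 => rw [star_add]; exact add_mem h1 h2
  | smul c x _ h => rw [star_smul]; exact Submodule.smul_mem _ _ h

theorem dense_right' : Dense
    (Submodule.span ℂ {x | ∃ a b : A, x = tmul 1 b * G.comul a} : Set (MinTensor A A)) := by
  refine dense_of_star_mem G.dense_right fun x hx => ?_
  induction hx using Submodule.span_induction with
  | mem x hx =>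
    obtain ⟨a, b, rfl⟩ := hx
    exact Submodule.subset_span ⟨star a, star b, by rw [star_mul, star_tmul, star_one, map_star]⟩
  | zero => rw [star_zero]; exact zero_mem _
  | add x y _ _ h1 h2 => rw [star_add]; exact add_mem h1 h2
  | smul c x _ h => rw [star_smul]; exact Submodule.smul_mem _ _ h

/-- For every state `ω` there is a state `h` with `ω * h = h = h * ω`. -/
theorem exists_conv_invariant (ω : State A) :
    ∃ h : State A, conv G.comul ω h = h ∧ conv G.comul h ω = h := by
  -- The state `w k` is the convolution power of ω of exponent k + 1. Its Cesàro means are invariant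
  -- up to O(1/N) by telescoping, so any ultralimit of them is invariant.
  let w : ℕ → State A := fun k => (conv G.comul ω)^[k] ω
  have hw1 (k : ℕ) : conv G.comul ω (w k) = w (k + 1) :=
    (Function.iterate_succ_apply' (conv G.comul ω) k ω).symm
  have hw2 (k : ℕ) : conv G.comul (w k) ω = w (k + 1) := by
    induction k with
    | zero => rfl
    | succ k ih => rw [← hw1 k, G.coassoc, ih, hw1]
  choose m hm using fun N : ℕ =>
    State.exists_average (Finset.range (N + 1)) ⟨0, by simp⟩ w
  obtain ⟨h, hh⟩ := State.exists_ultralimit (Filter.hyperfilter ℕ) m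
  have hle : (Filter.hyperfilter ℕ : Filter ℕ) ≤ Filter.atTop := by
    rw [← Nat.cofinite_eq_atTop]; exact Filter.hyperfilter_le_cofinite
  have key (T : A → A) (hT : ∀ k a, (w k).1 (T a) = (w (k + 1)).1 a) (a : A) :
      h.1 (T a) = h.1 a := by
    have h0 : Filter.Tendsto (fun N : ℕ => (m N).1 (T a) - (m N).1 a)
        (Filter.hyperfilter ℕ) (nhds 0) := by
      refine Filter.Tendsto.mono_left ?_ hle
      refine squeeze_zero_norm (a := fun N : ℕ => 2 * ‖a‖ * (1 / ((N : ℝ) + 1))) (fun N => ?_) ?_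
      · have e : (m N).1 (T a) - (m N).1 a =
            ((N + 1 : ℕ) : ℂ)⁻¹ * ((w (N + 1)).1 a - (w 0).1 a) := by
          rw [hm, hm, Finset.card_range, ← mul_sub, ← Finset.sum_sub_distrib]
          congr 1
          simp only [hT]
          exact Finset.sum_range_sub (fun k => (w k).1 a) (N + 1)
        rw [e, norm_mul, norm_inv, Complex.norm_natCast, mul_comm, one_div]
        push_cast
        refine mul_le_mul_of_nonneg_right ?_ (by positivity)
        refine (norm_sub_le _ _).trans ?_
        rw [two_mul]
        exact add_le_add (norm_state_apply_le _ a) (norm_state_apply_le _ a)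
      · have := (tendsto_one_div_add_atTop_nhds_zero_nat (𝕜 := ℝ)).const_mul (2 * ‖a‖)
        rwa [mul_zero] at this
    have h1 := (hh (T a)).sub (hh a)
    exact sub_eq_zero.mp (tendsto_nhds_unique h1 h0)
  refine ⟨h, State.ext fun a => ?_, State.ext fun a => ?_⟩
  · rw [← state_lop]
    exact key (G.lop ω) (fun k a => by rw [state_lop, hw1]) a
  · rw [← state_rop]
    exact key (G.rop ω) (fun k a => by rw [state_rop, hw2]) a

/-- Invariance under an average passes to each averaged state. For b = (id ⊗ h)Δ(a) and y = Δ(b) − b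
⊗ 1, invariance gives (h ⊗ ω)(y*y) = 0. As ω is an average of states, each (h ⊗ φ)(y*y) vanishes
too, so y annihilates the cyclic vector of h ⊗ φ. Pairing with c ⊗ 1 compares h ⊗ (φ ∗ h) with h ⊗ h
on (c ⊗ 1)Δ(a), and these elements span a dense subspace. -/
theorem conv_left_eq_of_average {s : Finset (State A)} {ω h : State A} (hs : s.Nonempty)
    (hω : ∀ a, ω.1 a = (s.card : ℂ)⁻¹ * ∑ i ∈ s, i.1 a) (h1 : conv G.comul ω h = h)
    (h2 : conv G.comul h ω = h) {φ : State A} (hφ : φ ∈ s) : conv G.comul φ h = h := by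
  have hc : (s.card : ℂ) ≠ 0 := Nat.cast_ne_zero.mpr hs.card_pos.ne'
  have key (a : A) : component h φ (G.comul (G.rop h a) - tmul (G.rop h a) 1) (cycTensor h φ)
      = 0 := by
    set b := G.rop h a with hb
    have hbω : G.rop ω b = b := by rw [hb, rop_rop, h1]
    set y := G.comul b - tmul b 1 with hy
    -- Both cross terms collapse to b*b because (id ⊗ ω)Δ fixes b.
    have e1 : sliceR ω (star y * y) = G.rop ω (star b * b) - star b * b := by
      have : star y * y = G.comul (star b * b) - tmul 1 1 * G.comul (star b) * tmul b 1
          - tmul (star b) 1 * G.comul b * tmul 1 1 + tmul (star b) 1 * 1 * tmul b 1 := by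
        rw [hy, star_sub, star_tmul, star_one, tmul_one_one, map_mul, map_star]
        noncomm_ring
      rw [this, map_add, map_sub, map_sub, sliceR_mul, sliceR_mul, sliceR_mul, sliceR_one,
        ← rop_apply, ← rop_apply, ← rop_apply, rop_star, hbω]
      noncomm_ring
    have e2 : prodState h ω (star y * y) = 0 := by
      rw [← state_sliceR, e1, map_sub, state_rop, h2, sub_self]
    rw [component_cyc_eq_zero_iff]
    rw [← state_sliceL, hω] at e2
    have e3 := (mul_eq_zero.mp e2).resolve_left (inv_ne_zero hc)
    have e4 := (Finset.sum_eq_zero_iff_of_nonneg (fun i _ => by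
      rw [state_sliceL]; exact prodState_star_mul_self_nonneg _ _ _)).mp e3 φ hφ
    rwa [state_sliceL] at e4
  have hext : prodStateL h (conv G.comul φ h) = prodStateL h h := by
    refine ContinuousLinearMap.ext_on G.dense_left' ?_
    rintro _ ⟨a, c, rfl⟩
    have e1 : prodState h φ (tmul c 1 * (G.comul (G.rop h a) - tmul (G.rop h a) 1)) = 0 := by
      rw [prodState, component_mul_apply, key, map_zero, inner_zero_right]
    have e2 : tmul c 1 * (G.comul (G.rop h a) - tmul (G.rop h a) 1) =
        tmul c 1 * G.comul (G.rop h a) * tmul 1 1 - tmul c 1 * 1 * tmul (G.rop h a) 1 := by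
      rw [tmul_one_one]; noncomm_ring
    rw [e2, ← state_sliceR, map_sub, sliceR_mul, sliceR_mul, ← rop_apply, rop_rop, map_sub,
      sub_eq_zero, sliceR_one] at e1
    rw [prodStateL_apply, prodStateL_apply, ← state_sliceR, ← state_sliceR,
      ← mul_one (tmul c 1 * G.comul a), ← tmul_one_one, sliceR_mul, sliceR_mul, ← rop_apply,
      ← rop_apply, e1]
    simp
  refine State.ext fun d => ?_
  have := DFunLike.congr_fun hext (tmul 1 d)
  rwa [prodStateL_apply, prodStateL_apply, prodState_tmul, prodState_tmul, h.2, one_mul,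
    one_mul] at this

/-- The mirror image of `conv_left_eq_of_average`, resting on the other density axiom. -/
theorem conv_right_eq_of_average {s : Finset (State A)} {ω h : State A} (hs : s.Nonempty)
    (hω : ∀ a, ω.1 a = (s.card : ℂ)⁻¹ * ∑ i ∈ s, i.1 a) (h1 : conv G.comul ω h = h)
    (h2 : conv G.comul h ω = h) {φ : State A} (hφ : φ ∈ s) : conv G.comul h φ = h := by
  have hc : (s.card : ℂ) ≠ 0 := Nat.cast_ne_zero.mpr hs.card_pos.ne'
  have key (a : A) : component φ h (G.comul (G.lop h a) - tmul 1 (G.lop h a)) (cycTensor φ h)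
      = 0 := by
    set b := G.lop h a with hb
    have hbω : G.lop ω b = b := by rw [hb, lop_lop, h2]
    set y := G.comul b - tmul 1 b with hy
    have e1 : sliceL ω (star y * y) = G.lop ω (star b * b) - star b * b := by
      have : star y * y = G.comul (star b * b) - tmul 1 1 * G.comul (star b) * tmul 1 b
          - tmul 1 (star b) * G.comul b * tmul 1 1 + tmul 1 (star b) * 1 * tmul 1 b := by
        rw [hy, star_sub, star_tmul, star_one, tmul_one_one, map_mul, map_star]
        noncomm_ring
      rw [this, map_add, map_sub, map_sub, sliceL_mul, sliceL_mul, sliceL_mul, sliceL_one,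
        ← lop_apply, ← lop_apply, ← lop_apply, lop_star, hbω]
      noncomm_ring
    have e2 : prodState ω h (star y * y) = 0 := by
      rw [← state_sliceL, e1, map_sub, state_lop, h1, sub_self]
    rw [component_cyc_eq_zero_iff]
    rw [← state_sliceR, hω] at e2
    have e3 := (mul_eq_zero.mp e2).resolve_left (inv_ne_zero hc)
    have e4 := (Finset.sum_eq_zero_iff_of_nonneg (fun i _ => by
      rw [state_sliceR]; exact prodState_star_mul_self_nonneg _ _ _)).mp e3 φ hφ
    rwa [state_sliceR] at e4
  have hext : prodStateL (conv G.comul h φ) h = prodStateL h h := by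
    refine ContinuousLinearMap.ext_on G.dense_right' ?_
    rintro _ ⟨a, c, rfl⟩
    have e1 : prodState φ h (tmul 1 c * (G.comul (G.lop h a) - tmul 1 (G.lop h a))) = 0 := by
      rw [prodState, component_mul_apply, key, map_zero, inner_zero_right]
    have e2 : tmul 1 c * (G.comul (G.lop h a) - tmul 1 (G.lop h a)) =
        tmul 1 c * G.comul (G.lop h a) * tmul 1 1 - tmul 1 c * 1 * tmul 1 (G.lop h a) := by
      rw [tmul_one_one]; noncomm_ring
    rw [e2, ← state_sliceL, map_sub, sliceL_mul, sliceL_mul, ← lop_apply, lop_lop, map_sub,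
      sub_eq_zero, sliceL_one] at e1
    rw [prodStateL_apply, prodStateL_apply, ← state_sliceL, ← state_sliceL,
      ← mul_one (tmul 1 c * G.comul a), ← tmul_one_one, sliceL_mul, sliceL_mul, ← lop_apply,
      ← lop_apply, e1]
    simp
  refine State.ext fun d => ?_
  have := DFunLike.congr_fun hext (tmul d 1)
  rwa [prodStateL_apply, prodStateL_apply, prodState_tmul, prodState_tmul, h.2, mul_one,
    mul_one] at this

/-- `h` is the Haar state: it is invariant under convolution with every state. -/
structure IsHaar (h : State A) : Prop where
  left : ∀ φ : State A, conv G.comul φ h = h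
  right : ∀ φ : State A, conv G.comul h φ = h

/-- Existence of the Haar state. -/
theorem exists_isHaar : ∃ h : State A, G.IsHaar h := by
  classical
  have hex (s : Finset (State A)) : ∃ h : State A,
      ∀ φ ∈ s, conv G.comul φ h = h ∧ conv G.comul h φ = h := by
    rcases s.eq_empty_or_nonempty with rfl | hs
    · exact ⟨Classical.arbitrary _, by simp⟩
    obtain ⟨ω, hω⟩ := State.exists_average s hs id
    obtain ⟨h, h1, h2⟩ := G.exists_conv_invariant ω
    exact ⟨h, fun φ hφ => ⟨G.conv_left_eq_of_average hs hω h1 h2 hφ,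
      G.conv_right_eq_of_average hs hω h1 h2 hφ⟩⟩
  choose k hk using hex
  -- Along an ultrafilter finer than the inclusion order on finite sets, each given state eventually
  -- belongs to the set, so the limit is invariant under all states at once.
  let U : Ultrafilter (Finset (State A)) := Ultrafilter.of Filter.atTop
  have hU : (U : Filter (Finset (State A))) ≤ Filter.atTop := Ultrafilter.of_le _
  obtain ⟨h, hh⟩ := State.exists_ultralimit U k
  refine ⟨h, fun φ => State.ext fun a => ?_, fun φ => State.ext fun a => ?_⟩
  · rw [← state_lop]
    refine tendsto_nhds_unique (hh (G.lop φ a)) ((hh a).congr' ?_)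
    filter_upwards [hU (Filter.eventually_ge_atTop {φ})] with s hs
    rw [state_lop, (hk s φ (hs (Finset.mem_singleton_self φ))).1]
  · rw [← state_rop]
    refine tendsto_nhds_unique (hh (G.rop φ a)) ((hh a).congr' ?_)
    filter_upwards [hU (Filter.eventually_ge_atTop {φ})] with s hs
    rw [state_rop, (hk s φ (hs (Finset.mem_singleton_self φ))).2]

end CompactQuantumGroup

/-! ### Convolution operators on the GNS space of the Haar state -/

namespace CompactQuantumGroup

variable {A : Type*} [CStarAlgebra A] [PartialOrder A] [StarOrderedRing A] [Nontrivial A]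
  (G : CompactQuantumGroup A)

/-- The span of the operators `(φ ⊗ id)Δ` for states `φ`. -/
def lopSpan : Submodule ℂ (A →ₗ[ℂ] A) := Submodule.span ℂ (Set.range G.lop)

/-- The span of the operators `(id ⊗ ψ)Δ` for states `ψ`. -/
def ropSpan : Submodule ℂ (A →ₗ[ℂ] A) := Submodule.span ℂ (Set.range G.rop)

/-- The operator `(φ(c* · d) ⊗ id)Δ`. -/
def lopVec (φ : State A) (c d : A) : A →ₗ[ℂ] A :=
  (sliceL φ).toLinearMap ∘ₗ LinearMap.mulRight ℂ (tmul d 1) ∘ₗ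
    LinearMap.mulLeft ℂ (tmul (star c) 1) ∘ₗ G.comul.toAlgHom.toLinearMap

/-- The operator `(id ⊗ ψ(c* · d))Δ`. -/
def ropVec (ψ : State A) (c d : A) : A →ₗ[ℂ] A :=
  (sliceR ψ).toLinearMap ∘ₗ LinearMap.mulRight ℂ (tmul 1 d) ∘ₗ
    LinearMap.mulLeft ℂ (tmul 1 (star c)) ∘ₗ G.comul.toAlgHom.toLinearMap

theorem lopVec_apply (φ : State A) (c d a : A) :
    G.lopVec φ c d a = sliceL φ (tmul (star c) 1 * G.comul a * tmul d 1) := rfl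

theorem ropVec_apply (ψ : State A) (c d a : A) :
    G.ropVec ψ c d a = sliceR ψ (tmul 1 (star c) * G.comul a * tmul 1 d) := rfl

/-- For c = d the functional φ(c* · c) is a multiple of a state; polarization reduces the general
case to this one. -/
theorem lopVec_mem (φ : State A) (c d : A) : G.lopVec φ c d ∈ G.lopSpan := by
  have hdiag (e : A) : G.lopVec φ e e ∈ G.lopSpan := by
    obtain ⟨r, φ', h⟩ := φ.exists_conjugate e
    have : G.lopVec φ e e = r • G.lop φ' := by
      refine LinearMap.ext fun a => eq_of_state_apply fun ψ => ?_
      rw [lopVec_apply, state_sliceL, ← state_sliceR, sliceR_mul, h, LinearMap.smul_apply,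
        map_smul, lop_apply, state_sliceL, state_sliceR, smul_eq_mul]
    rw [this]
    exact Submodule.smul_mem _ _ (Submodule.subset_span ⟨φ', rfl⟩)
  have : G.lopVec φ c d = (4⁻¹ : ℂ) • (G.lopVec φ (c + d) (c + d)
      - Complex.I • G.lopVec φ (c + Complex.I • d) (c + Complex.I • d)
      - G.lopVec φ (c - d) (c - d)
      + Complex.I • G.lopVec φ (c - Complex.I • d) (c - Complex.I • d)) := by
    refine LinearMap.ext fun a => ?_
    have e1 (e : A) : G.lopVec φ e e a =
        sliceL φ (star (tmul e 1) * G.comul a * tmul e 1) := by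
      rw [lopVec_apply, star_tmul, star_one]
    simp only [LinearMap.smul_apply, LinearMap.add_apply, LinearMap.sub_apply, e1]
    have e2 := star_mul_mul_eq_polarization (tmul c (1 : A)) (G.comul a) (tmul d 1)
    have hs : tmul (c - d) (1 : A) = tmul c 1 - tmul d 1 := by
      rw [sub_eq_add_neg, sub_eq_add_neg, ← neg_one_smul ℂ d, tmul_add_left, tmul_smul_left,
        neg_one_smul]
    have hsI : tmul (c - Complex.I • d) (1 : A) = tmul c 1 - Complex.I • tmul d 1 := by
      rw [sub_eq_add_neg, sub_eq_add_neg, ← neg_smul, tmul_add_left, tmul_smul_left, neg_smul]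
    rw [tmul_add_left, tmul_add_left, hs, hsI, tmul_smul_left, ← map_smul, ← map_smul, ← map_sub,
      ← map_sub, ← map_add, ← map_smul, ← e2, lopVec_apply, star_tmul, star_one]
  rw [this]
  exact Submodule.smul_mem _ _ (Submodule.add_mem _ (Submodule.sub_mem _ (Submodule.sub_mem _
    (hdiag _) (Submodule.smul_mem _ _ (hdiag _))) (hdiag _)) (Submodule.smul_mem _ _ (hdiag _)))

theorem ropVec_mem (ψ : State A) (c d : A) : G.ropVec ψ c d ∈ G.ropSpan := by
  have hdiag (e : A) : G.ropVec ψ e e ∈ G.ropSpan := by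
    obtain ⟨r, ψ', h⟩ := ψ.exists_conjugate e
    have : G.ropVec ψ e e = r • G.rop ψ' := by
      refine LinearMap.ext fun a => eq_of_state_apply fun φ => ?_
      rw [ropVec_apply, state_sliceR, ← state_sliceL, sliceL_mul, h, LinearMap.smul_apply,
        map_smul, rop_apply, state_sliceL, state_sliceR, smul_eq_mul]
    rw [this]
    exact Submodule.smul_mem _ _ (Submodule.subset_span ⟨ψ', rfl⟩)
  have : G.ropVec ψ c d = (4⁻¹ : ℂ) • (G.ropVec ψ (c + d) (c + d)
      - Complex.I • G.ropVec ψ (c + Complex.I • d) (c + Complex.I • d)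
      - G.ropVec ψ (c - d) (c - d)
      + Complex.I • G.ropVec ψ (c - Complex.I • d) (c - Complex.I • d)) := by
    refine LinearMap.ext fun a => ?_
    have e1 (e : A) : G.ropVec ψ e e a =
        sliceR ψ (star (tmul 1 e) * G.comul a * tmul 1 e) := by
      rw [ropVec_apply, star_tmul, star_one]
    simp only [LinearMap.smul_apply, LinearMap.add_apply, LinearMap.sub_apply, e1]
    have e2 := star_mul_mul_eq_polarization (tmul (1 : A) c) (G.comul a) (tmul 1 d)
    have hs : tmul (1 : A) (c - d) = tmul 1 c - tmul 1 d := by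
      rw [sub_eq_add_neg, sub_eq_add_neg, ← neg_one_smul ℂ d, tmul_add_right, tmul_smul_right,
        neg_one_smul]
    have hsI : tmul (1 : A) (c - Complex.I • d) = tmul 1 c - Complex.I • tmul 1 d := by
      rw [sub_eq_add_neg, sub_eq_add_neg, ← neg_smul, tmul_add_right, tmul_smul_right, neg_smul]
    rw [tmul_add_right, tmul_add_right, hs, hsI, tmul_smul_right, ← map_smul, ← map_smul,
      ← map_sub, ← map_sub, ← map_add, ← map_smul, ← e2, ropVec_apply, star_tmul, star_one]
  rw [this]
  exact Submodule.smul_mem _ _ (Submodule.add_mem _ (Submodule.sub_mem _ (Submodule.sub_mem _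
    (hdiag _) (Submodule.smul_mem _ _ (hdiag _))) (hdiag _)) (Submodule.smul_mem _ _ (hdiag _)))

theorem lopSpan_comm_ropSpan {L R : A →ₗ[ℂ] A} (hL : L ∈ G.lopSpan) (hR : R ∈ G.ropSpan) (a : A) :
    L (R a) = R (L a) := by
  induction hL using Submodule.span_induction with
  | mem L hL =>
    obtain ⟨φ, rfl⟩ := hL
    induction hR using Submodule.span_induction with
    | mem R hR => obtain ⟨ψ, rfl⟩ := hR; exact G.lop_rop φ ψ a
    | zero => simp
    | add x y _ _ h1 h2 => simp only [LinearMap.add_apply, map_add, h1, h2]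
    | smul c x _ h => simp only [LinearMap.smul_apply, map_smul, h]
  | zero => simp
  | add x y _ _ h1 h2 => simp only [LinearMap.add_apply, map_add, h1, h2]
  | smul c x _ h => simp only [LinearMap.smul_apply, map_smul, h]

variable {G} {h : State A} (hh : G.IsHaar h)

include hh

/-- A form of right invariance that is linear in R, so that it extends from states to the
functionals ψ(c* · d). -/
theorem IsHaar.apply_ropSpan {R : A →ₗ[ℂ] A} (hR : R ∈ G.ropSpan) (a : A) :
    h.1 (R a) • (1 : A) = h.1 a • R 1 := by
  induction hR using Submodule.span_induction with
  | mem R hR =>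
    obtain ⟨ψ, rfl⟩ := hR
    rw [state_rop, hh.right, rop_apply, map_one, sliceR_one]
  | zero => simp
  | add x y _ _ h1 h2 => simp only [LinearMap.add_apply, map_add, add_smul, smul_add, h1, h2]
  | smul c x _ h =>
    simp only [LinearMap.smul_apply, map_smul, smul_eq_mul]
    rw [mul_smul, h, smul_comm]

theorem IsHaar.apply_ropVec (ψ : State A) (c d a : A) :
    h.1 (G.ropVec ψ c d a) = h.1 a * ψ.1 (star c * d) := by
  have h1 := hh.apply_ropSpan (G.ropVec_mem ψ c d) a
  rw [ropVec_apply G ψ c d 1, map_one, mul_one, tmul_mul_tmul, one_mul, sliceR_tmul, smul_smul] at h1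
  have := congrArg h.1 h1
  rwa [map_smul, map_smul, h.2, smul_eq_mul, smul_eq_mul, mul_one, mul_one] at this

theorem IsHaar.norm_comul_cyc (φ : State A) (a : A) :
    ‖component φ h (G.comul a) (cycTensor φ h)‖ = ‖gnsVec h a‖ := by
  have h1 := norm_component_cyc_sq φ h (G.comul a)
  rw [← map_star, ← map_mul, ← conv_apply, hh.left, ← norm_gnsVec_sq] at h1
  have h2 : ‖component φ h (G.comul a) (cycTensor φ h)‖ ^ 2 = ‖gnsVec h a‖ ^ 2 := by
    exact_mod_cast h1
  exact (pow_left_inj₀ (norm_nonneg _) (norm_nonneg _) two_ne_zero).mp h2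

omit hh in
theorem inner_gnsVec_lop (φ ψ : State A) (d a : A) :
    ⟪gnsVec ψ d, gnsVec ψ (G.lop φ a)⟫_ℂ =
      ⟪vecTensor (cyc φ) (gnsVec ψ d), component φ ψ (G.comul a) (cycTensor φ ψ)⟫_ℂ := by
  rw [inner_gnsVec, cycTensor_eq, ← gnsVec_one φ, inner_vec_component_vec, ← state_sliceL, star_one,
    sliceL_mul, mul_one, lop_apply]

/-- The operator is Λ(a) ↦ Δ(a)(Ω ⊗ Ω), isometric by left invariance, followed by pairing the first
leg with a unit vector. -/
theorem IsHaar.norm_lop_le (φ : State A) (a : A) :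
    ‖gnsVec h (G.lop φ a)‖ ≤ ‖gnsVec h a‖ := by
  have h1 : ‖gnsVec h (G.lop φ a)‖ * ‖gnsVec h (G.lop φ a)‖ ≤
      ‖gnsVec h (G.lop φ a)‖ * ‖gnsVec h a‖ := by
    have h3 : ‖gnsVec h (G.lop φ a)‖ * ‖gnsVec h (G.lop φ a)‖ =
        ‖⟪gnsVec h (G.lop φ a), gnsVec h (G.lop φ a)⟫_ℂ‖ := by
      rw [inner_self_eq_norm_sq_to_K, ← RCLike.ofReal_pow, RCLike.norm_ofReal, abs_sq, sq]
    rw [h3, inner_gnsVec_lop]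
    refine (norm_inner_le_norm _ _).trans ?_
    rw [norm_vecTensor, norm_cyc, one_mul, hh.norm_comul_cyc]
  rcases (norm_nonneg (gnsVec h (G.lop φ a))).eq_or_lt with h0 | h0
  · rw [← h0]; exact norm_nonneg _
  · exact le_of_mul_le_mul_left h1 h0

theorem IsHaar.exists_bound {L : A →ₗ[ℂ] A} (hL : L ∈ G.lopSpan) :
    ∃ C : ℝ, ∀ a, ‖gnsVec h (L a)‖ ≤ C * ‖gnsVec h a‖ := by
  induction hL using Submodule.span_induction with
  | mem L hL =>
    obtain ⟨φ, rfl⟩ := hL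
    exact ⟨1, fun a => by rw [one_mul]; exact hh.norm_lop_le φ a⟩
  | zero => exact ⟨0, fun a => by simp⟩
  | add x y _ _ h1 h2 =>
    obtain ⟨C, hC⟩ := h1
    obtain ⟨D, hD⟩ := h2
    refine ⟨C + D, fun a => ?_⟩
    rw [LinearMap.add_apply, map_add, add_mul]
    exact (norm_add_le _ _).trans (add_le_add (hC a) (hD a))
  | smul c x _ h =>
    obtain ⟨C, hC⟩ := h
    refine ⟨‖c‖ * C, fun a => ?_⟩
    rw [LinearMap.smul_apply, map_smul, norm_smul, mul_assoc]
    exact mul_le_mul_of_nonneg_left (hC a) (norm_nonneg c)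

/-- The operators in `lopSpan` extend to bounded operators on the GNS space of the Haar state. -/
theorem IsHaar.exists_extension {L : A →ₗ[ℂ] A} (hL : L ∈ G.lopSpan) :
    ∃ T : HSpace h →L[ℂ] HSpace h, ∀ a, T (gnsVec h a) = gnsVec h (L a) :=
  ⟨(gnsVec h ∘ₗ L).extendOfNorm (gnsVec h),
    LinearMap.extendOfNorm_eq (denseRange_gnsVec h) (hh.exists_bound hL)⟩

/-- The isometry `Λ(a) ↦ Δ(a)(Ω ⊗ Ω)`. -/
theorem IsHaar.exists_delta : ∃ δ : HSpace h →L[ℂ] GNSTensor h h,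
    ∀ a, δ (gnsVec h a) = component h h (G.comul a) (cycTensor h h) :=
  ⟨((actL h h (cycTensor h h)).toLinearMap ∘ₗ G.comul.toAlgHom.toLinearMap).extendOfNorm
    (gnsVec h), LinearMap.extendOfNorm_eq (denseRange_gnsVec h)
      ⟨1, fun a => by rw [one_mul]; exact (hh.norm_comul_cyc h a).le⟩⟩

end CompactQuantumGroup

/-! ### Orthogonal complements of finite dimensional coideals -/

namespace CompactQuantumGroup

variable {A : Type*} [CStarAlgebra A] [PartialOrder A] [StarOrderedRing A] [Nontrivial A]
  (G : CompactQuantumGroup A)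

theorem inner_comul_ropVec (φ ψ : State A) (a c d p q : A) :
    ⟪vecTensor (gnsVec φ c) (gnsVec ψ d),
      component φ ψ (G.comul a) (vecTensor (gnsVec φ p) (gnsVec ψ q))⟫_ℂ =
    φ.1 (star c * G.ropVec ψ d q a * p) := by
  rw [inner_vec_component_vec, ropVec_apply, ← sliceR_mul, state_sliceR]
  congr 1
  rw [← mul_assoc, ← mul_assoc, tmul_mul_tmul, mul_assoc _ (tmul 1 q), tmul_mul_tmul]
  simp

theorem inner_comul_lopVec (φ ψ : State A) (a c d p q : A) :
    ⟪vecTensor (gnsVec φ c) (gnsVec ψ d),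
      component φ ψ (G.comul a) (vecTensor (gnsVec φ p) (gnsVec ψ q))⟫_ℂ =
    ψ.1 (star d * G.lopVec φ c p a * q) := by
  rw [inner_vec_component_vec, lopVec_apply, ← sliceL_mul, state_sliceL]
  congr 1
  rw [← mul_assoc, ← mul_assoc, tmul_mul_tmul, mul_assoc _ (tmul p 1), tmul_mul_tmul]
  simp

theorem inner_vecTensor_comul_right (φ ψ : State A) (ξ : HSpace φ) (a d q : A) :
    ⟪vecTensor ξ (gnsVec ψ d), component φ ψ (G.comul a) (vecTensor (cyc φ) (gnsVec ψ q))⟫_ℂ =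
    ⟪ξ, gnsVec φ (G.ropVec ψ d q a)⟫_ℂ := by
  have hc : Continuous fun ξ : HSpace φ => ⟪vecTensor ξ (gnsVec ψ d),
      component φ ψ (G.comul a) (vecTensor (cyc φ) (gnsVec ψ q))⟫_ℂ :=
    ((vecTensorR (gnsVec ψ d)).continuous).inner continuous_const
  refine congrFun ((denseRange_gnsVec φ).equalizer hc
    (by fun_prop : Continuous fun ξ : HSpace φ => ⟪ξ, gnsVec φ (G.ropVec ψ d q a)⟫_ℂ) ?_) ξ
  funext c
  simp only [Function.comp_apply]
  rw [← gnsVec_one φ, inner_comul_ropVec, inner_gnsVec, mul_one]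

theorem inner_vecTensor_comul_left (φ ψ : State A) (ξ : HSpace ψ) (a c p : A) :
    ⟪vecTensor (gnsVec φ c) ξ, component φ ψ (G.comul a) (vecTensor (gnsVec φ p) (cyc ψ))⟫_ℂ =
    ⟪ξ, gnsVec ψ (G.lopVec φ c p a)⟫_ℂ := by
  have hc : Continuous fun ξ : HSpace ψ => ⟪vecTensor (gnsVec φ c) ξ,
      component φ ψ (G.comul a) (vecTensor (gnsVec φ p) (cyc ψ))⟫_ℂ :=
    ((vecTensorL (gnsVec φ c)).continuous).inner continuous_const
  refine congrFun ((denseRange_gnsVec ψ).equalizer hc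
    (by fun_prop : Continuous fun ξ : HSpace ψ => ⟪ξ, gnsVec ψ (G.lopVec φ c p a)⟫_ℂ) ?_) ξ
  funext d
  simp only [Function.comp_apply]
  rw [← gnsVec_one ψ, inner_comul_lopVec, inner_gnsVec, mul_one]

theorem denseRange_actL_cyc (φ ψ : State A) : DenseRange (actL φ ψ (cycTensor φ ψ)) := by
  have h1 := dense_span_vecTensor (denseRange_gnsVec φ) (denseRange_gnsVec ψ)
  have hle : Submodule.span ℂ {z : GNSTensor φ ψ | ∃ x ∈ Set.range (gnsVec φ),
      ∃ y ∈ Set.range (gnsVec ψ), z = vecTensor x y} ≤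
      LinearMap.range (actL φ ψ (cycTensor φ ψ)).toLinearMap := by
    refine Submodule.span_le.mpr ?_
    rintro _ ⟨_, ⟨p, rfl⟩, _, ⟨q, rfl⟩, rfl⟩
    refine ⟨tmul p q, ?_⟩
    change component φ ψ (tmul p q) (cycTensor φ ψ) = _
    rw [cycTensor_eq, component_tmul_vec, mul_one, mul_one]
  exact h1.mono hle

/-- Continuous maps on `H_φ ⊗ H_ψ` agree if they agree on the vectors `Δ(p)(Ω ⊗ Λ(q))`. -/
theorem clm_ext_comul {φ ψ : State A} {E : Type*} [NormedAddCommGroup E] [NormedSpace ℂ E]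
    {f g : GNSTensor φ ψ →L[ℂ] E}
    (h : ∀ p q, f (component φ ψ (G.comul p) (vecTensor (cyc φ) (gnsVec ψ q))) =
      g (component φ ψ (G.comul p) (vecTensor (cyc φ) (gnsVec ψ q)))) : f = g := by
  have hfg : f.comp (actL φ ψ (cycTensor φ ψ)) = g.comp (actL φ ψ (cycTensor φ ψ)) := by
    refine ContinuousLinearMap.ext_on G.dense_right ?_
    rintro _ ⟨p, q, rfl⟩
    change f (component φ ψ (G.comul p * tmul 1 q) (cycTensor φ ψ)) =
      g (component φ ψ (G.comul p * tmul 1 q) (cycTensor φ ψ))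
    rw [cycTensor_eq, component_mul_apply, component_tmul_vec, mul_one, mul_one, gnsVec_one, h]
  have := (denseRange_actL_cyc φ ψ).equalizer f.continuous g.continuous
    (funext fun x => DFunLike.congr_fun hfg x)
  exact DFunLike.coe_injective this

variable {G} {h : State A} (hh : G.IsHaar h)

/-- Slicing the second leg turns Δ(p) into a right convolution operator applied to p, and L commutes
with it. -/
theorem opTensor_comul {L : A →ₗ[ℂ] A} (hL : L ∈ G.lopSpan) {T : HSpace h →L[ℂ] HSpace h}
    (hT : ∀ a, T (gnsVec h a) = gnsVec h (L a)) (p q : A) :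
    opTensor T 1 (component h h (G.comul p) (vecTensor (cyc h) (gnsVec h q))) =
      component h h (G.comul (L p)) (vecTensor (cyc h) (gnsVec h q)) := by
  refine (dense_span_vecTensor (denseRange_gnsVec h) (denseRange_gnsVec h)).eq_of_inner_right ℂ
    fun z hz => ?_
  induction hz using Submodule.span_induction with
  | mem z hz =>
    obtain ⟨_, ⟨c, rfl⟩, _, ⟨d, rfl⟩, rfl⟩ := hz
    rw [← ContinuousLinearMap.adjoint_inner_left, ← ContinuousLinearMap.star_eq_adjoint,
      star_opTensor, opTensor_vecTensor, star_one, one_apply_eq_self,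
      inner_vecTensor_comul_right, inner_vecTensor_comul_right,
      ContinuousLinearMap.star_eq_adjoint, ContinuousLinearMap.adjoint_inner_left, hT,
      G.lopSpan_comm_ropSpan hL (G.ropVec_mem h d q)]
  | zero => simp
  | add x y _ _ h1 h2 => rw [inner_add_left, inner_add_left, h1, h2]
  | smul c x _ h => rw [inner_smul_left, inner_smul_left, h]

include hh

/-- Pairing with Λ(a) produces (h ⊗ h)(Δ(a*p)(1 ⊗ q)), and invariance of h splits this as
h(a*p)h(q). -/
theorem IsHaar.adjoint_delta_comul {δ : HSpace h →L[ℂ] GNSTensor h h}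
    (hδ : ∀ a, δ (gnsVec h a) = component h h (G.comul a) (cycTensor h h)) (p q : A) :
    ContinuousLinearMap.adjoint δ
      (component h h (G.comul p) (vecTensor (cyc h) (gnsVec h q))) = h.1 q • gnsVec h p := by
  refine (denseRange_gnsVec h).eq_of_inner_right ℂ fun a => ?_
  rw [ContinuousLinearMap.adjoint_inner_right, hδ, inner_component_left, ← component_mul_apply,
    ← map_star, ← map_mul, cycTensor_eq, ← gnsVec_one h, inner_comul_ropVec, inner_smul_right,
    inner_gnsVec, star_one, one_mul, mul_one, hh.apply_ropVec, star_one, one_mul, mul_comm]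

/-- It suffices to check the vectors Δ(p)(Ω ⊗ Λ(q)), where both sides equal h(q)Λ(Lp). -/
theorem IsHaar.extension_adjoint_delta {δ : HSpace h →L[ℂ] GNSTensor h h}
    (hδ : ∀ a, δ (gnsVec h a) = component h h (G.comul a) (cycTensor h h))
    {L : A →ₗ[ℂ] A} (hL : L ∈ G.lopSpan) {T : HSpace h →L[ℂ] HSpace h}
    (hT : ∀ a, T (gnsVec h a) = gnsVec h (L a)) (v : GNSTensor h h) :
    T (ContinuousLinearMap.adjoint δ v) = ContinuousLinearMap.adjoint δ (opTensor T 1 v) := by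
  have : T.comp (ContinuousLinearMap.adjoint δ) =
      (ContinuousLinearMap.adjoint δ).comp (opTensor T 1) := by
    refine G.clm_ext_comul fun p q => ?_
    rw [ContinuousLinearMap.comp_apply, ContinuousLinearMap.comp_apply,
      hh.adjoint_delta_comul hδ, opTensor_comul hL hT, hh.adjoint_delta_comul hδ, map_smul, hT]
  exact DFunLike.congr_fun this v

omit hh in
-- The hypothesis makes Ω ⊗ x orthogonal to every (b ⊗ 1)Δ(a)(Ω ⊗ Ω). By density of (A ⊗ 1)Δ(A) it
-- is then orthogonal to each Ω ⊗ Λ(c).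
theorem eq_zero_of_adjoint_delta {δ : HSpace h →L[ℂ] GNSTensor h h}
    (hδ : ∀ a, δ (gnsVec h a) = component h h (G.comul a) (cycTensor h h)) {x : HSpace h}
    (h1 : ∀ b, ContinuousLinearMap.adjoint δ (vecTensor (gnsVec h b) x) = 0) : x = 0 := by
  have h0 (a b : A) :
      ⟪vecTensor (cyc h) x, component h h (tmul b 1 * G.comul a) (cycTensor h h)⟫_ℂ = 0 := by
    rw [component_mul_apply, ← star_star (tmul b 1), ← inner_component_left, star_tmul, star_one,
      component_tmul, opTensor_vecTensor, ← hδ, ← ContinuousLinearMap.adjoint_inner_left,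
      ← gnsVec_apply, map_one, one_apply_eq_self, h1, inner_zero_left]
  have h2 (t : MinTensor A A) :
      ⟪vecTensor (cyc h) x, actL h h (cycTensor h h) t⟫_ℂ = 0 := by
    refine congrFun (Continuous.ext_on G.dense_left'
      (f := fun t => ⟪vecTensor (cyc h) x, actL h h (cycTensor h h) t⟫_ℂ) (g := fun _ => 0)
      (continuous_const.inner (actL h h (cycTensor h h)).continuous) continuous_const
      fun t ht => ?_) t
    dsimp only
    induction ht using Submodule.span_induction with
    | mem t ht => obtain ⟨a, b, rfl⟩ := ht; exact h0 a b
    | zero => rw [map_zero, inner_zero_right]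
    | add x y _ _ h1 h2 => rw [map_add, inner_add_right, h1, h2, add_zero]
    | smul c x _ h => rw [map_smul, inner_smul_right, h, mul_zero]
  refine (denseRange_gnsVec h).eq_of_inner_left ℂ fun c => ?_
  have h3 := h2 (tmul 1 c)
  rw [actL_apply, cycTensor_eq, component_tmul_vec, inner_vecTensor, mul_one, mul_one, gnsVec_one,
    inner_self_eq_norm_sq_to_K, norm_cyc] at h3
  rw [inner_zero_left]
  simpa using h3

omit hh in
theorem inner_comul_of_mem_span {V : Submodule ℂ A} {w : HSpace h}
    (hw : w ∈ (V.map (gnsVec h))ᗮ) (v : HSpace h) {t : MinTensor A A}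
    (ht : t ∈ Submodule.span ℂ {t | ∃ a, ∃ y ∈ V, t = tmul a y}) :
    ⟪actL h h (cycTensor h h) t, vecTensor v w⟫_ℂ = 0 := by
  induction ht using Submodule.span_induction with
  | mem t ht =>
    obtain ⟨a, y, hy, rfl⟩ := ht
    rw [actL_apply, cycTensor_eq, component_tmul_vec, inner_vecTensor, mul_one, mul_one,
      (Submodule.mem_orthogonal _ w).mp hw _ (Submodule.mem_map_of_mem hy), mul_zero]
  | zero => simp
  | add x y _ _ h1 h2 => rw [map_add, inner_add_left, h1, h2, add_zero]
  | smul c x _ h => rw [map_smul, inner_smul_left, h, mul_zero]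

/-- The operators `(φ ⊗ id)Δ` preserve the orthogonal complement of a finite dimensional
right-invariant subspace. -/
theorem IsHaar.apply_lopSpan_eq_zero (V : Submodule ℂ A) [FiniteDimensional ℂ V]
    (hV : ∀ x ∈ V, G.comul x ∈ Submodule.span ℂ {t | ∃ a, ∃ y ∈ V, t = tmul a y})
    {L : A →ₗ[ℂ] A} (hL : L ∈ G.lopSpan) {p : A} (hp : ∀ y ∈ V, h.1 (star y * p) = 0) :
    ∀ y ∈ V, h.1 (star y * L p) = 0 := by
  obtain ⟨δ, hδ⟩ := hh.exists_delta
  set m := ContinuousLinearMap.adjoint δ with hm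
  set K : Submodule ℂ (HSpace h) := V.map (gnsVec h) with hK
  -- The aim is Kᗮ = I, the closure of the span of δ*(H ⊗ Kᗮ): I is visibly stable under the
  -- operators in question, whereas stability of Kᗮ would otherwise require control of their
  -- adjoints.
  set I₀ : Submodule ℂ (HSpace h) :=
    Submodule.span ℂ {ξ | ∃ b : A, ∃ w ∈ Kᗮ, ξ = m (vecTensor (gnsVec h b) w)} with hI₀
  set I := I₀.topologicalClosure with hI
  -- The coideal property puts δ(K) in the span of the H ⊗ K, which is orthogonal to H ⊗ Kᗮ.
  have hKI : K ≤ Iᗮ := by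
    rw [hI, Submodule.orthogonal_closure]
    rintro _ ⟨x, hx, rfl⟩
    rw [Submodule.mem_orthogonal']
    intro ξ hξ
    induction hξ using Submodule.span_induction with
    | mem ξ hξ =>
      obtain ⟨b, w, hw, rfl⟩ := hξ
      rw [hm, ContinuousLinearMap.adjoint_inner_right, hδ, ← actL_apply]
      exact inner_comul_of_mem_span hw _ (hV x hx)
    | zero => simp
    | add x y _ _ h1 h2 => rw [inner_add_right, h1, h2, add_zero]
    | smul c x _ h => rw [inner_smul_right, h, mul_zero]
  have hTI {L : A →ₗ[ℂ] A} (hL : L ∈ G.lopSpan) {T : HSpace h →L[ℂ] HSpace h}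
      (hT : ∀ a, T (gnsVec h a) = gnsVec h (L a)) : ∀ ξ ∈ I, T ξ ∈ I := by
    have h0 : ∀ ξ ∈ I₀, T ξ ∈ I₀ := by
      intro ξ hξ
      induction hξ using Submodule.span_induction with
      | mem ξ hξ =>
        obtain ⟨b, w, hw, rfl⟩ := hξ
        rw [hm, hh.extension_adjoint_delta hδ hL hT, opTensor_vecTensor, hT, one_apply_eq_self]
        exact Submodule.subset_span ⟨_, w, hw, rfl⟩
      | zero => simp
      | add x y _ _ h1 h2 => rw [map_add]; exact add_mem h1 h2
      | smul c x _ h => rw [map_smul]; exact Submodule.smul_mem _ _ h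
    intro ξ hξ
    exact map_mem_closure T.continuous hξ h0
  -- For such x the vector ξ = δ*(Λ(b) ⊗ x) lies in I and satisfies ⟨ξ, ξ⟩ = ⟨x, Tξ⟩, where T
  -- extends (h(b* · ) ⊗ id)Δ. Since Tξ is in I and x is in Iᗮ, ξ = 0 for every b.
  have hzero : ∀ x ∈ Iᗮ, x ∈ Kᗮ → x = 0 := by
    intro x hxI hxK
    have h1 (b : A) : m (vecTensor (gnsVec h b) x) = 0 := by
      have hmem : m (vecTensor (gnsVec h b) x) ∈ I :=
        Submodule.le_topologicalClosure _ (Submodule.subset_span ⟨b, x, hxK, rfl⟩)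
      obtain ⟨T, hT⟩ := hh.exists_extension (G.lopVec_mem h b 1)
      have h2 (ξ : HSpace h) : ⟪m (vecTensor (gnsVec h b) x), ξ⟫_ℂ = ⟪x, T ξ⟫_ℂ := by
        refine congrFun ((denseRange_gnsVec h).equalizer
          (by fun_prop : Continuous fun ξ => ⟪m (vecTensor (gnsVec h b) x), ξ⟫_ℂ)
          (by fun_prop : Continuous fun ξ => ⟪x, T ξ⟫_ℂ) (funext fun a => ?_)) ξ
        simp only [Function.comp_apply]
        rw [hm, ContinuousLinearMap.adjoint_inner_left, hδ, hT, cycTensor, ← gnsVec_one h,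
          gnsVec_one h, ← inner_vecTensor_comul_left, gnsVec_one]
      have h3 := h2 (m (vecTensor (gnsVec h b) x))
      rw [Submodule.mem_orthogonal'] at hxI
      rw [hxI _ (hTI (G.lopVec_mem h b 1) hT _ hmem)] at h3
      exact inner_self_eq_zero.mp h3
    exact eq_zero_of_adjoint_delta hδ h1
  have : FiniteDimensional ℂ K := inferInstanceAs (FiniteDimensional ℂ (V.map (gnsVec h)))
  have hIK : Iᗮ = K := by
    refine le_antisymm (fun x hx => ?_) hKI
    have hw : x - K.starProjection x ∈ Kᗮ := K.sub_starProjection_mem_orthogonal x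
    have hk : K.starProjection x ∈ K := K.starProjection_apply_mem x
    have := hzero _ (Submodule.sub_mem _ hx (hKI hk)) hw
    rw [sub_eq_zero] at this
    rw [this]; exact hk
  have hKeq : Kᗮ = I := by
    rw [← hIK, hI, Submodule.orthogonal_closure, Submodule.orthogonal_orthogonal_eq_closure]
  obtain ⟨T, hT⟩ := hh.exists_extension hL
  have hpI : gnsVec h p ∈ I := by
    rw [← hKeq, Submodule.mem_orthogonal]
    rintro _ ⟨y, hy, rfl⟩
    rw [inner_gnsVec, hp y hy]
  have hLp := hTI hL hT _ hpI
  rw [← hKeq, hT, Submodule.mem_orthogonal] at hLp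
  intro y hy
  rw [← inner_gnsVec]
  exact hLp _ (Submodule.mem_map_of_mem hy)

end CompactQuantumGroup

/-! ### Unitarity of the coefficient matrix of a coideal -/

namespace CompactQuantumGroup

variable {A : Type*} [CStarAlgebra A] [PartialOrder A] [StarOrderedRing A] [Nontrivial A]
  (G : CompactQuantumGroup A)

/-- A family `e` of elements of `V` whose GNS vectors form an orthonormal basis of the image of
`V`. -/
structure IsGNSBasis (h : State A) (V : Submodule ℂ A) {r : ℕ} (e : Fin r → A) : Prop where
  mem : ∀ c, e c ∈ V
  orthonormal : ∀ c d, h.1 (star (e c) * e d) = if c = d then 1 else 0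
  expand : ∀ x ∈ V, gnsVec h x = ∑ c, h.1 (star (e c) * x) • gnsVec h (e c)

theorem exists_isGNSBasis (h : State A) (V : Submodule ℂ A) [FiniteDimensional ℂ V] :
    ∃ (r : ℕ) (e : Fin r → A), IsGNSBasis h V e := by
  have : FiniteDimensional ℂ (V.map (gnsVec h)) := inferInstance
  let b := stdOrthonormalBasis ℂ (V.map (gnsVec h))
  have hb (c) : ∃ x ∈ V, gnsVec h x = (b c : HSpace h) := (b c).2
  choose e he heb using hb
  refine ⟨_, e, he, fun c d => ?_, fun x hx => ?_⟩
  · rw [← inner_gnsVec, heb, heb, ← Submodule.coe_inner, orthonormal_iff_ite.mp b.orthonormal]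
  · have := congrArg Subtype.val (b.sum_repr ⟨gnsVec h x, Submodule.mem_map_of_mem hx⟩)
    rw [Submodule.coe_sum] at this
    refine this.symm.trans (Finset.sum_congr rfl fun c _ => ?_)
    rw [Submodule.coe_smul, heb, ← inner_gnsVec, heb, b.repr_apply_apply, Submodule.coe_inner]

variable {G} {h : State A} {V : Submodule ℂ A} {r : ℕ} {e : Fin r → A}

theorem IsGNSBasis.apply_star_mul_eq_zero (he : IsGNSBasis h V e) {p : A}
    (hp : ∀ c, h.1 (star (e c) * p) = 0) : ∀ y ∈ V, h.1 (star y * p) = 0 := by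
  intro y hy
  rw [← inner_gnsVec, he.expand y hy, sum_inner]
  refine Finset.sum_eq_zero fun c _ => ?_
  rw [inner_smul_left, inner_gnsVec, hp, mul_zero]

/-- Only the second leg of Δ(x) is expanded in the basis, which the coideal property allows. The
expansion holds for GNS vectors only, since h need not be faithful. -/
theorem IsGNSBasis.component_comul (he : IsGNSBasis h V e)
    (hV : ∀ x ∈ V, G.comul x ∈ Submodule.span ℂ {t | ∃ a, ∃ y ∈ V, t = tmul a y})
    (φ : State A) {x : A} (hx : x ∈ V) (q : A) :
    component φ h (G.comul x) (vecTensor (gnsVec φ q) (gnsVec h 1)) =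
      ∑ c, vecTensor (gnsVec φ (G.ropVec h (e c) 1 x * q)) (gnsVec h (e c)) := by
  have key (t : MinTensor A A) (ht : t ∈ Submodule.span ℂ {t | ∃ a, ∃ y ∈ V, t = tmul a y}) :
      component φ h t (vecTensor (gnsVec φ q) (gnsVec h 1)) =
        ∑ c, vecTensor (gnsVec φ (sliceR h (tmul 1 (star (e c)) * t * tmul 1 1) * q))
          (gnsVec h (e c)) := by
    induction ht using Submodule.span_induction with
    | mem t ht =>
      obtain ⟨a, y, hy, rfl⟩ := ht
      rw [component_tmul_vec, mul_one, he.expand y hy, ← vecTensorₗ_apply, map_sum]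
      refine Finset.sum_congr rfl fun c _ => ?_
      rw [tmul_mul_tmul, tmul_mul_tmul, sliceR_tmul, smul_mul_assoc, map_smul, one_mul, mul_one,
        mul_one, map_smul, vecTensorₗ_apply, vecTensor_smul_left]
    | zero =>
      rw [← actL_apply, map_zero]
      symm
      refine Finset.sum_eq_zero fun c _ => ?_
      rw [mul_zero, zero_mul, map_zero, zero_mul, map_zero, ← vecTensorR_apply, map_zero]
    | add x y _ _ h1 h2 =>
      rw [component_add, add_apply, h1, h2, ← Finset.sum_add_distrib]
      refine Finset.sum_congr rfl fun c _ => ?_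
      rw [mul_add, add_mul, map_add, add_mul, map_add, vecTensor_add_left]
    | smul k x _ h1 =>
      rw [component_smul, smul_apply, h1, Finset.smul_sum]
      refine Finset.sum_congr rfl fun c _ => ?_
      rw [mul_smul_comm, smul_mul_assoc, map_smul, smul_mul_assoc, map_smul, vecTensor_smul_left]
  exact key _ (hV x hx)

/-- The matrix of the operators `R_c = (id ⊗ h(e_c* · ))Δ` on the family `e`. -/
def coeffMatrix (G : CompactQuantumGroup A) (h : State A) (e : Fin r → A) :
    Matrix (Fin r) (Fin r) A := Matrix.of fun c a => G.ropVec h (e c) 1 (e a)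

theorem coeffMatrix_apply (c a : Fin r) :
    coeffMatrix G h e c a = G.ropVec h (e c) 1 (e a) := rfl

variable (hh : G.IsHaar h) (he : IsGNSBasis h V e)
  (hV : ∀ x ∈ V, G.comul x ∈ Submodule.span ℂ {t | ∃ a, ∃ y ∈ V, t = tmul a y})

include hh he hV

/-- Under a state φ the (a, b) entry is (φ ⊗ h)(Δ(e_a* e_b)), which left invariance reduces to
h(e_a* e_b). -/
theorem star_coeffMatrix_mul_self : star (coeffMatrix G h e) * coeffMatrix G h e = 1 := by
  refine Matrix.ext fun a b => ?_
  refine eq_of_state_apply fun φ => ?_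
  have h1 : ⟪component φ h (G.comul (e a)) (cycTensor φ h),
      component φ h (G.comul (e b)) (cycTensor φ h)⟫_ℂ = if a = b then 1 else 0 := by
    rw [inner_component_left, ← component_mul_apply, ← map_star, ← map_mul]
    have := conv_apply G.comul φ h (star (e a) * e b)
    rw [hh.left, he.orthonormal] at this
    exact this.symm
  rw [cycTensor_eq, he.component_comul hV φ (he.mem a), he.component_comul hV φ (he.mem b),
    sum_inner] at h1
  rw [Matrix.mul_apply, map_sum, Matrix.one_apply]
  have h2 : φ.1 (if a = b then 1 else 0) = if a = b then 1 else 0 := by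
    split_ifs
    · exact φ.2
    · exact map_zero φ.1
  rw [h2, ← h1]
  refine Finset.sum_congr rfl fun c _ => ?_
  rw [inner_sum, Finset.sum_eq_single c]
  · rw [inner_vecTensor, inner_gnsVec, inner_gnsVec, he.orthonormal, if_pos rfl, mul_one, mul_one,
      mul_one, Matrix.star_apply, coeffMatrix_apply, coeffMatrix_apply]
  · intro d _ hd
    rw [inner_vecTensor, inner_gnsVec h, he.orthonormal, if_neg hd.symm, mul_zero]
  · simp

/-- A row P annihilating the coefficient matrix from the left gives a vector ∑ Λ(P_b*) ⊗ Λ(e_b)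
orthogonal to all Δ(p)(q ⊗ 1)(Ω ⊗ Ω), hence by density to everything. For p = e_a this is the
hypothesis on P; for p orthogonal to V it is the invariance of the orthogonal complement. -/
theorem sum_inner_eq_zero (hfin : FiniteDimensional ℂ V) (φ : State A) (P : Fin r → A)
    (hP : ∀ a, ∑ b, P b * coeffMatrix G h e b a = 0) (t : MinTensor A A) :
    ∑ b, ⟪vecTensor (gnsVec φ (star (P b))) (gnsVec h (e b)),
      actL φ h (cycTensor φ h) t⟫_ℂ = 0 := by
  have hpV (q : A) (a : Fin r) :
      ∑ b, h.1 (star (e b) * G.lopVec φ (star (P b)) q (e a)) = 0 := by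
    have h0 (b : Fin r) : h.1 (star (e b) * G.lopVec φ (star (P b)) q (e a)) =
        φ.1 (P b * coeffMatrix G h e b a * q) := by
      rw [← mul_one (star (e b) * _), ← inner_comul_lopVec, he.component_comul hV φ (he.mem a),
        inner_sum, Finset.sum_eq_single b]
      · rw [inner_vecTensor, inner_gnsVec, inner_gnsVec, he.orthonormal, if_pos rfl, mul_one,
          star_star, mul_assoc, coeffMatrix_apply]
      · intro d _ hd
        rw [inner_vecTensor, inner_gnsVec h, he.orthonormal, if_neg hd.symm, mul_zero]
      · simp
    simp only [h0]
    rw [← map_sum, ← Finset.sum_mul, hP, zero_mul, map_zero]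
  have hall (q p : A) : ∑ b, h.1 (star (e b) * G.lopVec φ (star (P b)) q p) = 0 := by
    -- The component of p orthogonal to V.
    set p' := p - ∑ c, h.1 (star (e c) * p) • e c with hp'
    have h1 (c : Fin r) : h.1 (star (e c) * p') = 0 := by
      rw [hp', mul_sub, map_sub, Finset.mul_sum, map_sum]
      simp only [mul_smul_comm, map_smul, he.orthonormal]
      simp
    have h2 (b : Fin r) : h.1 (star (e b) * G.lopVec φ (star (P b)) q p') = 0 :=
      hh.apply_lopSpan_eq_zero V hV (G.lopVec_mem φ _ q) (he.apply_star_mul_eq_zero h1) _ (he.mem b)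
    have h3 : p = p' + ∑ c, h.1 (star (e c) * p) • e c := by rw [hp', sub_add_cancel]
    rw [h3]
    simp only [map_add, map_sum, map_smul, mul_add, Finset.mul_sum, mul_smul_comm, h2, zero_add]
    rw [Finset.sum_comm]
    refine Finset.sum_eq_zero fun c _ => ?_
    rw [← Finset.smul_sum, hpV, smul_zero]
  refine congrFun (Continuous.ext_on G.dense_left
    (f := fun t => ∑ b, ⟪vecTensor (gnsVec φ (star (P b))) (gnsVec h (e b)),
      actL φ h (cycTensor φ h) t⟫_ℂ) (g := fun _ => 0)
    (continuous_finsetSum _ fun b _ =>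
      continuous_const.inner (actL φ h (cycTensor φ h)).continuous) continuous_const
    fun t ht => ?_) t
  dsimp only
  induction ht using Submodule.span_induction with
  | mem t ht =>
    obtain ⟨p, q, rfl⟩ := ht
    rw [← hall q p]
    refine Finset.sum_congr rfl fun b _ => ?_
    rw [actL_apply, component_mul_apply, cycTensor_eq, component_tmul_vec, mul_one, mul_one,
      inner_comul_lopVec, mul_one]
  | zero => simp
  | add x y _ _ h1 h2 =>
    simp only [map_add, inner_add_right, Finset.sum_add_distrib, h1, h2, add_zero]
  | smul c x _ h => simp only [map_smul, inner_smul_right, ← Finset.mul_sum, h, mul_zero]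

/-- With ω an isometry, P = 1 − ωω* is a projection with Pω = 0. `sum_inner_eq_zero` shows that
every state vanishes on its diagonal entries, and P = PP* then forces all entries to be zero. -/
theorem coeffMatrix_mul_star_self (hfin : FiniteDimensional ℂ V) :
    coeffMatrix G h e * star (coeffMatrix G h e) = 1 := by
  set ω := coeffMatrix G h e with hω
  have h1 : star ω * ω = 1 := star_coeffMatrix_mul_self hh he hV
  set P := 1 - ω * star ω with hP
  have hPω : P * ω = 0 := by rw [hP, sub_mul, mul_assoc, h1, mul_one, one_mul, sub_self]
  have hPstar : star P = P := by rw [hP, star_sub, star_one, star_mul, star_star]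
  have hPP : P * star P = P := by
    rw [hPstar]
    nth_rewrite 2 [hP]
    rw [mul_sub, ← mul_assoc, hPω, zero_mul, mul_one, sub_zero]
  have hPaa (a : Fin r) (φ : State A) : φ.1 (P a a) = 0 := by
    have h2 := sum_inner_eq_zero hh he hV hfin φ (P a) (fun c => congrFun (congrFun hPω a) c)
      (tmul 1 (e a))
    rw [Finset.sum_eq_single a] at h2
    · rwa [actL_apply, cycTensor_eq, component_tmul_vec, inner_vecTensor, inner_gnsVec,
        inner_gnsVec, mul_one, mul_one, mul_one, he.orthonormal, if_pos rfl, mul_one,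
        star_star] at h2
    · intro b _ hb
      rw [actL_apply, cycTensor_eq, component_tmul_vec, inner_vecTensor, inner_gnsVec h, mul_one,
        mul_one, he.orthonormal, if_neg hb, mul_zero]
    · simp
  have hP0 : P = 0 := by
    refine Matrix.ext fun a b => ?_
    rw [Matrix.zero_apply, ← star_eq_zero]
    refine eq_zero_of_state_star_mul_self _ fun φ => ?_
    have h3 := hPaa a φ
    rw [← hPP, Matrix.mul_apply, map_sum] at h3
    have h4 := (Finset.sum_eq_zero_iff_of_nonneg (fun c _ => by
      have := φ.apply_star_mul_self_nonneg (star (P a c))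
      rwa [star_star] at this)).mp h3 b (Finset.mem_univ b)
    rw [Matrix.star_apply] at h4
    rwa [star_star]
  rw [hP, sub_eq_zero] at hP0
  exact hP0.symm

omit he hV in
-- By left invariance Δ(n) kills Ω_φ ⊗ Ω_h for each state φ. Thus the slice depends only on the GNS
-- vector, even when h is not faithful.
theorem ropVec_eq_zero_of_gnsVec (d : A) {n : A} (hn : gnsVec h n = 0) :
    G.ropVec h d 1 n = 0 := by
  refine eq_zero_of_state_apply _ fun φ => ?_
  have h1 : component φ h (G.comul n) (cycTensor φ h) = 0 := by
    rw [← norm_eq_zero, hh.norm_comul_cyc, hn, norm_zero]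
  rw [cycTensor_eq] at h1
  have h2 := inner_comul_ropVec G φ h n 1 d 1 1
  rw [h1, inner_zero_right, star_one, one_mul, mul_one] at h2
  exact h2.symm

omit hV in
theorem ropVec_expand (d : A) {x : A} (hx : x ∈ V) :
    G.ropVec h d 1 x = ∑ c, h.1 (star (e c) * x) • G.ropVec h d 1 (e c) := by
  have : G.ropVec h d 1 (x - ∑ c, h.1 (star (e c) * x) • e c) = 0 := by
    refine ropVec_eq_zero_of_gnsVec hh d ?_
    rw [map_sub, he.expand x hx, map_sum, sub_eq_zero]
    simp only [map_smul]
  rw [map_sub, map_sum, sub_eq_zero] at this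
  simpa only [map_smul] using this

end CompactQuantumGroup

/-! ### Unitary corepresentations from matrix coefficients -/

namespace CompactQuantumGroup

variable {A : Type*} [CStarAlgebra A] [PartialOrder A] [StarOrderedRing A] [Nontrivial A]
  {G : CompactQuantumGroup A} {ι : Type*} [Fintype ι] [DecidableEq ι]

/-- The space of matrix coefficients of `z`. -/
def coeffSpan (z : Matrix ι ι A) : Submodule ℂ A :=
  Submodule.span ℂ (Set.range fun p : ι × ι => z p.1 p.2)

theorem mem_coeffSpan (z : Matrix ι ι A) (i j : ι) : z i j ∈ coeffSpan z :=
  Submodule.subset_span ⟨(i, j), rfl⟩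

instance (z : Matrix ι ι A) : FiniteDimensional ℂ (coeffSpan z) :=
  FiniteDimensional.span_of_finite ℂ (Set.finite_range _)

theorem ropVec_coeff {z : Matrix ι ι A}
    (hz : ∀ i j, G.comul (z i j) = ∑ k, tmul (z i k) (z k j)) (h : State A) (d : A) (i j : ι) :
    G.ropVec h d 1 (z i j) = ∑ k, h.1 (star d * z k j) • z i k := by
  have h1 : tmul 1 (star d) * ∑ k, tmul (z i k) (z k j) =
      ∑ k, tmul 1 (star d) * tmul (z i k) (z k j) := map_sum (mulLeftL (tmul 1 (star d))) _ _
  rw [ropVec_apply, hz, tmul_one_one, mul_one, h1, map_sum]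
  refine Finset.sum_congr rfl fun k _ => ?_
  rw [tmul_mul_tmul, sliceR_tmul, one_mul]

theorem comul_ropVec_coeff {z : Matrix ι ι A}
    (hz : ∀ i j, G.comul (z i j) = ∑ k, tmul (z i k) (z k j)) {h : State A} (hh : G.IsHaar h)
    {r : ℕ} {e : Fin r → A} (he : IsGNSBasis h (coeffSpan z) e) (d : A) {x : A}
    (hx : x ∈ coeffSpan z) :
    G.comul (G.ropVec h d 1 x) =
      ∑ c, tmul (G.ropVec h (e c) 1 x) (G.ropVec h d 1 (e c)) := by
  induction hx using Submodule.span_induction with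
  | mem x hx =>
    obtain ⟨⟨i, j⟩, rfl⟩ := hx
    dsimp only
    have h1 : G.comul (G.ropVec h d 1 (z i j)) =
        ∑ k, tmul (z i k) (G.ropVec h d 1 (z k j)) := by
      rw [ropVec_coeff hz, map_sum]
      simp only [map_smul, hz, ropVec_coeff hz, ← tmulₗ_apply, map_sum, Finset.smul_sum]
      rw [Finset.sum_comm]
    rw [h1]
    simp only [ropVec_coeff hz h (e _) i j]
    simp only [ropVec_expand hh he d (mem_coeffSpan z _ j), ← tmulₗ_apply, map_sum, map_smul,
      LinearMap.sum_apply, LinearMap.smul_apply]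
    rw [Finset.sum_comm]
  | zero => simp [← tmulₗ_apply]
  | add x y _ _ h1 h2 =>
    rw [map_add, map_add, h1, h2, ← Finset.sum_add_distrib]
    simp only [map_add, tmul_add_left]
  | smul k x _ h1 =>
    rw [map_smul, map_smul, h1, Finset.smul_sum]
    simp only [map_smul, tmul_smul_left]

theorem comul_mem_span {z : Matrix ι ι A}
    (hz : ∀ i j, G.comul (z i j) = ∑ k, tmul (z i k) (z k j)) {x : A} (hx : x ∈ coeffSpan z) :
    G.comul x ∈ Submodule.span ℂ {t | ∃ a, ∃ y ∈ coeffSpan z, t = tmul a y} := by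
  induction hx using Submodule.span_induction with
  | mem x hx =>
    obtain ⟨⟨i, j⟩, rfl⟩ := hx
    dsimp only
    rw [hz]
    exact Submodule.sum_mem _ fun k _ => Submodule.subset_span ⟨_, _, mem_coeffSpan z k j, rfl⟩
  | zero => rw [map_zero]; exact zero_mem _
  | add x y _ _ h1 h2 => rw [map_add]; exact add_mem h1 h2
  | smul c x _ h => rw [map_smul]; exact Submodule.smul_mem _ _ h

/-- The contragredient of a finite dimensional corepresentation contains enough intertwiners from
a unitary corepresentation. -/
theorem exists_unitary_corep {z : Matrix ι ι A}
    (hz : ∀ i j, G.comul (z i j) = ∑ k, tmul (z i k) (z k j)) :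
    ∃ (r : ℕ) (ζ : Matrix (Fin r) (Fin r) A) (X : ι → Matrix ι (Fin r) ℂ),
      ζ ∈ unitary (Matrix (Fin r) (Fin r) A) ∧
      (∀ a b, G.comul (ζ a b) = ∑ c, tmul (ζ a c) (ζ c b)) ∧
      (∀ j, contra z * amp (A := A) (X j) = amp (A := A) (X j) * ζ) ∧
      (∀ v : Fin r → ℂ, (∀ j, (X j).mulVec v = 0) → v = 0) ∧
      (z ∈ unitary (Matrix ι ι A) → Nonempty ι → 0 < r) := by
  obtain ⟨h, hh⟩ := G.exists_isHaar
  obtain ⟨r, e, he⟩ := exists_isGNSBasis h (coeffSpan z)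
  have hV : ∀ x ∈ coeffSpan z, _ := fun x hx => comul_mem_span hz hx
  -- The matrix X_j holds the inner products of the j-th column of z with the basis. The
  -- intertwining relation is the adjoint of expanding (id ⊗ h(e_a* · ))Δ(z_ij) in two ways.
  refine ⟨r, star (coeffMatrix G h e),
    fun j => Matrix.of fun i a => h.1 (star (z i j) * e a), ?_, fun a b => ?_, fun j => ?_,
    fun v hv => ?_, fun hu hι => ?_⟩
  · rw [Unitary.mem_iff, star_star]
    exact ⟨coeffMatrix_mul_star_self hh he hV inferInstance, star_coeffMatrix_mul_self hh he hV⟩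
  · rw [Matrix.star_apply, map_star, coeffMatrix_apply,
      comul_ropVec_coeff hz hh he _ (he.mem _), star_sum]
    refine Finset.sum_congr rfl fun c _ => ?_
    rw [star_tmul, Matrix.star_apply, Matrix.star_apply, coeffMatrix_apply, coeffMatrix_apply]
  · refine Matrix.ext fun i a => ?_
    have h1 : G.ropVec h (e a) 1 (z i j) = ∑ k, h.1 (star (e a) * z k j) • z i k :=
      ropVec_coeff hz h (e a) i j
    rw [ropVec_expand hh he _ (mem_coeffSpan z i j)] at h1
    have h2 := congrArg star h1
    simp only [star_sum, star_smul, ← State.apply_star, star_mul, star_star] at h2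
    simp only [Matrix.mul_apply, contra, amp, Matrix.map_apply, Matrix.of_apply,
      Matrix.star_apply, coeffMatrix_apply]
    simp only [← Algebra.commutes, ← Algebra.smul_def]
    exact h2.symm
  · have h1 : gnsVec h (∑ a, v a • e a) = 0 := by
      rw [← inner_self_eq_zero (𝕜 := ℂ)]
      have h2 : ∀ y ∈ coeffSpan z, ⟪gnsVec h y, gnsVec h (∑ a, v a • e a)⟫_ℂ = 0 := by
        intro y hy
        induction hy using Submodule.span_induction with
        | mem y hy =>
          obtain ⟨⟨i, j⟩, rfl⟩ := hy
          have := congrFun (hv j) i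
          rw [inner_gnsVec, Finset.mul_sum, map_sum]
          simp only [mul_smul_comm, map_smul, smul_eq_mul]
          simpa [Matrix.mulVec, dotProduct, mul_comm] using this
        | zero => simp
        | add x y _ _ h1 h2 => rw [map_add, inner_add_left, h1, h2, add_zero]
        | smul c x _ h => rw [map_smul, inner_smul_left, h, mul_zero]
      exact h2 _ (Submodule.sum_mem _ fun a _ => Submodule.smul_mem _ _ (he.mem a))
    funext b
    have h3 : ⟪gnsVec h (e b), gnsVec h (∑ a, v a • e a)⟫_ℂ = v b := by
      rw [inner_gnsVec, Finset.mul_sum, map_sum]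
      simp only [mul_smul_comm, map_smul, smul_eq_mul, he.orthonormal]
      simp
    rw [← h3, h1, inner_zero_right, Pi.zero_apply]
  -- With an empty basis every coefficient of z would be null for h, contradicting ∑_i z_ij* z_ij =
  -- 1.
  · by_contra hr
    obtain rfl : r = 0 := by omega
    obtain ⟨j⟩ := hι
    have h1 : (star z * z) j j = 1 := by rw [hu.1, Matrix.one_apply_eq]
    rw [Matrix.mul_apply] at h1
    have h2 := congrArg h.1 h1
    rw [map_sum, h.2, Finset.sum_eq_zero] at h2
    · exact zero_ne_one h2
    · intro i _
      rw [Matrix.star_apply, ← inner_gnsVec, he.expand _ (mem_coeffSpan z i j)]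
      simp

end CompactQuantumGroup

/-! ### Amplified scalar matrices and the contragredient -/

open scoped MatrixOrder in
theorem _root_.Matrix.PosDef.exists_posDef_sqrt {n : Type*} [Fintype n] [DecidableEq n]
    {P : Matrix n n ℂ} (hP : P.PosDef) : ∃ S : Matrix n n ℂ, S.PosDef ∧ S * S = P := by
  have h0 : 0 ≤ P := hP.posSemidef.nonneg
  have h1 : CFC.sqrt P * CFC.sqrt P = P := CFC.sqrt_mul_sqrt_self P h0
  refine ⟨CFC.sqrt P, ?_, h1⟩
  rw [(Matrix.nonneg_iff_posSemidef.mp (CFC.sqrt_nonneg P)).posDef_iff_isUnit]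
  have hu := hP.isUnit
  rw [← h1] at hu
  exact isUnit_of_mul_isUnit_left hu

namespace CompactQuantumGroup

variable {A : Type*} [CStarAlgebra A] [PartialOrder A] [StarOrderedRing A]
  {ι κ μ : Type*}

theorem amp_apply (T : Matrix ι κ ℂ) (i : ι) (j : κ) :
    amp (A := A) T i j = algebraMap ℂ A (T i j) := rfl

theorem amp_mul [Fintype κ] (S : Matrix ι κ ℂ) (T : Matrix κ μ ℂ) :
    amp (A := A) (S * T) = amp (A := A) S * amp (A := A) T := Matrix.map_mul

theorem amp_one [DecidableEq ι] : amp (A := A) (1 : Matrix ι ι ℂ) = 1 :=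
  Matrix.map_one _ (map_zero _) (map_one _)

theorem amp_conjTranspose (T : Matrix ι κ ℂ) :
    (amp (A := A) T).conjTranspose = amp (A := A) T.conjTranspose := by
  refine Matrix.ext fun i j => ?_
  simp only [Matrix.conjTranspose_apply, amp_apply, algebraMap_star_comm]

theorem amp_smul (c : ℂ) (T : Matrix ι κ ℂ) : amp (A := A) (c • T) = c • amp (A := A) T := by
  refine Matrix.ext fun i j => ?_
  simp [amp_apply, Algebra.smul_def]

theorem map_star_amp_mul [Fintype κ] (T : Matrix ι κ ℂ) (M : Matrix κ μ A) :
    (amp (A := A) T * M).map star = amp (A := A) (T.map star) * M.map star := by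
  refine Matrix.ext fun i j => ?_
  simp only [Matrix.map_apply, Matrix.mul_apply, amp_apply, star_sum, star_mul, ← algebraMap_star_comm,
    Algebra.commutes]

theorem map_star_mul_amp [Fintype κ] (M : Matrix ι κ A) (T : Matrix κ μ ℂ) :
    (M * amp (A := A) T).map star = M.map star * amp (A := A) (T.map star) := by
  refine Matrix.ext fun i j => ?_
  simp only [Matrix.map_apply, Matrix.mul_apply, amp_apply, star_sum, star_mul, ← algebraMap_star_comm,
    Algebra.commutes]

theorem map_star_map_star {R : Type*} [InvolutiveStar R] (M : Matrix ι κ R) :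
    (M.map star).map star = M := by
  refine Matrix.ext fun i j => ?_
  simp

theorem map_star_mul [Fintype κ] (S : Matrix ι κ ℂ) (T : Matrix κ μ ℂ) :
    (S * T).map star = S.map star * T.map star := by
  refine Matrix.ext fun i j => ?_
  simp [Matrix.mul_apply]

theorem mem_hom_iff [Fintype ι] [Fintype κ] {u : Matrix ι ι A} {v : Matrix κ κ A}
    {T : Matrix κ ι ℂ} : T ∈ Hom u v ↔ v * amp (A := A) T = amp (A := A) T * u := Iff.rfl

theorem map_star_mem_hom_contra [Fintype ι] [Fintype κ] {u : Matrix ι ι A} {v : Matrix κ κ A}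
    {T : Matrix κ ι ℂ} (hT : T ∈ Hom u v) : T.map star ∈ Hom (contra u) (contra v) := by
  rw [mem_hom_iff] at hT ⊢
  have := congrArg (fun M : Matrix κ ι A => M.map star) hT
  rwa [map_star_mul_amp, map_star_amp_mul] at this

theorem contra_contra (u : Matrix ι ι A) : contra (contra u) = u := map_star_map_star u

theorem IsIrreducible.contra_hom [Fintype ι] [DecidableEq ι] {u : Matrix ι ι A}
    (hu : IsIrreducible u) {T : Matrix ι ι ℂ} (hT : T ∈ Hom (contra u) (contra u)) :
    ∃ c : ℂ, T = c • (1 : Matrix ι ι ℂ) := by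
  have h := map_star_mem_hom_contra hT
  rw [contra_contra] at h
  obtain ⟨c, hc⟩ := hu.2 _ h
  refine ⟨star c, ?_⟩
  rw [← map_star_map_star T, hc]
  refine Matrix.ext fun i j => ?_
  by_cases hij : i = j <;> simp [hij]

variable [Fintype ι] [DecidableEq ι]

theorem hom_mul [Fintype κ] [Fintype μ] {u : Matrix ι ι A} {v : Matrix κ κ A} {w : Matrix μ μ A}
    {S : Matrix μ κ ℂ} {T : Matrix κ ι ℂ} (hS : S ∈ Hom v w) (hT : T ∈ Hom u v) :
    S * T ∈ Hom u w := by
  rw [mem_hom_iff] at *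
  rw [amp_mul, ← Matrix.mul_assoc, hS, Matrix.mul_assoc, hT, Matrix.mul_assoc]

/-- The adjoint of an intertwiner of unitary representations is an intertwiner. -/
theorem hom_conjTranspose [Fintype κ] [DecidableEq κ] {u : Matrix ι ι A} {v : Matrix κ κ A}
    (hu : u ∈ unitary (Matrix ι ι A)) (hv : v ∈ unitary (Matrix κ κ A))
    {T : Matrix κ ι ℂ} (hT : T ∈ Hom u v) : T.conjTranspose ∈ Hom v u := by
  rw [mem_hom_iff] at *
  have h1 : v.conjTranspose * amp (A := A) T = amp (A := A) T * u.conjTranspose := by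
    have e1 : v.conjTranspose * (v * amp (A := A) T) * u.conjTranspose =
        v.conjTranspose * (amp (A := A) T * u) * u.conjTranspose := by rw [hT]
    have e2 : v.conjTranspose * v = 1 := hv.1
    have e3 : u * u.conjTranspose = 1 := hu.2
    rw [← Matrix.mul_assoc, e2, Matrix.one_mul, Matrix.mul_assoc, Matrix.mul_assoc, e3,
      Matrix.mul_one] at e1
    exact e1.symm
  have h2 := congrArg Matrix.conjTranspose h1
  rw [Matrix.conjTranspose_mul, Matrix.conjTranspose_mul, Matrix.conjTranspose_conjTranspose,
    Matrix.conjTranspose_conjTranspose, amp_conjTranspose] at h2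
  exact h2.symm

/-- For an irreducible unitary representation `u`, the representation `u^c` is invertible and
preserves a positive definite matrix. -/
theorem exists_posDef_contra [Nontrivial A] (G : CompactQuantumGroup A) {u : Matrix ι ι A}
    (hu : ∀ i j, G.comul (u i j) = ∑ k, tmul (u i k) (u k j)) (huu : u ∈ unitary (Matrix ι ι A))
    (hirr : IsIrreducible u) :
    ∃ P : Matrix ι ι ℂ, P.PosDef ∧
      contra u * amp (A := A) P * (contra u).conjTranspose = amp (A := A) P ∧
      ∃ W : Matrix ι ι A, W * contra u = 1 := by
  obtain ⟨r, ζ, X, hζu, hζ, hX, hXi, hr⟩ := exists_unitary_corep hu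
  -- The first application links ζ to u^c and the second links z to ζ^c. Conjugating the former and
  -- composing gives intertwiners from the unitary z to the unitary u, to which Schur's lemma
  -- applies.
  obtain ⟨r', z, Y, hzu, -, hY, hYi, hr'⟩ := exists_unitary_corep hζ
  have hr0 := hr huu hirr.1
  have hr0' := hr' hζu ⟨⟨0, hr0⟩⟩
  obtain ⟨l, hl⟩ : ∃ l, Y l ≠ 0 := by
    by_contra! h
    have := congrFun (hYi (fun _ => 1) fun j => by rw [h j, Matrix.zero_mulVec]) ⟨0, hr0'⟩
    simp at this
  -- If all products vanished, the conjugated columns of Y_l would lie in the common kernel of the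
  -- X_j, which is zero.
  obtain ⟨j, hj⟩ : ∃ j, (X j).map star * Y l ≠ 0 := by
    by_contra! h
    refine hl (Matrix.ext fun a b => ?_)
    have h1 := hXi (fun a => star (Y l a b)) fun j => by
      funext i
      have h2 := congrArg star (congrFun (congrFun (h j) i) b)
      simpa [Matrix.mul_apply, Matrix.mulVec, dotProduct] using h2
    simpa using congrFun h1 a
  set x := X j with hx
  set y := Y l with hy
  have h1 : u * amp (A := A) (x.map star) = amp (A := A) (x.map star) * contra ζ := by
    have := map_star_mem_hom_contra (u := ζ) (v := contra u) (T := x) (hX j)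
    rwa [contra_contra] at this
  have h2 : x.map star * y ∈ Hom z u := hom_mul (v := contra ζ) h1 (hY l)
  obtain ⟨c, hc⟩ := hirr.2 _ (hom_mul h2 (hom_conjTranspose hzu huu h2))
  have hc0 : c ≠ 0 := by
    rintro rfl
    rw [zero_smul] at hc
    exact hj (Matrix.self_mul_conjTranspose_eq_zero.mp hc)
  -- Up to the nonzero scalar c, this is a right inverse of the conjugate of x. It makes xx*
  -- definite and provides the left inverse of u^c.
  set B := y * (x.map star * y).conjTranspose with hB
  have hBhom : B ∈ Hom u (contra ζ) := hom_mul (hY l) (hom_conjTranspose hzu huu h2)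
  have hxB : x * B.map star = star c • (1 : Matrix ι ι ℂ) := by
    have h3 : x.map star * B = c • (1 : Matrix ι ι ℂ) := by rw [hB, ← Matrix.mul_assoc, hc]
    have h4 := congrArg (fun M : Matrix ι ι ℂ => M.map star) h3
    rw [map_star_mul, map_star_map_star] at h4
    rw [h4]
    refine Matrix.ext fun i j => ?_
    by_cases hij : i = j <;> simp [hij]
  have hBc : ζ * amp (A := A) (B.map star) = amp (A := A) (B.map star) * contra u := by
    have := map_star_mem_hom_contra hBhom
    rwa [contra_contra] at this
  have hζ1 : ζ.conjTranspose * ζ = 1 := hζu.1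
  have hζ2 : ζ * ζ.conjTranspose = 1 := hζu.2
  have hXj : contra u * amp (A := A) x = amp (A := A) x * ζ := hX j
  refine ⟨x * x.conjTranspose, ?_, ?_, (star c)⁻¹ • (amp (A := A) x * ζ.conjTranspose *
    amp (A := A) (B.map star)), ?_⟩
  · refine Matrix.PosDef.mul_conjTranspose_self x fun v w hvw => ?_
    have h5 := congrArg (fun t => Matrix.vecMul t (B.map star)) hvw
    dsimp only at h5
    rw [Matrix.vecMul_vecMul, Matrix.vecMul_vecMul, hxB, Matrix.vecMul_smul, Matrix.vecMul_smul,
      Matrix.vecMul_one, Matrix.vecMul_one] at h5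
    exact smul_right_injective _ (star_ne_zero.mpr hc0) h5
  · rw [amp_mul, ← Matrix.mul_assoc, hXj, ← amp_conjTranspose, Matrix.mul_assoc,
      ← Matrix.conjTranspose_mul, hXj, Matrix.conjTranspose_mul, Matrix.mul_assoc,
      ← Matrix.mul_assoc ζ, hζ2, Matrix.one_mul]
  · rw [Matrix.smul_mul, Matrix.mul_assoc, ← hBc, Matrix.mul_assoc, ← Matrix.mul_assoc _ ζ, hζ1,
      Matrix.one_mul, ← amp_mul, hxB, amp_smul, amp_one, smul_smul,
      inv_mul_cancel₀ (star_ne_zero.mpr hc0), one_smul]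

end CompactQuantumGroup

/-! ### Existence and properties of the modular matrix -/

namespace CompactQuantumGroup

variable {A : Type*} [CStarAlgebra A] [PartialOrder A] [StarOrderedRing A]
  {ι : Type*} [Fintype ι] [DecidableEq ι]

theorem amp_inv_mul {R : Matrix ι ι ℂ} (hR : IsUnit R) :
    amp (A := A) R⁻¹ * amp (A := A) R = 1 := by
  rw [← amp_mul, Matrix.nonsing_inv_mul R ((Matrix.isUnit_iff_isUnit_det R).mp hR), amp_one]

theorem amp_mul_inv {R : Matrix ι ι ℂ} (hR : IsUnit R) :
    amp (A := A) R * amp (A := A) R⁻¹ = 1 := by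
  rw [← amp_mul, Matrix.mul_nonsing_inv R ((Matrix.isUnit_iff_isUnit_det R).mp hR), amp_one]

theorem _root_.Matrix.PosDef.exists_trace_eq_ofReal [Nonempty ι] {P : Matrix ι ι ℂ}
    (hP : P.PosDef) : ∃ a : ℝ, 0 < a ∧ P.trace = a := by
  have h := hP.trace_pos
  rw [Complex.lt_def] at h
  exact ⟨P.trace.re, h.1, Complex.ext rfl h.2.symm⟩

/-- With S = P^{-1/2}, invariance of P makes S u^c S⁻¹ a coisometry, and the left inverse of u^c
makes it unitary. A positive multiple of S then meets the trace condition, which by irreducibility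
concerns scalar intertwiners only. -/
theorem IsQSqrt.of_sq_inv {u : Matrix ι ι A} {P S : Matrix ι ι ℂ} (hP : P.PosDef) (hS : S.PosDef)
    (hSP : S * S = P⁻¹)
    (hu : contra u * amp (A := A) P * (contra u).conjTranspose = amp (A := A) P)
    {W : Matrix ι ι A} (hW : W * contra u = 1) (hirr : IsIrreducible u) :
    ∃ R : Matrix ι ι ℂ, IsQSqrt u R := by
  have hne := hirr.1
  have hSd := (Matrix.isUnit_iff_isUnit_det S).mp hS.isUnit
  have hPd := (Matrix.isUnit_iff_isUnit_det P).mp hP.isUnit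
  obtain ⟨a, ha, hPa⟩ := hP.exists_trace_eq_ofReal
  obtain ⟨b, hb, hPb⟩ := hP.inv.exists_trace_eq_ofReal
  -- The traces of (tS)² and of its inverse are t²b and t⁻²a, which agree exactly when t⁴ = a/b.
  set t : ℝ := Real.sqrt (Real.sqrt (a / b)) with ht
  have ht0 : 0 < t := Real.sqrt_pos.mpr (Real.sqrt_pos.mpr (div_pos ha hb))
  have ht4 : t ^ 2 * t ^ 2 * b = a := by
    rw [ht, Real.sq_sqrt (Real.sqrt_nonneg _), Real.mul_self_sqrt (div_pos ha hb).le,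
      div_mul_cancel₀ _ hb.ne']
  have htc : (t : ℂ) ≠ 0 := by exact_mod_cast ht0.ne'
  have hRinv : ((t : ℂ) • S)⁻¹ = (t : ℂ)⁻¹ • S⁻¹ := by
    refine Matrix.inv_eq_left_inv ?_
    rw [Matrix.smul_mul, Matrix.mul_smul, smul_smul, inv_mul_cancel₀ htc, one_smul,
      Matrix.nonsing_inv_mul S hSd]
  have hPS : P = S⁻¹ * S⁻¹ := by
    rw [← Matrix.mul_inv_rev, hSP, Matrix.nonsing_inv_nonsing_inv P hPd]
  have hSh : S.conjTranspose = S := hS.isHermitian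
  have hSih : S⁻¹.conjTranspose = S⁻¹ := hS.inv.isHermitian
  set V := amp (A := A) S * contra u * amp (A := A) S⁻¹ with hV
  have hV1 : V * V.conjTranspose = 1 := by
    rw [hV, Matrix.conjTranspose_mul, Matrix.conjTranspose_mul, amp_conjTranspose,
      amp_conjTranspose, hSh, hSih]
    calc amp (A := A) S * contra u * amp (A := A) S⁻¹ *
          (amp (A := A) S⁻¹ * ((contra u).conjTranspose * amp (A := A) S))
        = amp (A := A) S * (contra u * (amp (A := A) S⁻¹ * amp (A := A) S⁻¹) *
          (contra u).conjTranspose) * amp (A := A) S := by simp only [Matrix.mul_assoc]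
      _ = 1 := by
        rw [← amp_mul, ← hPS, hu, hPS, amp_mul, ← Matrix.mul_assoc, amp_mul_inv hS.isUnit,
          Matrix.one_mul, amp_inv_mul hS.isUnit]
  have hV2 : (amp (A := A) S * W * amp (A := A) S⁻¹) * V = 1 := by
    calc (amp (A := A) S * W * amp (A := A) S⁻¹) * V
        = amp (A := A) S * W * (amp (A := A) S⁻¹ * amp (A := A) S) * contra u *
            amp (A := A) S⁻¹ := by rw [hV]; simp only [Matrix.mul_assoc]
      _ = 1 := by
        rw [amp_inv_mul hS.isUnit, Matrix.mul_one, Matrix.mul_assoc _ W, hW, Matrix.mul_one,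
          amp_mul_inv hS.isUnit]
  have hV3 : V.conjTranspose * V = 1 := by
    rw [← left_inv_eq_right_inv hV2 hV1]; exact hV2
  refine ⟨(t : ℂ) • S, hS.smul (by exact_mod_cast ht0), ?_, fun X hX => ?_⟩
  · have : amp (A := A) ((t : ℂ) • S) * contra u * amp (A := A) ((t : ℂ) • S)⁻¹ = V := by
      rw [hRinv, amp_smul, amp_smul, Matrix.smul_mul, Matrix.smul_mul, Matrix.mul_smul, smul_smul,
        mul_inv_cancel₀ htc, one_smul]
    rw [this]
    exact ⟨hV3, hV1⟩
  · obtain ⟨c, rfl⟩ := hirr.contra_hom hX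
    have h2 : ((t : ℂ) • S) ^ 2 = ((t : ℂ) ^ 2) • P⁻¹ := by rw [smul_pow, sq S, hSP]
    have h3 : (((t : ℂ) • S) ^ 2)⁻¹ = ((t : ℂ) ^ 2)⁻¹ • P := by
      rw [h2]
      refine Matrix.inv_eq_left_inv ?_
      rw [Matrix.smul_mul, Matrix.mul_smul, smul_smul, inv_mul_cancel₀ (pow_ne_zero 2 htc),
        one_smul, Matrix.mul_nonsing_inv P hPd]
    have h4 : (t : ℂ) ^ 2 * (t : ℂ) ^ 2 * b = a := by exact_mod_cast ht4
    rw [h3, h2, Matrix.mul_smul, Matrix.mul_smul, Matrix.mul_one, Matrix.mul_one,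
      Matrix.trace_smul, Matrix.trace_smul, Matrix.trace_smul, Matrix.trace_smul, hPa, hPb, ← h4,
      smul_eq_mul, smul_eq_mul, smul_eq_mul, smul_eq_mul]
    field_simp

theorem exists_isQSqrt [Nontrivial A] (G : CompactQuantumGroup A) {u : Matrix ι ι A}
    (hu : ∀ i j, G.comul (u i j) = ∑ k, tmul (u i k) (u k j)) (huu : u ∈ _root_.unitary (Matrix ι ι A))
    (hirr : IsIrreducible u) : ∃ R : Matrix ι ι ℂ, IsQSqrt u R := by
  obtain ⟨P, hP, hP1, W, hW⟩ := exists_posDef_contra G hu huu hirr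
  obtain ⟨S, hS, hS1⟩ := hP.inv.exists_posDef_sqrt
  exact IsQSqrt.of_sq_inv hP hS hS1 hP1 hW hirr

theorem isQSqrt_qSqrt {u : Matrix ι ι A} (h : ∃ R : Matrix ι ι ℂ, IsQSqrt u R) :
    IsQSqrt u (qSqrt u) := by
  rw [qSqrt, dif_pos h]
  exact h.choose_spec

theorem Irrep.isQSqrt [Nontrivial A] {G : CompactQuantumGroup A} (α : G.Irrep) :
    IsQSqrt α.u (qSqrt α.u) :=
  isQSqrt_qSqrt (exists_isQSqrt G α.isRep.comul_apply α.unitary α.irreducible)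

section

variable {u : Matrix ι ι A} {R : Matrix ι ι ℂ} (hR : IsQSqrt u R)

include hR

theorem IsQSqrt.contra_conjTranspose_mul :
    (contra u).conjTranspose * amp (A := A) (R ^ 2) * contra u = amp (A := A) (R ^ 2) := by
  have hRh : R.conjTranspose = R := hR.posDef.isHermitian
  have hRih : R⁻¹.conjTranspose = R⁻¹ := hR.posDef.inv.isHermitian
  have h1 : (amp (A := A) R * contra u * amp (A := A) R⁻¹).conjTranspose *
      (amp (A := A) R * contra u * amp (A := A) R⁻¹) = 1 := hR.unitary.1
  rw [Matrix.conjTranspose_mul, Matrix.conjTranspose_mul, amp_conjTranspose, amp_conjTranspose,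
    hRh, hRih] at h1
  calc (contra u).conjTranspose * amp (A := A) (R ^ 2) * contra u
      = amp (A := A) R * amp (A := A) R⁻¹ * ((contra u).conjTranspose *
          (amp (A := A) R * amp (A := A) R) * contra u) * (amp (A := A) R⁻¹ * amp (A := A) R) := by
        rw [amp_mul_inv hR.posDef.isUnit, amp_inv_mul hR.posDef.isUnit, Matrix.one_mul,
          Matrix.mul_one, ← amp_mul, ← sq]
    _ = amp (A := A) R * (amp (A := A) R⁻¹ * ((contra u).conjTranspose * amp (A := A) R) *
          (amp (A := A) R * contra u * amp (A := A) R⁻¹)) * amp (A := A) R := by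
        simp only [Matrix.mul_assoc]
    _ = amp (A := A) (R ^ 2) := by rw [h1, Matrix.mul_one, ← amp_mul, ← sq]

theorem IsQSqrt.contra_mul_conjTranspose :
    contra u * amp (A := A) (R ^ 2)⁻¹ * (contra u).conjTranspose = amp (A := A) (R ^ 2)⁻¹ := by
  have hRh : R.conjTranspose = R := hR.posDef.isHermitian
  have hRih : R⁻¹.conjTranspose = R⁻¹ := hR.posDef.inv.isHermitian
  have h1 : (amp (A := A) R * contra u * amp (A := A) R⁻¹) *
      (amp (A := A) R * contra u * amp (A := A) R⁻¹).conjTranspose = 1 := hR.unitary.2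
  rw [Matrix.conjTranspose_mul, Matrix.conjTranspose_mul, amp_conjTranspose, amp_conjTranspose,
    hRh, hRih] at h1
  rw [sq, Matrix.mul_inv_rev]
  calc contra u * amp (A := A) (R⁻¹ * R⁻¹) * (contra u).conjTranspose
      = amp (A := A) R⁻¹ * amp (A := A) R * (contra u *
          (amp (A := A) R⁻¹ * amp (A := A) R⁻¹) * (contra u).conjTranspose) *
            (amp (A := A) R * amp (A := A) R⁻¹) := by
        rw [amp_mul_inv hR.posDef.isUnit, amp_inv_mul hR.posDef.isUnit, Matrix.one_mul,
          Matrix.mul_one, ← amp_mul]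
    _ = amp (A := A) R⁻¹ * (amp (A := A) R * contra u * amp (A := A) R⁻¹ *
          (amp (A := A) R⁻¹ * ((contra u).conjTranspose * amp (A := A) R))) *
            amp (A := A) R⁻¹ := by
        simp only [Matrix.mul_assoc]
    _ = amp (A := A) (R⁻¹ * R⁻¹) := by rw [h1, Matrix.mul_one, ← amp_mul]

theorem IsQSqrt.posDef_sq : (R ^ 2).PosDef := by
  have h := Matrix.PosDef.conjTranspose_mul_self R
    (Matrix.mulVec_injective_of_isUnit hR.posDef.isUnit)
  rwa [show R.conjTranspose = R from hR.posDef.isHermitian, ← sq] at h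

theorem IsQSqrt.trace_sq : (R ^ 2).trace = ((R ^ 2)⁻¹).trace := by
  have h := hR.trace_eq 1 (by rw [mem_hom_iff, amp_one, Matrix.mul_one, Matrix.one_mul])
  rwa [Matrix.mul_one, Matrix.mul_one] at h

/-- If `u^c` is an isometry then it is unitary. -/
theorem IsQSqrt.contra_mem_unitary (h : (contra u).conjTranspose * contra u = 1) :
    contra u ∈ _root_.unitary (Matrix ι ι A) := by
  refine ⟨h, ?_⟩
  have h1 := hR.contra_mul_conjTranspose
  have h2 : contra u * (amp (A := A) (R ^ 2)⁻¹ * (contra u).conjTranspose * amp (A := A) (R ^ 2))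
      = 1 := by
    rw [← Matrix.mul_assoc, ← Matrix.mul_assoc, h1, amp_inv_mul hR.posDef_sq.isUnit]
  have h3 := left_inv_eq_right_inv h h2
  rw [← h3] at h2
  exact h2

end

/-- If `u` and `u^c` are unitary and `u` is irreducible, then `Q_{u} = 1`. -/
theorem IsQSqrt.eq_one {u : Matrix ι ι A} {R : Matrix ι ι ℂ} (hR : IsQSqrt u R)
    (hu : contra u ∈ _root_.unitary (Matrix ι ι A)) (hirr : IsIrreducible u) : R = 1 := by
  have hne := hirr.1
  have h1 := hR.contra_conjTranspose_mul
  have h2 : contra u * amp (A := A) (R ^ 2) = amp (A := A) (R ^ 2) * contra u := by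
    have h3 : contra u * (contra u).conjTranspose = 1 := hu.2
    nth_rewrite 1 [← h1]
    rw [← Matrix.mul_assoc, ← Matrix.mul_assoc, h3, Matrix.one_mul]
  obtain ⟨c, hc⟩ := hirr.contra_hom h2
  obtain ⟨a, ha, hRa⟩ := hR.posDef_sq.exists_trace_eq_ofReal
  have hn : (Fintype.card ι : ℂ) ≠ 0 := by exact_mod_cast Fintype.card_ne_zero
  have hc0 : c ≠ 0 := by
    rintro rfl
    rw [hc, zero_smul, Matrix.trace_zero] at hRa
    exact ha.ne (by exact_mod_cast hRa)
  have hinv : (R ^ 2)⁻¹ = c⁻¹ • (1 : Matrix ι ι ℂ) := by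
    refine Matrix.inv_eq_left_inv ?_
    rw [hc, Matrix.smul_mul, Matrix.mul_smul, smul_smul, inv_mul_cancel₀ hc0, one_smul,
      Matrix.one_mul]
  have h3 := hR.trace_sq
  rw [hinv, hc, Matrix.trace_smul, Matrix.trace_smul, Matrix.trace_one, smul_eq_mul,
    smul_eq_mul] at h3
  have h4 : c = c⁻¹ := mul_right_cancel₀ hn h3
  have h5 : c * c = 1 := by nth_rewrite 2 [h4]; exact mul_inv_cancel₀ hc0
  -- The trace normalization leaves c = ±1, and positivity of Q excludes −1.
  have h6 : c = 1 := by
    rcases mul_self_eq_one_iff.mp h5 with h | h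
    · exact h
    · rw [hc, h, Matrix.trace_smul, Matrix.trace_one, smul_eq_mul] at hRa
      have h7 : (-(Fintype.card ι : ℝ)) = a := by
        have : ((-(Fintype.card ι : ℝ) : ℝ) : ℂ) = (a : ℂ) := by rw [← hRa]; push_cast; ring
        exact_mod_cast this
      have h8 : (0 : ℝ) ≤ Fintype.card ι := Nat.cast_nonneg _
      linarith
  rw [h6, one_smul] at hc
  -- From R² = 1 to R = 1: the factor R + 1 is positive definite, hence invertible.
  have h7 : (R + 1) * (R - 1) = 0 := by
    have : (R + 1) * (R - 1) = R ^ 2 - 1 := by noncomm_ring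
    rw [this, hc, sub_self]
  have h8 : IsUnit (R + 1) := (hR.posDef.add Matrix.PosDef.one).isUnit
  have h9 := (IsUnit.mul_right_eq_zero h8).mp h7
  exact sub_eq_zero.mp h9

/-- The irreducible representation `u^c` for an irreducible unitary representation `u` whose
contragredient is unitary. -/
def Irrep.contragredient {G : CompactQuantumGroup A} (α : G.Irrep)
    (h : contra α.u ∈ _root_.unitary (Matrix (Fin α.n) (Fin α.n) A)) : G.Irrep where
  n := α.n
  u := contra α.u
  isRep :=
    { isUnit := ⟨Unitary.toUnits ⟨contra α.u, h⟩, rfl⟩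
      comul_apply := fun i j => by
        change G.comul (star (α.u i j)) = ∑ k, tmul (star (α.u i k)) (star (α.u k j))
        rw [map_star, α.isRep.comul_apply, star_sum]
        simp only [star_tmul] }
  unitary := h
  irreducible := ⟨α.irreducible.1, fun _ hT => α.irreducible.contra_hom hT⟩

theorem Irrep.qSqrt_contragredient [Nontrivial A] {G : CompactQuantumGroup A} (α : G.Irrep)
    (h : contra α.u ∈ _root_.unitary (Matrix (Fin α.n) (Fin α.n) A)) :
    qSqrt (α.contragredient h).u = 1 := by
  refine (α.contragredient h).isQSqrt.eq_one ?_ (α.contragredient h).irreducible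
  change contra (contra α.u) ∈ _
  rw [contra_contra]
  exact α.unitary

/-- With trivial modular matrix, conjugation only takes entrywise adjoints, which undoes the
contragredient exactly and not merely up to equivalence. -/
theorem Irrep.conj_contragredient [Nontrivial A] {G : CompactQuantumGroup A} (α : G.Irrep)
    (h : contra α.u ∈ _root_.unitary (Matrix (Fin α.n) (Fin α.n) A)) :
    conj (α.contragredient h).u = α.u := by
  rw [conj, α.qSqrt_contragredient h, inv_one, amp_one, Matrix.mul_one, Matrix.one_mul]
  exact contra_contra α.u

end CompactQuantumGroup

/-! ### Choi matrices, invariant functionals and the norm inequality -/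

namespace Matrix

variable {ι κ : Type*} [Fintype ι] [DecidableEq ι] [Fintype κ] [DecidableEq κ]

open scoped MatrixOrder Matrix.Norms.L2Operator in
theorem PosSemidef.norm_smul_one_sub {Q : Matrix ι ι ℂ} (hQ : Q.PosSemidef) :
    ((‖toEuclideanCLM (𝕜 := ℂ) Q‖ : ℂ) • (1 : Matrix ι ι ℂ) - Q).PosSemidef := by
  have h := IsSelfAdjoint.le_algebraMap_norm_self (a := Q) hQ.isHermitian
  rw [le_iff, cstar_norm_def, Algebra.algebraMap_eq_smul_one] at h
  exact_mod_cast h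

open scoped MatrixOrder Matrix.Norms.L2Operator in
theorem PosSemidef.norm_le {Q : Matrix ι ι ℂ} (hQ : Q.PosSemidef) {m : ℝ} (hm : 0 ≤ m)
    (h : ((m : ℂ) • (1 : Matrix ι ι ℂ) - Q).PosSemidef) :
    ‖toEuclideanCLM (𝕜 := ℂ) Q‖ ≤ m := by
  have h1 := (CStarAlgebra.norm_le_iff_le_algebraMap Q hm hQ.nonneg).mpr (by
    rw [le_iff, Algebra.algebraMap_eq_smul_one]
    exact_mod_cast h)
  rwa [cstar_norm_def] at h1

open scoped MatrixOrder in
theorem PosSemidef.trace_mul_nonneg {P S : Matrix ι ι ℂ} (hP : P.PosSemidef) (hS : S.PosSemidef) :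
    0 ≤ (P * S).trace := by
  obtain ⟨B, hB⟩ := CStarAlgebra.nonneg_iff_eq_star_mul_self.mp hP.nonneg
  have h := (hS.mul_mul_conjTranspose_same B).trace_nonneg
  rw [trace_mul_cycle] at h
  rw [hB]
  exact h

end Matrix

theorem Finset.sum_comm_three {α β γ M : Type*} [AddCommMonoid M] [Fintype α] [Fintype β]
    [Fintype γ] (f : α → β → γ → M) :
    ∑ a, ∑ b, ∑ c, f a b c = ∑ c, ∑ b, ∑ a, f a b c := by
  rw [Finset.sum_comm, Finset.sum_congr rfl fun b _ => Finset.sum_comm, Finset.sum_comm]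

theorem Finset.sum_comm_four {α β γ δ M : Type*} [AddCommMonoid M] [Fintype α] [Fintype β]
    [Fintype γ] [Fintype δ] (f : α → β → γ → δ → M) :
    ∑ a, ∑ b, ∑ c, ∑ d, f a b c d = ∑ c, ∑ d, ∑ a, ∑ b, f a b c d := by
  have h := Finset.sum_comm (s := (Finset.univ : Finset (α × β)))
    (t := (Finset.univ : Finset (γ × δ))) (f := fun p q => f p.1 p.2 q.1 q.2)
  simpa only [Fintype.sum_prod_type] using h

namespace CompactQuantumGroup

section

variable {R : Type*} [Semiring R] {ι ι' ι'' κ κ' κ'' : Type*} [Fintype ι'] [Fintype κ']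

theorem kronecker_mul_kronecker {M : Matrix ι ι' R} {N : Matrix κ κ' R} {M' : Matrix ι' ι'' R}
    {N' : Matrix κ' κ'' R} (h : ∀ i j k l, Commute (N i j) (M' k l)) :
    (M ⊗ₖ N) * (M' ⊗ₖ N') = (M * M') ⊗ₖ (N * N') := by
  refine Matrix.ext fun p q => ?_
  simp only [Matrix.mul_apply, Matrix.kroneckerMap_apply, Fintype.sum_prod_type,
    Finset.sum_mul_sum]
  refine Finset.sum_congr rfl fun i _ => Finset.sum_congr rfl fun k _ => ?_
  rw [mul_assoc, ← mul_assoc (N _ _), (h _ _ _ _).eq, mul_assoc, mul_assoc]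

end

variable {A : Type*} [CStarAlgebra A] [PartialOrder A] [StarOrderedRing A]
  {ι κ : Type*} [Fintype ι] [DecidableEq ι] [Fintype κ] [DecidableEq κ]

/-- The Choi matrix of a linear map between matrix algebras. -/
def choi (Φ : Matrix ι ι ℂ →ₗ[ℂ] Matrix κ κ ℂ) : Matrix (ι × κ) (ι × κ) ℂ :=
  Matrix.of fun p q => Φ (Matrix.single p.1 q.1 1) p.2 q.2

theorem choi_apply (Φ : Matrix ι ι ℂ →ₗ[ℂ] Matrix κ κ ℂ) (p q : ι × κ) :
    choi Φ p q = Φ (Matrix.single p.1 q.1 1) p.2 q.2 := rfl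

theorem apply_eq_sum_choi (Φ : Matrix ι ι ℂ →ₗ[ℂ] Matrix κ κ ℂ) (X : Matrix ι ι ℂ) (k l : κ) :
    Φ X k l = ∑ i, ∑ j, X i j * choi Φ (i, k) (j, l) := by
  conv_lhs => rw [Matrix.matrix_eq_sum_single X]
  simp only [map_sum, Matrix.sum_apply]
  refine Finset.sum_congr rfl fun i _ => Finset.sum_congr rfl fun j _ => ?_
  have : Matrix.single i j (X i j) = X i j • Matrix.single i j (1 : ℂ) := by
    rw [Matrix.smul_single, smul_eq_mul, mul_one]
  rw [this, map_smul, Matrix.smul_apply, smul_eq_mul, choi_apply]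

theorem trace_kronecker_mul_choi (Φ : Matrix ι ι ℂ →ₗ[ℂ] Matrix κ κ ℂ) (S : Matrix ι ι ℂ)
    (T : Matrix κ κ ℂ) : ((S ⊗ₖ T) * choi Φ).trace = (T * Φ S.transpose).trace := by
  simp only [Matrix.trace, Matrix.diag_apply, Matrix.mul_apply, Matrix.kroneckerMap_apply,
    Fintype.sum_prod_type, apply_eq_sum_choi Φ S.transpose, Matrix.transpose_apply, Finset.mul_sum]
  rw [Finset.sum_comm]
  refine Finset.sum_congr rfl fun k _ => ?_
  rw [Finset.sum_comm_three]
  refine Finset.sum_congr rfl fun l _ => Finset.sum_congr rfl fun a _ =>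
    Finset.sum_congr rfl fun b _ => ?_
  ring

theorem IsCPTP.map_posSemidef {Φ : Matrix ι ι ℂ →ₗ[ℂ] Matrix κ κ ℂ} (hΦ : IsCPTP Φ)
    {X : Matrix ι ι ℂ} (hX : X.PosSemidef) : (Φ X).PosSemidef :=
  (hΦ.cp 1 (X.submatrix Prod.snd Prod.snd) (hX.submatrix _)).submatrix fun k => (0, k)

theorem contra_conj_apply (v : Matrix κ κ A) (F : Matrix κ κ ℂ) (p q : κ) :
    ((contra v).conjTranspose * amp (A := A) F * contra v) p q =
      ∑ k, ∑ l, F k l • (v k p * star (v l q)) := by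
  simp only [Matrix.mul_apply, Finset.sum_mul, Matrix.conjTranspose_apply, contra,
    Matrix.map_apply, star_star, amp_apply]
  rw [Finset.sum_comm]
  refine Finset.sum_congr rfl fun k _ => Finset.sum_congr rfl fun l _ => ?_
  rw [← Algebra.commutes, mul_assoc, ← Algebra.smul_def]

theorem conj_amp_apply (v : Matrix κ κ A) (F : Matrix κ κ ℂ) (k l : κ) :
    (v * amp (A := A) F * star v) k l = ∑ p, ∑ q, F p q • (v k p * star (v l q)) := by
  simp only [Matrix.mul_apply, Finset.sum_mul, Matrix.star_apply, amp_apply]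
  rw [Finset.sum_comm]
  refine Finset.sum_congr rfl fun p _ => Finset.sum_congr rfl fun q _ => ?_
  rw [← Algebra.commutes, mul_assoc, ← Algebra.smul_def]

section

variable {u : Matrix ι ι A} {v : Matrix κ κ A} {Φ : Matrix ι ι ℂ →ₗ[ℂ] Matrix κ κ ℂ}
  (hΦ : IsCovariant u v Φ)

include hΦ

theorem IsCovariant.apply_single (a b : ι) (k l : κ) :
    ∑ i, ∑ j, choi Φ (i, k) (j, l) • (u i a * star (u j b)) =
      ∑ p, ∑ q, choi Φ (a, p) (b, q) • (v k p * star (v l q)) := by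
  have h := congrFun (congrFun (hΦ (Matrix.single a b 1)) k) l
  rw [conj_amp_apply] at h
  rw [mapAmp, Matrix.of_apply] at h
  simp only [conj_amp_apply] at h
  simp only [choi_apply]
  rw [← h]
  refine Finset.sum_congr rfl fun i _ => Finset.sum_congr rfl fun j _ => ?_
  congr 1
  rw [Finset.sum_eq_single a, Finset.sum_eq_single b]
  · simp
  · intro q _ hq; simp [hq.symm]
  · simp
  · intro p _ hp; exact Finset.sum_eq_zero fun q _ => by simp [hp.symm]
  · simp

/-- Covariance at X = 1, where u(1 ⊗ 1)u* = 1. -/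
theorem IsCovariant.map_one_mem_hom (hu : u ∈ unitary (Matrix ι ι A))
    (hv : v ∈ unitary (Matrix κ κ A)) : Φ 1 ∈ Hom v v := by
  have h := hΦ 1
  rw [amp_one, Matrix.mul_one, hu.2] at h
  have h1 : mapAmp Φ (1 : Matrix ι ι A) = amp (A := A) (Φ 1) := by
    refine Matrix.ext fun k l => ?_
    rw [mapAmp, Matrix.of_apply, amp_apply, apply_eq_sum_choi, map_sum]
    refine Finset.sum_congr rfl fun i _ => ?_
    rw [map_sum]
    refine Finset.sum_congr rfl fun j _ => ?_
    by_cases hij : i = j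
    · subst hij
      rw [Matrix.one_apply_eq, Matrix.one_apply_eq, one_mul, choi_apply, Algebra.smul_def, mul_one]
    · rw [Matrix.one_apply_ne hij, Matrix.one_apply_ne hij, smul_zero, zero_mul, map_zero]
  rw [h1] at h
  rw [mem_hom_iff]
  nth_rewrite 2 [h]
  rw [Matrix.mul_assoc (v * _), hv.1, Matrix.mul_one]

/-- The functional `X ↦ Tr(Q_vᵗ Φ(X))` is invariant. -/
theorem IsCovariant.invariant {Q : Matrix κ κ ℂ}
    (hQ : (contra v).conjTranspose * amp (A := A) Q * contra v = amp (A := A) Q) :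
    (contra u).conjTranspose * amp (A := A) (Matrix.of fun i j =>
      (Q.transpose * Φ (Matrix.single i j 1)).trace) * contra u =
      amp (A := A) (Matrix.of fun i j => (Q.transpose * Φ (Matrix.single i j 1)).trace) := by
  have htr (i j : ι) : (Q.transpose * Φ (Matrix.single i j 1)).trace =
      ∑ k, ∑ l, Q k l * choi Φ (i, k) (j, l) := by
    simp only [Matrix.trace, Matrix.diag_apply, Matrix.mul_apply, Matrix.transpose_apply,
      choi_apply]
    rw [Finset.sum_comm]
  refine Matrix.ext fun a b => ?_
  rw [contra_conj_apply, amp_apply]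
  simp only [Matrix.of_apply, htr]
  calc ∑ i, ∑ j, (∑ k, ∑ l, Q k l * choi Φ (i, k) (j, l)) • (u i a * star (u j b))
      = ∑ k, ∑ l, Q k l • ∑ i, ∑ j, choi Φ (i, k) (j, l) • (u i a * star (u j b)) := by
        simp only [Finset.sum_smul, Finset.smul_sum, smul_smul]
        exact Finset.sum_comm_four _
    _ = ∑ k, ∑ l, Q k l • ∑ p, ∑ q, choi Φ (a, p) (b, q) • (v k p * star (v l q)) := by
        simp only [hΦ.apply_single]
    _ = ∑ p, ∑ q, choi Φ (a, p) (b, q) • ∑ k, ∑ l, Q k l • (v k p * star (v l q)) := by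
        simp only [Finset.smul_sum, smul_smul]
        rw [Finset.sum_comm_four]
        simp only [mul_comm]
    _ = algebraMap ℂ A (∑ k, ∑ l, Q k l * choi Φ (a, k) (b, l)) := by
        have h1 (p q : κ) : ∑ k, ∑ l, Q k l • (v k p * star (v l q)) = algebraMap ℂ A (Q p q) := by
          rw [← contra_conj_apply, hQ, amp_apply]
        simp only [h1]
        simp only [map_sum, Algebra.smul_def]
        refine Finset.sum_congr rfl fun i _ => Finset.sum_congr rfl fun j _ => ?_
        rw [← map_mul, mul_comm]

end

theorem trace_eq_sum_functional (Ψ : Matrix ι ι ℂ →ₗ[ℂ] Matrix κ κ ℂ) (T : Matrix κ κ ℂ)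
    (X : Matrix ι ι ℂ) :
    (T * Ψ X).trace = ((Matrix.of fun i j => (T * Ψ (Matrix.single i j 1)).trace).transpose
      * X).trace := by
  let f : Matrix ι ι ℂ →ₗ[ℂ] ℂ := Matrix.traceLinearMap κ ℂ ℂ ∘ₗ LinearMap.mulLeft ℂ T ∘ₗ Ψ
  have h (Y : Matrix ι ι ℂ) : (T * Ψ Y).trace = f Y := rfl
  simp only [h]
  conv_lhs => rw [Matrix.matrix_eq_sum_single X]
  simp only [map_sum, Matrix.trace, Matrix.diag_apply, Matrix.mul_apply, Matrix.transpose_apply,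
    Matrix.of_apply]
  rw [Finset.sum_comm]
  refine Finset.sum_congr rfl fun i _ => Finset.sum_congr rfl fun j _ => ?_
  have : Matrix.single j i (X j i) = X j i • Matrix.single j i (1 : ℂ) := by
    rw [Matrix.smul_single, smul_eq_mul, mul_one]
  rw [this, map_smul, smul_eq_mul, mul_comm]

/-- Up to a scalar, `Q_u` is the only matrix invariant under `u^c`. -/
theorem IsQSqrt.eq_smul_of_invariant {u : Matrix ι ι A} {R : Matrix ι ι ℂ} (hR : IsQSqrt u R)
    (hirr : IsIrreducible u) {F : Matrix ι ι ℂ}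
    (hF : (contra u).conjTranspose * amp (A := A) F * contra u = amp (A := A) F) :
    ∃ c : ℂ, F = c • R ^ 2 := by
  have h1 := hR.contra_mul_conjTranspose
  have h2 : (R ^ 2)⁻¹ * F ∈ Hom (contra u) (contra u) := by
    rw [mem_hom_iff, amp_mul]
    nth_rewrite 1 [← hF]
    nth_rewrite 2 [← h1]
    simp only [Matrix.mul_assoc]
  obtain ⟨c, hc⟩ := hirr.contra_hom h2
  refine ⟨c, ?_⟩
  have hd := (Matrix.isUnit_iff_isUnit_det _).mp hR.posDef_sq.isUnit
  rw [← Matrix.mul_nonsing_inv_cancel_left (R ^ 2) F hd, hc, Matrix.mul_smul, Matrix.mul_one]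

section Irrep

variable [Nontrivial A] {G : CompactQuantumGroup A} {α β : G.Irrep}
  {Φ : Matrix (Fin α.n) (Fin α.n) ℂ →ₗ[ℂ] Matrix (Fin β.n) (Fin β.n) ℂ}

theorem Irrep.n_pos (α : G.Irrep) : 0 < α.n := by
  obtain ⟨i⟩ := α.irreducible.1
  exact i.pos

theorem Irrep.exists_trace_qMatrix (α : G.Irrep) :
    0 < qDim α.u ∧ (qMatrix α.u).trace = (qDim α.u : ℂ) := by
  have := α.irreducible.1
  obtain ⟨a, ha, h⟩ := α.isQSqrt.posDef_sq.exists_trace_eq_ofReal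
  have h1 : qDim α.u = a := by rw [qDim, qMatrix, h, Complex.ofReal_re]
  rw [h1]
  exact ⟨ha, h⟩

theorem IsCovariant.map_one_eq (hΦ : IsCovariant α.u β.u Φ) (htp : ∀ X, (Φ X).trace = X.trace) :
    Φ 1 = ((α.n : ℂ) / β.n) • (1 : Matrix (Fin β.n) (Fin β.n) ℂ) := by
  obtain ⟨c, hc⟩ := β.irreducible.2 _ (hΦ.map_one_mem_hom α.unitary β.unitary)
  have h := htp 1
  rw [hc, Matrix.trace_smul, Matrix.trace_one, Matrix.trace_one, Fintype.card_fin,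
    Fintype.card_fin, smul_eq_mul] at h
  have hb : (β.n : ℂ) ≠ 0 := by exact_mod_cast β.n_pos.ne'
  rw [hc, ← h, mul_div_cancel_right₀ _ hb]

/-- Both sides are functionals invariant under the contragredient of α, and these form a line. The
constant is found at X = 1, where Φ(1) is a known scalar. -/
theorem IsCovariant.trace_qMatrix_mul (hΦ : IsCovariant α.u β.u Φ)
    (htp : ∀ X, (Φ X).trace = X.trace) (X : Matrix (Fin α.n) (Fin α.n) ℂ) :
    ((qMatrix β.u).transpose * Φ X).trace =
      ((α.n : ℂ) * qDim β.u / (β.n * qDim α.u)) * ((qMatrix α.u).transpose * X).trace := by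
  obtain ⟨c, hc⟩ := α.isQSqrt.eq_smul_of_invariant α.irreducible
    (hΦ.invariant β.isQSqrt.contra_conjTranspose_mul)
  have h (Y : Matrix (Fin α.n) (Fin α.n) ℂ) : ((qMatrix β.u).transpose * Φ Y).trace =
      c * ((qMatrix α.u).transpose * Y).trace := by
    rw [trace_eq_sum_functional]
    change ((Matrix.of fun i j =>
      ((qSqrt β.u ^ 2).transpose * Φ (Matrix.single i j 1)).trace).transpose * Y).trace = _
    rw [hc, Matrix.transpose_smul, Matrix.smul_mul, Matrix.trace_smul, smul_eq_mul]
    rfl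
  have h1 := h 1
  rw [hΦ.map_one_eq htp, Matrix.mul_smul, Matrix.mul_one, Matrix.mul_one, Matrix.trace_smul,
    Matrix.trace_transpose, Matrix.trace_transpose, α.exists_trace_qMatrix.2,
    β.exists_trace_qMatrix.2, smul_eq_mul] at h1
  have ha : (qDim α.u : ℂ) ≠ 0 := by exact_mod_cast α.exists_trace_qMatrix.1.ne'
  have hb : (β.n : ℂ) ≠ 0 := by exact_mod_cast β.n_pos.ne'
  rw [h]
  congr 1
  rw [eq_div_iff (mul_ne_zero hb ha), mul_comm (β.n : ℂ), ← mul_assoc, ← h1]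
  field_simp

/-- For X ≥ 0, pairing ‖Q_β‖ − Q_β ≥ 0 with Φ(X) ≥ 0 gives c Tr(Q_αᵗ X) ≤ ‖Q_β‖ Tr X. Rank one X
turn this into Q_α ≤ ‖Q_β‖/c. -/
theorem IsCovariant.norm_qMatrix_le (hΦ : IsCovariant α.u β.u Φ) (hΦ' : IsCPTP Φ) :
    α.n * qNorm α.u / qDim α.u ≤ β.n * qNorm β.u / qDim β.u := by
  have hna : (0 : ℝ) < α.n := by exact_mod_cast α.n_pos
  have hnb : (0 : ℝ) < β.n := by exact_mod_cast β.n_pos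
  have hda := α.exists_trace_qMatrix.1
  have hdb := β.exists_trace_qMatrix.1
  have hQa : (qMatrix α.u).PosDef := α.isQSqrt.posDef_sq
  have hQb : (qMatrix β.u).PosDef := β.isQSqrt.posDef_sq
  set c : ℝ := α.n * qDim β.u / (β.n * qDim α.u) with hc
  have hc0 : 0 < c := by positivity
  set m : ℝ := qNorm β.u / c with hm
  have hm0 : 0 ≤ m := div_nonneg (norm_nonneg _) hc0.le
  have key : (((m : ℝ) : ℂ) • (1 : Matrix (Fin α.n) (Fin α.n) ℂ) - qMatrix α.u).PosSemidef := by
    refine Matrix.PosSemidef.of_dotProduct_mulVec_nonneg ?_ fun x => ?_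
    · refine Matrix.IsHermitian.sub ?_ hQa.isHermitian
      rw [Matrix.IsHermitian, Matrix.conjTranspose_smul, Matrix.conjTranspose_one]
      simp
    have hX := Matrix.posSemidef_vecMulVec_star_self x
    -- The conjugation sits on the left factor because the modular matrix enters transposed: Tr(Qᵗ
    -- X) is then x*Qx.
    set X := Matrix.vecMulVec (star x) x with hXdef
    have h1 := Matrix.PosSemidef.trace_mul_nonneg hQb.posSemidef.norm_smul_one_sub.transpose
      (hΦ'.map_posSemidef hX)
    rw [Matrix.transpose_sub, Matrix.transpose_smul, Matrix.transpose_one, Matrix.sub_mul,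
      Matrix.smul_mul, Matrix.one_mul, Matrix.trace_sub, Matrix.trace_smul, hΦ'.tp,
      hΦ.trace_qMatrix_mul hΦ'.tp, smul_eq_mul] at h1
    have h2 : ((qMatrix α.u).transpose * X).trace = star x ⬝ᵥ (qMatrix α.u).mulVec x := by
      rw [hXdef, Matrix.mul_vecMulVec, Matrix.trace_vecMulVec, Matrix.mulVec_transpose,
        Matrix.dotProduct_mulVec]
    have h3 : X.trace = star x ⬝ᵥ x := by rw [hXdef, Matrix.trace_vecMulVec]
    rw [Matrix.sub_mulVec, Matrix.smul_mulVec, Matrix.one_mulVec, dotProduct_sub, dotProduct_smul,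
      ← h2, ← h3, smul_eq_mul]
    have h4 : ((α.n : ℂ) * qDim β.u / (β.n * qDim α.u)) = ((c : ℝ) : ℂ) := by
      rw [hc]; push_cast; rfl
    rw [h4] at h1
    have hcc : (c : ℂ) ≠ 0 := by exact_mod_cast hc0.ne'
    have h5 : (m : ℂ) * X.trace - ((qMatrix α.u).transpose * X).trace =
        ((c⁻¹ : ℝ) : ℂ) * ((qNorm β.u : ℂ) * X.trace -
          (c : ℂ) * ((qMatrix α.u).transpose * X).trace) := by
      rw [hm]; push_cast; field_simp
    rw [h5]
    refine mul_nonneg ?_ h1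
    exact_mod_cast (inv_pos.mpr hc0).le
  have hle : qNorm α.u ≤ m := hQa.posSemidef.norm_le hm0 key
  calc α.n * qNorm α.u / qDim α.u ≤ α.n * m / qDim α.u := by gcongr
    _ = β.n * qNorm β.u / qDim β.u := by
      rw [hm, hc]; field_simp

end Irrep

end CompactQuantumGroup

/-! ### Schur's lemma and multiplicity-free decompositions -/

namespace CompactQuantumGroup

variable {A : Type*} [CStarAlgebra A] [PartialOrder A] [StarOrderedRing A]
  {ι κ : Type*} [Fintype ι] [DecidableEq ι] [Fintype κ] [DecidableEq κ]

theorem commute_one_apply {R : Type*} [Semiring R] (a : R) (i j : ι) :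
    Commute a ((1 : Matrix ι ι R) i j) := by
  rw [Matrix.one_apply]; split_ifs
  · exact Commute.one_right a
  · exact Commute.zero_right a

theorem commute_amp_apply {ι' κ' : Type*} (a : A) (T : Matrix ι' κ' ℂ) (i : ι') (j : κ') :
    Commute a (amp (A := A) T i j) :=
  (Algebra.commutes (T i j) a).symm

theorem kronecker_eq_mul (u : Matrix ι ι A) (v : Matrix κ κ A) :
    u ⊗ₖ v = (u ⊗ₖ (1 : Matrix κ κ A)) * ((1 : Matrix ι ι A) ⊗ₖ v) := by
  rw [kronecker_mul_kronecker fun i j k l => commute_one_apply _ k l, Matrix.mul_one,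
    Matrix.one_mul]

theorem amp_kronecker {ι' κ' : Type*} (S : Matrix ι ι' ℂ) (T : Matrix κ κ' ℂ) :
    amp (A := A) (S ⊗ₖ T) = amp (A := A) S ⊗ₖ amp (A := A) T := by
  refine Matrix.ext fun p q => ?_
  simp [amp_apply]

theorem conjTranspose_kronecker_one (u : Matrix ι ι A) :
    (u ⊗ₖ (1 : Matrix κ κ A)).conjTranspose = u.conjTranspose ⊗ₖ 1 := by
  refine Matrix.ext fun p q => ?_
  simp only [Matrix.conjTranspose_apply, Matrix.kroneckerMap_apply, star_mul, Matrix.one_apply]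
  by_cases h : p.2 = q.2
  · simp [h]
  · simp [h, Ne.symm h]

theorem conjTranspose_one_kronecker (v : Matrix κ κ A) :
    ((1 : Matrix ι ι A) ⊗ₖ v).conjTranspose = 1 ⊗ₖ v.conjTranspose := by
  refine Matrix.ext fun p q => ?_
  simp only [Matrix.conjTranspose_apply, Matrix.kroneckerMap_apply, star_mul, Matrix.one_apply]
  by_cases h : p.1 = q.1
  · simp [h]
  · simp [h, Ne.symm h]

theorem kronecker_one_mul (u u' : Matrix ι ι A) :
    (u ⊗ₖ (1 : Matrix κ κ A)) * (u' ⊗ₖ 1) = (u * u') ⊗ₖ 1 := by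
  rw [kronecker_mul_kronecker (N := (1 : Matrix κ κ A)) fun i j k l =>
    (commute_one_apply _ i j).symm, Matrix.mul_one]

theorem one_kronecker_mul (v v' : Matrix κ κ A) :
    ((1 : Matrix ι ι A) ⊗ₖ v) * (1 ⊗ₖ v') = 1 ⊗ₖ (v * v') := by
  rw [kronecker_mul_kronecker fun i j k l => commute_one_apply _ k l, Matrix.mul_one]

theorem kronecker_mem_unitary {u : Matrix ι ι A} {v : Matrix κ κ A}
    (hu : u ∈ unitary (Matrix ι ι A)) (hv : v ∈ unitary (Matrix κ κ A)) :
    u ⊗ₖ v ∈ unitary (Matrix (ι × κ) (ι × κ) A) := by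
  rw [kronecker_eq_mul]
  have hu1 : u.conjTranspose * u = 1 := hu.1
  have hu2 : u * u.conjTranspose = 1 := hu.2
  have hv1 : v.conjTranspose * v = 1 := hv.1
  have hv2 : v * v.conjTranspose = 1 := hv.2
  refine mul_mem ⟨?_, ?_⟩ ⟨?_, ?_⟩
  · rw [Matrix.star_eq_conjTranspose, conjTranspose_kronecker_one, kronecker_one_mul, hu1,
      Matrix.one_kronecker_one]
  · rw [Matrix.star_eq_conjTranspose, conjTranspose_kronecker_one, kronecker_one_mul, hu2,
      Matrix.one_kronecker_one]
  · rw [Matrix.star_eq_conjTranspose, conjTranspose_one_kronecker, one_kronecker_mul, hv1,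
      Matrix.one_kronecker_one]
  · rw [Matrix.star_eq_conjTranspose, conjTranspose_one_kronecker, one_kronecker_mul, hv2,
      Matrix.one_kronecker_one]

/-- The adjoint of a nonzero intertwiner from an irreducible unitary representation is a multiple
of its inverse. -/
theorem IsIrreducible.exists_conjTranspose_mul_self {u : Matrix ι ι A} {w : Matrix κ κ A}
    (hirr : IsIrreducible u) (hu : u ∈ unitary (Matrix ι ι A)) (hw : w ∈ unitary (Matrix κ κ A))
    {T : Matrix κ ι ℂ} (hT : T ∈ Hom u w) (hT0 : T ≠ 0) :
    ∃ a : ℝ, 0 < a ∧ T.conjTranspose * T = (a : ℂ) • (1 : Matrix ι ι ℂ) := by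
  obtain ⟨c, hc⟩ := hirr.2 _ (hom_mul (hom_conjTranspose hu hw hT) hT)
  have hc' : T.conjTranspose * T = c • (1 : Matrix ι ι ℂ) := hc
  obtain ⟨i⟩ := hirr.1
  have h0 : 0 ≤ c := by
    have h := (Matrix.posSemidef_conjTranspose_mul_self T).diag_nonneg (i := i)
    rw [hc'] at h
    simpa using h
  have hne : c ≠ 0 := by
    rintro rfl
    rw [zero_smul] at hc'
    exact hT0 (Matrix.conjTranspose_mul_self_eq_zero.mp hc')
  have hpos := lt_of_le_of_ne h0 hne.symm
  rw [Complex.lt_def] at hpos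
  refine ⟨c.re, hpos.1, ?_⟩
  rw [hc']
  congr 1
  exact Complex.ext rfl hpos.2.symm

/-- Schur's lemma. -/
theorem eq_zero_of_not_equivalent {u : Matrix ι ι A} {w : Matrix κ κ A}
    (hiu : IsIrreducible u) (hiw : IsIrreducible w)
    (hu : u ∈ unitary (Matrix ι ι A)) (hw : w ∈ unitary (Matrix κ κ A))
    (h : ¬ Equivalent u w) {T : Matrix κ ι ℂ} (hT : T ∈ Hom u w) : T = 0 := by
  by_contra hT0
  obtain ⟨a, ha, h1⟩ := hiu.exists_conjTranspose_mul_self hu hw hT hT0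
  obtain ⟨b, hb, h2⟩ := hiw.exists_conjTranspose_mul_self hw hu (hom_conjTranspose hu hw hT)
    (by rwa [Ne, Matrix.conjTranspose_eq_zero])
  rw [Matrix.conjTranspose_conjTranspose] at h2
  have hac : (a : ℂ) ≠ 0 := by exact_mod_cast ha.ne'
  -- Evaluate TT*T in both ways.
  have hab : (b : ℂ) = a := by
    have h3 : (b : ℂ) • T = (a : ℂ) • T := by
      rw [← Matrix.mul_one ((a : ℂ) • T), Matrix.smul_mul, ← Matrix.mul_smul, ← h1,
        ← Matrix.mul_assoc, h2, Matrix.smul_mul, Matrix.one_mul]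
    have h4 : ((b : ℂ) - a) • T = 0 := by rw [sub_smul, h3, sub_self]
    exact sub_eq_zero.mp ((smul_eq_zero.mp h4).resolve_right hT0)
  refine h ⟨T, hT, (a : ℂ)⁻¹ • T.conjTranspose, ?_, ?_⟩
  · rw [Matrix.smul_mul, h1, smul_smul, inv_mul_cancel₀ hac, one_smul]
  · rw [Matrix.mul_smul, h2, hab, smul_smul, inv_mul_cancel₀ hac, one_smul]

theorem hom_smul {u : Matrix ι ι A} {w : Matrix κ κ A} {T : Matrix κ ι ℂ} (hT : T ∈ Hom u w)
    (c : ℂ) : c • T ∈ Hom u w := by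
  rw [mem_hom_iff] at *
  rw [amp_smul, Matrix.mul_smul, hT, Matrix.smul_mul]

theorem Equivalent.symm {u : Matrix ι ι A} {w : Matrix κ κ A} (h : Equivalent u w) :
    Equivalent w u := by
  obtain ⟨T, hT, S, hST, hTS⟩ := h
  refine ⟨S, ?_, T, hTS, hST⟩
  have hST' : S * T = 1 := hST
  have hTS' : T * S = 1 := hTS
  rw [mem_hom_iff] at hT ⊢
  have h1 := congrArg (fun M => amp (A := A) S * M * amp (A := A) S) hT
  rw [Matrix.mul_assoc, Matrix.mul_assoc, ← amp_mul, hTS', amp_one, Matrix.mul_one,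
    ← Matrix.mul_assoc, ← amp_mul, hST', amp_one, Matrix.one_mul] at h1
  exact h1.symm

section Decomposition

variable {G : CompactQuantumGroup A} {N : ℕ} {δ : Fin N → G.Irrep} {w : Matrix κ κ A}

/-- The inclusion of a summand of a direct sum is an intertwiner. -/
theorem summand_mem_hom {S : Matrix κ (Σ j, Fin (δ j).n) ℂ}
    (hS : S ∈ Hom (Matrix.blockDiagonal' fun j => (δ j).u) w) (j : Fin N) :
    S.submatrix id (fun x => ⟨j, x⟩) ∈ Hom (δ j).u w := by
  rw [mem_hom_iff] at *
  refine Matrix.ext fun p x => ?_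
  have h := congrFun (congrFun hS p) ⟨j, x⟩
  rw [Matrix.mul_apply, Matrix.mul_apply, Fintype.sum_sigma, Finset.sum_eq_single j] at h
  · simp only [Matrix.blockDiagonal'_apply_eq] at h
    exact h
  · intro k _ hk
    refine Finset.sum_eq_zero fun y _ => ?_
    rw [Matrix.blockDiagonal'_apply_ne _ _ _ hk, mul_zero]
  · simp

/-- A multiplicity-free unitary representation is an orthogonal direct sum of irreducible ones. -/
theorem exists_isometries (hw : w ∈ unitary (Matrix κ κ A))
    (hδ : ∀ j k, j ≠ k → ¬ Equivalent (δ j).u (δ k).u)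
    (hwδ : Equivalent w (Matrix.blockDiagonal' fun j => (δ j).u)) :
    ∃ V : ∀ j, Matrix κ (Fin (δ j).n) ℂ, (∀ j, V j ∈ Hom (δ j).u w) ∧
      (∀ j, (V j).conjTranspose * V j = 1) ∧ ∑ j, V j * (V j).conjTranspose = 1 := by
  obtain ⟨S, hS, T, hTS, hST⟩ := hwδ.symm
  have hST' : S * T = 1 := hST
  have hTS' : T * S = 1 := hTS
  -- The given equivalence S need not be unitary. Its block columns are multiples of isometries by
  -- irreducibility, and mutually orthogonal by inequivalence of the summands.
  set U : ∀ j, Matrix κ (Fin (δ j).n) ℂ := fun j => S.submatrix id (fun x => ⟨j, x⟩) with hU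
  have hUh (j : Fin N) : U j ∈ Hom (δ j).u w := summand_mem_hom hS j
  have hU0 (j : Fin N) : U j ≠ 0 := by
    intro h
    obtain ⟨x⟩ := (δ j).irreducible.1
    have h1 := congrFun (congrFun hTS' ⟨j, x⟩) ⟨j, x⟩
    rw [Matrix.mul_apply, Matrix.one_apply_eq, Finset.sum_eq_zero] at h1
    · exact zero_ne_one h1
    · intro p _
      have : S p ⟨j, x⟩ = 0 := congrFun (congrFun h p) x
      rw [this, mul_zero]
  choose a ha haU using fun j => (δ j).irreducible.exists_conjTranspose_mul_self (δ j).unitary hw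
    (hUh j) (hU0 j)
  have hsq (j : Fin N) : ((Real.sqrt (a j) : ℝ) : ℂ) * (Real.sqrt (a j) : ℝ) = a j := by
    exact_mod_cast Real.mul_self_sqrt (ha j).le
  have hs0 (j : Fin N) : ((Real.sqrt (a j) : ℝ) : ℂ) ≠ 0 := by
    exact_mod_cast (Real.sqrt_pos.mpr (ha j)).ne'
  set V : ∀ j, Matrix κ (Fin (δ j).n) ℂ := fun j => ((Real.sqrt (a j) : ℝ) : ℂ)⁻¹ • U j with hV
  have hVh (j : Fin N) : V j ∈ Hom (δ j).u w := hom_smul (hUh j) _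
  have hVV (j : Fin N) : (V j).conjTranspose * V j = 1 := by
    rw [hV]
    dsimp only
    rw [Matrix.conjTranspose_smul, Matrix.smul_mul, Matrix.mul_smul, haU, smul_smul, smul_smul,
      star_inv₀, ← hsq j]
    have : star ((Real.sqrt (a j) : ℝ) : ℂ) = (Real.sqrt (a j) : ℝ) := Complex.conj_ofReal _
    rw [this, mul_assoc, inv_mul_cancel_left₀ (hs0 j), inv_mul_cancel₀ (hs0 j), one_smul]
  refine ⟨V, hVh, hVV, ?_⟩
  have hVU (j : Fin N) : U j = ((Real.sqrt (a j) : ℝ) : ℂ) • V j := by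
    rw [hV]
    dsimp only
    rw [smul_smul, mul_inv_cancel₀ (hs0 j), one_smul]
  -- The sum of the range projections fixes each block column of S, hence S; since S is invertible,
  -- the sum is 1.
  have hpU (i : Fin N) : (∑ j, V j * (V j).conjTranspose) * U i = U i := by
    rw [Matrix.sum_mul, Finset.sum_eq_single i]
    · rw [hVU, Matrix.mul_smul, Matrix.mul_assoc, hVV, Matrix.mul_one]
    · intro j _ hj
      have h0 : (V j).conjTranspose * U i = 0 :=
        eq_zero_of_not_equivalent (δ i).irreducible (δ j).irreducible (δ i).unitary (δ j).unitary
          (hδ i j hj.symm) (hom_mul (hom_conjTranspose (δ j).unitary hw (hVh j)) (hUh i))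
      rw [Matrix.mul_assoc, h0, Matrix.mul_zero]
    · simp
  have hpS : (∑ j, V j * (V j).conjTranspose) * S = S := by
    refine Matrix.ext fun p x => ?_
    obtain ⟨i, x⟩ := x
    exact congrFun (congrFun (hpU i) p) x
  rw [← Matrix.mul_one (∑ j, V j * (V j).conjTranspose), ← hST', ← Matrix.mul_assoc, hpS]

/-- A positive intertwiner of a multiplicity-free representation is a positive combination of the
projections onto the irreducible summands. -/
theorem exists_spectral_decomposition (hw : w ∈ unitary (Matrix κ κ A))
    (hδ : ∀ j k, j ≠ k → ¬ Equivalent (δ j).u (δ k).u)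
    {V : ∀ j, Matrix κ (Fin (δ j).n) ℂ} (hV : ∀ j, V j ∈ Hom (δ j).u w)
    (hV1 : ∑ j, V j * (V j).conjTranspose = 1) {D : Matrix κ κ ℂ} (hD : D ∈ Hom w w)
    (hD0 : D.PosSemidef) :
    ∃ d : Fin N → ℝ, (∀ j, 0 ≤ d j) ∧
      D = ∑ j, (d j : ℂ) • (V j * (V j).conjTranspose) := by
  have hVs (j : Fin N) : (V j).conjTranspose ∈ Hom w (δ j).u :=
    hom_conjTranspose (δ j).unitary hw (hV j)
  have hd (j : Fin N) : ∃ d : ℝ, 0 ≤ d ∧ (V j).conjTranspose * D * V j =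
      (d : ℂ) • (1 : Matrix (Fin (δ j).n) (Fin (δ j).n) ℂ) := by
    obtain ⟨c, hc⟩ := (δ j).irreducible.2 _ (hom_mul (hom_mul (hVs j) hD) (hV j))
    have hc' : (V j).conjTranspose * D * V j =
      c • (1 : Matrix (Fin (δ j).n) (Fin (δ j).n) ℂ) := hc
    obtain ⟨x⟩ := (δ j).irreducible.1
    have h := (hD0.conjTranspose_mul_mul_same (V j)).diag_nonneg (i := x)
    rw [hc', Matrix.smul_apply, Matrix.one_apply_eq, smul_eq_mul, mul_one, Complex.le_def] at h
    refine ⟨c.re, h.1, ?_⟩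
    rw [hc']
    congr 1
    exact Complex.ext rfl h.2.symm
  choose d hd0 hdV using hd
  refine ⟨d, hd0, ?_⟩
  calc D = (∑ i, V i * (V i).conjTranspose) * D * (∑ j, V j * (V j).conjTranspose) := by
        rw [hV1, Matrix.one_mul, Matrix.mul_one]
    _ = ∑ i, ∑ j, V i * ((V i).conjTranspose * D * V j) * (V j).conjTranspose := by
        rw [Matrix.sum_mul, Matrix.sum_mul]
        refine Finset.sum_congr rfl fun i _ => ?_
        rw [Matrix.mul_sum]
        simp only [Matrix.mul_assoc]
    _ = ∑ i, (d i : ℂ) • (V i * (V i).conjTranspose) := by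
        refine Finset.sum_congr rfl fun i _ => ?_
        rw [Finset.sum_eq_single i]
        · rw [hdV, Matrix.mul_smul, Matrix.mul_one, Matrix.smul_mul]
        · intro j _ hj
          have h0 : (V i).conjTranspose * D * V j = 0 :=
            eq_zero_of_not_equivalent (δ j).irreducible (δ i).irreducible (δ j).unitary
              (δ i).unitary (hδ j i hj) (hom_mul (hom_mul (hVs i) hD) (hV j))
          rw [h0, Matrix.mul_zero, Matrix.zero_mul]
        · simp

end Decomposition

end CompactQuantumGroup

/-! ### The normalized Choi matrix as an intertwiner -/

namespace CompactQuantumGroup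

variable {A : Type*} [CStarAlgebra A] [PartialOrder A] [StarOrderedRing A]
  {ι κ μ : Type*} [Fintype ι] [DecidableEq ι] [Fintype κ] [DecidableEq κ]

section

variable {R : Type*} [Semiring R]

theorem kronecker_one_mul_apply (M : Matrix ι ι R) (N : Matrix (ι × κ) μ R) (p : ι × κ) (q : μ) :
    ((M ⊗ₖ (1 : Matrix κ κ R)) * N) p q = ∑ i, M p.1 i * N (i, p.2) q := by
  rw [Matrix.mul_apply, Fintype.sum_prod_type]
  refine Finset.sum_congr rfl fun i _ => ?_
  rw [Finset.sum_eq_single p.2]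
  · simp
  · intro k _ hk; simp [Matrix.one_apply_ne hk.symm]
  · simp

theorem one_kronecker_mul_apply (M : Matrix κ κ R) (N : Matrix (ι × κ) μ R) (p : ι × κ) (q : μ) :
    (((1 : Matrix ι ι R) ⊗ₖ M) * N) p q = ∑ k, M p.2 k * N (p.1, k) q := by
  rw [Matrix.mul_apply, Fintype.sum_prod_type, Finset.sum_eq_single p.1]
  · simp
  · intro i _ hi; simp [Matrix.one_apply_ne hi.symm]
  · simp

theorem mul_kronecker_one_apply (N : Matrix μ (ι × κ) R) (M : Matrix ι ι R) (p : μ) (q : ι × κ) :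
    (N * (M ⊗ₖ (1 : Matrix κ κ R))) p q = ∑ i, N p (i, q.2) * M i q.1 := by
  rw [Matrix.mul_apply, Fintype.sum_prod_type]
  refine Finset.sum_congr rfl fun i _ => ?_
  rw [Finset.sum_eq_single q.2]
  · simp
  · intro k _ hk; simp [Matrix.one_apply_ne hk]
  · simp

theorem mul_one_kronecker_apply (N : Matrix μ (ι × κ) R) (M : Matrix κ κ R) (p : μ) (q : ι × κ) :
    (N * ((1 : Matrix ι ι R) ⊗ₖ M)) p q = ∑ k, N p (q.1, k) * M k q.2 := by
  rw [Matrix.mul_apply, Fintype.sum_prod_type, Finset.sum_eq_single q.1]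
  · simp
  · intro i _ hi; simp [Matrix.one_apply_ne hi]
  · simp

end

/-- Covariance of `Φ` in terms of its Choi matrix. -/
theorem IsCovariant.choi_eq {u : Matrix ι ι A} {v : Matrix κ κ A}
    {Φ : Matrix ι ι ℂ →ₗ[ℂ] Matrix κ κ ℂ} (hΦ : IsCovariant u v Φ) :
    ((contra u).conjTranspose ⊗ₖ (1 : Matrix κ κ A)) * amp (A := A) (choi Φ) *
      (contra u ⊗ₖ (1 : Matrix κ κ A)) =
    ((1 : Matrix ι ι A) ⊗ₖ v) * amp (A := A) (choi Φ) *
      ((1 : Matrix ι ι A) ⊗ₖ v.conjTranspose) := by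
  refine Matrix.ext fun ⟨a, k⟩ ⟨b, l⟩ => ?_
  rw [mul_kronecker_one_apply, mul_one_kronecker_apply]
  simp only [kronecker_one_mul_apply, one_kronecker_mul_apply, amp_apply, contra,
    Matrix.conjTranspose_apply, Matrix.map_apply, star_star, Finset.sum_mul]
  have h := hΦ.apply_single a b k l
  rw [Finset.sum_comm] at h
  nth_rewrite 2 [Finset.sum_comm] at h
  simp only [Algebra.smul_def, Algebra.commutes (choi Φ _ _)] at h ⊢
  simpa only [mul_assoc, ← Algebra.commutes (choi Φ _ _)] using h

theorem hom_conj_kronecker {u : Matrix ι ι A} {v : Matrix κ κ A} {R : Matrix ι ι ℂ}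
    (hR : IsUnit R) :
    R ⊗ₖ (1 : Matrix κ κ ℂ) ∈ Hom (contra u ⊗ₖ v)
      ((amp (A := A) R * contra u * amp (A := A) R⁻¹) ⊗ₖ v) := by
  rw [mem_hom_iff, amp_kronecker, amp_one,
    kronecker_mul_kronecker (M' := amp (A := A) R) fun i j k l => commute_amp_apply _ _ _ _,
    kronecker_mul_kronecker (N := (1 : Matrix κ κ A)) fun i j k l => (commute_one_apply _ i j).symm,
    Matrix.mul_assoc, amp_inv_mul hR, Matrix.mul_one, Matrix.mul_one, Matrix.one_mul]

theorem hom_conj_kronecker_inv {u : Matrix ι ι A} {v : Matrix κ κ A} {R : Matrix ι ι ℂ}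
    (hR : IsUnit R) :
    R⁻¹ ⊗ₖ (1 : Matrix κ κ ℂ) ∈ Hom
      ((amp (A := A) R * contra u * amp (A := A) R⁻¹) ⊗ₖ v) (contra u ⊗ₖ v) := by
  rw [mem_hom_iff, amp_kronecker, amp_one,
    kronecker_mul_kronecker (M' := amp (A := A) R⁻¹) fun i j k l => commute_amp_apply _ _ _ _,
    kronecker_mul_kronecker (N := (1 : Matrix κ κ A)) fun i j k l => (commute_one_apply _ i j).symm,
    ← Matrix.mul_assoc, ← Matrix.mul_assoc, amp_inv_mul hR, Matrix.one_mul, Matrix.one_mul,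
    Matrix.mul_one]

/-- Covariance of C has v on both sides but u^c only as (u^c)* on the left and u^c on the right. The
relation u^c Q⁻¹ (u^c)* = Q⁻¹ moves the left factor across, at the price of the factor Q⁻¹. -/
theorem IsCovariant.choi_mem_hom {u : Matrix ι ι A} {v : Matrix κ κ A}
    {Φ : Matrix ι ι ℂ →ₗ[ℂ] Matrix κ κ ℂ} (hΦ : IsCovariant u v Φ)
    (hv : v ∈ unitary (Matrix κ κ A)) {R : Matrix ι ι ℂ} (hR : IsQSqrt u R) :
    ((R ^ 2)⁻¹ ⊗ₖ (1 : Matrix κ κ ℂ)) * choi Φ ∈ Hom (contra u ⊗ₖ v) (contra u ⊗ₖ v) := by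
  have hv1 : v.conjTranspose * v = 1 := hv.1
  have h1 := congrArg (fun M => M * ((1 : Matrix ι ι A) ⊗ₖ v)) hΦ.choi_eq
  rw [Matrix.mul_assoc _ (contra u ⊗ₖ _), ← kronecker_eq_mul, Matrix.mul_assoc _ (1 ⊗ₖ _),
    one_kronecker_mul, hv1, Matrix.one_kronecker_one, Matrix.mul_one] at h1
  have h2 := hR.contra_mul_conjTranspose
  have h3 := congrArg (fun M => ((contra u * amp (A := A) (R ^ 2)⁻¹) ⊗ₖ (1 : Matrix κ κ A)) * M) h1
  rw [← Matrix.mul_assoc, ← Matrix.mul_assoc, kronecker_one_mul, h2] at h3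
  rw [mem_hom_iff, amp_mul, amp_kronecker, amp_one, h3, ← Matrix.mul_assoc, ← Matrix.mul_assoc]
  congr 1
  rw [kronecker_mul_kronecker (M' := amp (A := A) (R ^ 2)⁻¹) fun i j k l => commute_amp_apply _ _ _ _,
    kronecker_mul_kronecker (N := (1 : Matrix κ κ A)) fun i j k l => (commute_one_apply _ i j).symm,
    Matrix.mul_one, Matrix.mul_one, Matrix.one_mul]

/-- The normalized Choi matrix of a covariant map is an intertwiner of `ū ⊗ v`. -/
theorem IsCovariant.normalized_choi_mem_hom {u : Matrix ι ι A} {v : Matrix κ κ A}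
    {Φ : Matrix ι ι ℂ →ₗ[ℂ] Matrix κ κ ℂ} (hΦ : IsCovariant u v Φ)
    (hv : v ∈ unitary (Matrix κ κ A)) {R : Matrix ι ι ℂ} (hR : IsQSqrt u R) :
    (R⁻¹ ⊗ₖ (1 : Matrix κ κ ℂ)) * choi Φ * (R⁻¹ ⊗ₖ (1 : Matrix κ κ ℂ)) ∈
      Hom ((amp (A := A) R * contra u * amp (A := A) R⁻¹) ⊗ₖ v)
        ((amp (A := A) R * contra u * amp (A := A) R⁻¹) ⊗ₖ v) := by
  have h := hom_mul (hom_mul (hom_conj_kronecker hR.posDef.isUnit) (hΦ.choi_mem_hom hv hR))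
    (hom_conj_kronecker_inv hR.posDef.isUnit)
  have hd := (Matrix.isUnit_iff_isUnit_det _).mp hR.posDef.isUnit
  have e : R * (R ^ 2)⁻¹ = R⁻¹ := by
    rw [sq, Matrix.mul_inv_rev, ← Matrix.mul_assoc, Matrix.mul_nonsing_inv R hd, Matrix.one_mul]
  rwa [← Matrix.mul_assoc, ← Matrix.mul_kronecker_mul, e, Matrix.mul_one] at h

/-- The Choi matrix is the image under id ⊗ Φ of ξξ*, where ξ = ∑ e_i ⊗ e_i. -/
theorem choi_posSemidef {n : ℕ} {Φ : Matrix (Fin n) (Fin n) ℂ →ₗ[ℂ] Matrix κ κ ℂ}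
    (hΦ : IsCPTP Φ) : (choi Φ).PosSemidef := by
  let ξ : Fin n × Fin n → ℂ := fun p => if p.1 = p.2 then 1 else 0
  have h := hΦ.cp n _ (Matrix.posSemidef_vecMulVec_self_star ξ)
  convert h using 1
  refine Matrix.ext fun p q => ?_
  rw [choi_apply, Matrix.of_apply]
  refine congrArg (fun X => Φ X p.2 q.2) (Matrix.ext fun i j => ?_)
  simp only [Matrix.single_apply, Matrix.of_apply, Matrix.vecMulVec_apply, ξ, Pi.star_apply]
  by_cases h1 : p.1 = i <;> by_cases h2 : q.1 = j <;> simp [h1, h2]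

/-- The linear map with a given Choi matrix. -/
def ofChoi (C : Matrix (ι × κ) (ι × κ) ℂ) : Matrix ι ι ℂ →ₗ[ℂ] Matrix κ κ ℂ where
  toFun X := Matrix.of fun k l => ∑ i, ∑ j, X i j * C (i, k) (j, l)
  map_add' X Y := by
    refine Matrix.ext fun k l => ?_
    simp [add_mul, Finset.sum_add_distrib]
  map_smul' c X := by
    refine Matrix.ext fun k l => ?_
    simp [mul_assoc, Finset.mul_sum]

theorem ofChoi_apply (C : Matrix (ι × κ) (ι × κ) ℂ) (X : Matrix ι ι ℂ) (k l : κ) :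
    ofChoi C X k l = ∑ i, ∑ j, X i j * C (i, k) (j, l) := rfl

theorem ofChoi_choi (Φ : Matrix ι ι ℂ →ₗ[ℂ] Matrix κ κ ℂ) : ofChoi (choi Φ) = Φ :=
  LinearMap.ext fun X => Matrix.ext fun k l => by rw [ofChoi_apply, apply_eq_sum_choi]

theorem ofChoi_sum_smul {N : Type*} [Fintype N] (c : N → ℂ) (C : N → Matrix (ι × κ) (ι × κ) ℂ) :
    ofChoi (∑ j, c j • C j) = ∑ j, c j • ofChoi (C j) := by
  refine LinearMap.ext fun X => Matrix.ext fun k l => ?_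
  simp only [ofChoi_apply, LinearMap.sum_apply, Matrix.sum_apply, LinearMap.smul_apply,
    Matrix.smul_apply, smul_eq_mul, Finset.mul_sum]
  rw [Finset.sum_comm (s := (Finset.univ : Finset N))]
  refine Finset.sum_congr rfl fun i _ => ?_
  rw [Finset.sum_comm (s := (Finset.univ : Finset N))]
  simp only [mul_left_comm]

end CompactQuantumGroup

/-! ### Summands on which the modular matrix acts trivially -/

namespace CompactQuantumGroup

variable {A : Type*} [CStarAlgebra A] [PartialOrder A] [StarOrderedRing A]
  {ι κ : Type*} [Fintype ι] [DecidableEq ι] [Fintype κ] [DecidableEq κ]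

/-- The trace is ∑ d_j Tr((L W_j)(L W_j)*), a sum of nonnegative terms. -/
theorem mul_eq_zero_of_trace_eq_zero {N : Type*} [Fintype N] {d : N → ℝ} (hd : ∀ j, 0 ≤ d j)
    {n : N → ℕ} {W : ∀ j, Matrix κ (Fin (n j)) ℂ} {L : Matrix κ κ ℂ} (hL : L.IsHermitian)
    (h : ((L * L) * ∑ j, (d j : ℂ) • (W j * (W j).conjTranspose)).trace = 0) {j : N}
    (hj : d j ≠ 0) : L * W j = 0 := by
  have h1 (k : N) : ((L * L) * ((d k : ℂ) • (W k * (W k).conjTranspose))).trace =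
      (d k : ℂ) * ((L * W k) * (L * W k).conjTranspose).trace := by
    rw [Matrix.mul_smul, Matrix.trace_smul, smul_eq_mul, Matrix.conjTranspose_mul,
      show L.conjTranspose = L from hL, ← Matrix.mul_assoc (L * W k), Matrix.trace_mul_comm _ L]
    simp only [Matrix.mul_assoc]
  rw [Matrix.mul_sum, Matrix.trace_sum, Finset.sum_congr rfl fun k _ => h1 k,
    Finset.sum_eq_zero_iff_of_nonneg] at h
  · have h2 := (mul_eq_zero.mp (h j (Finset.mem_univ j))).resolve_left (by exact_mod_cast hj)
    exact Matrix.trace_mul_conjTranspose_self_eq_zero_iff.mp h2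
  · intro k _
    exact mul_nonneg (by exact_mod_cast hd k)
      (Matrix.posSemidef_self_mul_conjTranspose _).trace_nonneg

section Irrep

variable [Nontrivial A] {G : CompactQuantumGroup A} {α : G.Irrep}
  {Φ : Matrix (Fin α.n) (Fin α.n) ℂ →ₗ[ℂ] Matrix (Fin α.n) (Fin α.n) ℂ}

/-- The Choi matrix of a trace preserving covariant map is concentrated on the vectors fixed by
the modular matrix of `ū ⊗ u`. -/
theorem IsCovariant.trace_sq_mul_choi (hΦ : IsCovariant α.u α.u Φ)
    (htp : ∀ X, (Φ X).trace = X.trace) {L : Matrix (Fin α.n × Fin α.n) (Fin α.n × Fin α.n) ℂ}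
    (hL : L = ((qSqrt α.u)⁻¹ * (qSqrt α.u)⁻¹) ⊗ₖ (qSqrt α.u).transpose -
      1 ⊗ₖ ((qSqrt α.u)⁻¹).transpose) :
    ((L * L) * choi Φ).trace = 0 := by
  have hd := (Matrix.isUnit_iff_isUnit_det _).mp α.isQSqrt.posDef.isUnit
  have h1 := hΦ.trace_qMatrix_mul htp
  have h2 := hΦ.map_one_eq htp
  have hn : (α.n : ℂ) ≠ 0 := by exact_mod_cast α.n_pos.ne'
  have hq : (qDim α.u : ℂ) ≠ 0 := by exact_mod_cast α.exists_trace_qMatrix.1.ne'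
  rw [div_self hn, one_smul] at h2
  simp only [div_self (mul_ne_zero hn hq), one_mul, qMatrix] at h1
  generalize qSqrt α.u = R at *
  have e1 : R.transpose * (R⁻¹).transpose = 1 := by
    rw [← Matrix.transpose_mul, Matrix.nonsing_inv_mul R hd, Matrix.transpose_one]
  have e2 : (R⁻¹).transpose * R.transpose = 1 := by
    rw [← Matrix.transpose_mul, Matrix.mul_nonsing_inv R hd, Matrix.transpose_one]
  have e3 : R.transpose * R.transpose = (R ^ 2).transpose := by
    rw [← Matrix.transpose_mul, sq]
  have e4 : R⁻¹ * R⁻¹ * (R⁻¹ * R⁻¹) * R ^ 2 = R⁻¹ * R⁻¹ := by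
    rw [sq, Matrix.mul_assoc, Matrix.mul_assoc R⁻¹ R⁻¹ (R * R), ← Matrix.mul_assoc R⁻¹ R R,
      Matrix.nonsing_inv_mul R hd, Matrix.one_mul, Matrix.nonsing_inv_mul R hd, Matrix.mul_one]
  -- Since L = (1 ⊗ (R⁻¹)ᵗ)(Q⁻¹ ⊗ Qᵗ − 1), this is Q⁻² ⊗ Qᵗ − 2 Q⁻¹ ⊗ 1 + 1 ⊗ (Q⁻¹)ᵗ. Against the
  -- Choi matrix the terms are evaluated by preservation of Tr(Qᵗ · ), of Tr and of the unit, and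
  -- give (1 − 2 + 1) Tr Q⁻¹.
  have e5 : L * L = (R⁻¹ * R⁻¹ * (R⁻¹ * R⁻¹)) ⊗ₖ (R ^ 2).transpose - (R⁻¹ * R⁻¹) ⊗ₖ 1 -
      ((R⁻¹ * R⁻¹) ⊗ₖ 1 - 1 ⊗ₖ (R⁻¹.transpose * R⁻¹.transpose)) := by
    simp only [hL, mul_sub, sub_mul, ← Matrix.mul_kronecker_mul, e1, e2, e3, Matrix.one_mul,
      Matrix.mul_one]
  rw [e5, Matrix.sub_mul, Matrix.sub_mul, Matrix.sub_mul, Matrix.trace_sub, Matrix.trace_sub, Matrix.trace_sub, trace_kronecker_mul_choi,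
    trace_kronecker_mul_choi, trace_kronecker_mul_choi, h1, Matrix.one_mul, htp,
    Matrix.transpose_one, h2, Matrix.mul_one, ← Matrix.transpose_mul, ← Matrix.transpose_mul,
    Matrix.trace_transpose, Matrix.trace_transpose, e4]
  ring

end Irrep

/-- The adjoint reverses products of entries, so the factors occur in the order opposite to
`kronecker_eq_mul`. -/
theorem contra_kronecker (u : Matrix ι ι A) (v : Matrix κ κ A) :
    contra (u ⊗ₖ v) = ((1 : Matrix ι ι A) ⊗ₖ contra v) * (contra u ⊗ₖ (1 : Matrix κ κ A)) := by
  refine Matrix.ext fun p q => ?_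
  rw [one_kronecker_mul_apply, Finset.sum_eq_single q.2]
  · simp [contra]
  · intro k _ hk; simp [Matrix.one_apply_ne hk]
  · simp

/-- The invariant form on the contragredient of ū ⊗ u is the tensor product of invariant forms: Q
for u^c, and (Q⁻¹)ᵗ for the contragredient of ū, which is Rᵗ u (R⁻¹)ᵗ with u unitary. -/
theorem IsQSqrt.contra_conj_kronecker {u : Matrix ι ι A} {R : Matrix ι ι ℂ} (hR : IsQSqrt u R)
    (hu : u ∈ _root_.unitary (Matrix ι ι A)) {w : Matrix (ι × ι) (ι × ι) A}
    (hw : w = (amp (A := A) R * contra u * amp (A := A) R⁻¹) ⊗ₖ u) :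
    (contra w).conjTranspose * amp (A := A) (((R ^ 2)⁻¹).transpose ⊗ₖ (R ^ 2)) * contra w =
      amp (A := A) (((R ^ 2)⁻¹).transpose ⊗ₖ (R ^ 2)) := by
  have hd := (Matrix.isUnit_iff_isUnit_det _).mp hR.posDef.isUnit
  have hRs : R.map star = R.transpose := by
    conv_rhs => rw [← show R.conjTranspose = R from hR.posDef.isHermitian]
    rfl
  have hRis : R⁻¹.map star = R⁻¹.transpose := by
    conv_rhs => rw [← show R⁻¹.conjTranspose = R⁻¹ from hR.posDef.inv.isHermitian]
    rfl
  have hRt : R.transpose.conjTranspose = R.transpose := by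
    rw [← hRs]; exact (congrArg Matrix.transpose (map_star_map_star R)).trans hRs.symm
  have hRit : R⁻¹.transpose.conjTranspose = R⁻¹.transpose := by
    rw [← hRis]; exact (congrArg Matrix.transpose (map_star_map_star R⁻¹)).trans hRis.symm
  have hu1 : u.conjTranspose * u = 1 := hu.1
  have e1 : R.transpose * (R⁻¹).transpose = 1 := by
    rw [← Matrix.transpose_mul, Matrix.nonsing_inv_mul R hd, Matrix.transpose_one]
  have e2 : (R⁻¹).transpose * R.transpose = 1 := by
    rw [← Matrix.transpose_mul, Matrix.mul_nonsing_inv R hd, Matrix.transpose_one]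
  have e3 : ((R ^ 2)⁻¹).transpose = (R⁻¹).transpose * (R⁻¹).transpose := by
    rw [← Matrix.transpose_mul, sq, Matrix.mul_inv_rev]
  set z : Matrix ι ι A := contra (amp (A := A) R * contra u * amp (A := A) R⁻¹) with hz
  have hz1 : z = amp (A := A) R.transpose * u * amp (A := A) R⁻¹.transpose := by
    rw [hz, contra, map_star_mul_amp, map_star_amp_mul, hRs, hRis]
    rw [contra, map_star_map_star]
  have hz2 : z.conjTranspose * amp (A := A) ((R ^ 2)⁻¹).transpose * z =
      amp (A := A) ((R ^ 2)⁻¹).transpose := by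
    have e4 : amp (A := A) R.transpose * (amp (A := A) R⁻¹.transpose *
        (amp (A := A) R⁻¹.transpose * amp (A := A) R.transpose)) = 1 := by
      rw [← amp_mul, e2, amp_one, Matrix.mul_one, ← amp_mul, e1, amp_one]
    rw [hz1, Matrix.conjTranspose_mul, Matrix.conjTranspose_mul, amp_conjTranspose,
      amp_conjTranspose, hRt, hRit, e3, amp_mul]
    calc _ = amp (A := A) R⁻¹.transpose * (u.conjTranspose * ((amp (A := A) R.transpose *
        (amp (A := A) R⁻¹.transpose * (amp (A := A) R⁻¹.transpose * amp (A := A) R.transpose))) *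
          u)) * amp (A := A) R⁻¹.transpose := by simp only [Matrix.mul_assoc]
      _ = _ := by rw [e4, Matrix.one_mul, hu1, Matrix.mul_one]
  rw [hw, contra_kronecker, ← hz, Matrix.conjTranspose_mul, conjTranspose_kronecker_one,
    conjTranspose_one_kronecker, amp_kronecker]
  have h1 : ((1 : Matrix ι ι A) ⊗ₖ (contra u).conjTranspose) *
      (amp (A := A) ((R ^ 2)⁻¹).transpose ⊗ₖ amp (A := A) (R ^ 2)) *
      ((1 : Matrix ι ι A) ⊗ₖ contra u) =
      amp (A := A) ((R ^ 2)⁻¹).transpose ⊗ₖ amp (A := A) (R ^ 2) := by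
    rw [kronecker_mul_kronecker (M' := amp (A := A) ((R ^ 2)⁻¹).transpose)
      fun i j k l => commute_amp_apply _ _ _ _,
      kronecker_mul_kronecker (M' := (1 : Matrix ι ι A)) fun i j k l => commute_one_apply _ k l,
      hR.contra_conjTranspose_mul, Matrix.one_mul, Matrix.mul_one]
  have h2 : (z.conjTranspose ⊗ₖ (1 : Matrix ι ι A)) *
      (amp (A := A) ((R ^ 2)⁻¹).transpose ⊗ₖ amp (A := A) (R ^ 2)) *
      (z ⊗ₖ (1 : Matrix ι ι A)) =
      amp (A := A) ((R ^ 2)⁻¹).transpose ⊗ₖ amp (A := A) (R ^ 2) := by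
    rw [kronecker_mul_kronecker (N := (1 : Matrix ι ι A))
      fun i j k l => (commute_one_apply _ i j).symm,
      kronecker_mul_kronecker (N := (1 : Matrix ι ι A) * amp (A := A) (R ^ 2))
      fun i j k l => by
        rw [Matrix.one_mul]
        exact (commute_amp_apply _ _ _ _).symm,
      hz2, Matrix.one_mul, Matrix.mul_one]
  calc _ = (z.conjTranspose ⊗ₖ (1 : Matrix ι ι A)) *
      (((1 : Matrix ι ι A) ⊗ₖ (contra u).conjTranspose) *
      (amp (A := A) ((R ^ 2)⁻¹).transpose ⊗ₖ amp (A := A) (R ^ 2)) *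
      ((1 : Matrix ι ι A) ⊗ₖ contra u)) * (z ⊗ₖ (1 : Matrix ι ι A)) := by
        simp only [Matrix.mul_assoc]
    _ = _ := by rw [h1, h2]

/-- If the modular matrix acts trivially on a subrepresentation of `ū ⊗ u`, then the contragredient
of the subrepresentation is isometric. -/
theorem IsQSqrt.contra_conjTranspose_mul_contra {u : Matrix ι ι A} {R : Matrix ι ι ℂ}
    (hR : IsQSqrt u R) (hu : u ∈ _root_.unitary (Matrix ι ι A)) {δ : Matrix κ κ A}
    {V : Matrix (ι × ι) κ ℂ}
    (hV : V ∈ Hom δ ((amp (A := A) R * contra u * amp (A := A) R⁻¹) ⊗ₖ u))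
    (hV1 : V.conjTranspose * V = 1) (hVR : ((R ^ 2)⁻¹ ⊗ₖ (R ^ 2).transpose) * V = V) :
    (contra δ).conjTranspose * contra δ = 1 := by
  set X := ((R ^ 2)⁻¹).transpose ⊗ₖ (R ^ 2) with hX
  have h := hR.contra_conj_kronecker hu rfl
  have hc := map_star_mem_hom_contra hV
  set w := (amp (A := A) R * contra u * amp (A := A) R⁻¹) ⊗ₖ u
  rw [mem_hom_iff] at hc
  have hXs : ((R ^ 2)⁻¹ ⊗ₖ (R ^ 2).transpose).map star = X := by
    have h1 : ((R ^ 2)⁻¹).map star = ((R ^ 2)⁻¹).transpose := by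
      conv_rhs => rw [← show ((R ^ 2)⁻¹).conjTranspose = _ from hR.posDef_sq.inv.isHermitian]
      rfl
    have h2 : ((R ^ 2).transpose).map star = R ^ 2 := hR.posDef_sq.isHermitian
    have h3 (S T : Matrix ι ι ℂ) : (S ⊗ₖ T).map star = S.map star ⊗ₖ T.map star :=
      Matrix.ext fun p q => by simp
    rw [h3, h1, h2]
  have h1 : X * V.map star = V.map star := by
    have := congrArg (fun M => M.map star) hVR
    rwa [map_star_mul, hXs] at this
  have h2 : (V.map star).conjTranspose * (V.map star) = 1 := by
    have := congrArg (fun M => M.map star) hV1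
    rwa [map_star_mul, Matrix.map_one _ (star_zero _) (star_one _)] at this
  -- The invariant form X restricts to the standard one on the range of the conjugate of V. It can
  -- be inserted, δ^c moved across V into the contragredient of ū ⊗ u, and invariance of X applied.
  calc (contra δ).conjTranspose * contra δ
      = (contra δ).conjTranspose * (amp (A := A) ((V.map star).conjTranspose *
          (X * V.map star))) * contra δ := by rw [h1, h2, amp_one, Matrix.mul_one]
    _ = (amp (A := A) (V.map star) * contra δ).conjTranspose * amp (A := A) X *
          (amp (A := A) (V.map star) * contra δ) := by
        rw [Matrix.conjTranspose_mul, amp_conjTranspose, amp_mul, amp_mul]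
        simp only [Matrix.mul_assoc]
    _ = amp (A := A) (V.map star).conjTranspose * ((contra w).conjTranspose * amp (A := A) X *
          contra w) * amp (A := A) (V.map star) := by
        rw [← hc, Matrix.conjTranspose_mul, amp_conjTranspose]
        simp only [Matrix.mul_assoc]
    _ = 1 := by
        rw [h, ← amp_mul, ← amp_mul, Matrix.mul_assoc, h1, h2, amp_one]

end CompactQuantumGroup

/-! ### Summands of a direct sum as subrepresentations -/

namespace CompactQuantumGroup

variable {A : Type*} [CStarAlgebra A] [PartialOrder A] [StarOrderedRing A]
  {ι κ : Type*} [Fintype ι] [DecidableEq ι] [Fintype κ] [DecidableEq κ]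

theorem Equivalent.submatrix {μ : Type*} [Fintype μ] [DecidableEq μ] {u : Matrix ι ι A}
    {w : Matrix κ κ A} (h : Equivalent u w) (e : μ ≃ ι) : Equivalent (u.submatrix e e) w := by
  obtain ⟨T, hT, S, hST, hTS⟩ := h
  have hST' : S * T = 1 := hST
  have hTS' : T * S = 1 := hTS
  refine ⟨T.submatrix id e, ?_, S.submatrix e id, ?_, ?_⟩
  · rw [mem_hom_iff] at hT ⊢
    have h1 : (amp (A := A) T).submatrix id e * u.submatrix e e =
      (amp (A := A) T * u).submatrix id e := Matrix.submatrix_mul_equiv _ _ _ _ _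
    refine Eq.trans ?_ h1.symm
    rw [← hT]
    rfl
  · change S.submatrix e id * T.submatrix id e = 1
    rw [← Matrix.submatrix_mul S T e id e Function.bijective_id, hST', Matrix.submatrix_one_equiv]
  · change T.submatrix id e * S.submatrix e id = 1
    rw [Matrix.submatrix_mul_equiv, hTS', Matrix.submatrix_id_id]

theorem zero_tmul (b : A) : tmul (0 : A) b = 0 := (tmulₗ (A := A) (B := A)).map_zero₂ b

theorem tmul_zero (a : A) : tmul a (0 : A) = 0 := (tmulₗ (A := A) (B := A) a).map_zero

section Summand

variable {G : CompactQuantumGroup A} {N : ℕ} (δ : Fin N → G.Irrep)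

theorem blockDiagonal'_conjTranspose_mul_self :
    (Matrix.blockDiagonal' fun j => (δ j).u).conjTranspose *
      (Matrix.blockDiagonal' fun j => (δ j).u) = 1 := by
  rw [Matrix.blockDiagonal'_conjTranspose, ← Matrix.blockDiagonal'_mul, ← Matrix.blockDiagonal'_one]
  congr 1
  funext j
  exact (δ j).unitary.1

theorem blockDiagonal'_mul_conjTranspose_self :
    (Matrix.blockDiagonal' fun j => (δ j).u) *
      (Matrix.blockDiagonal' fun j => (δ j).u).conjTranspose = 1 := by
  rw [Matrix.blockDiagonal'_conjTranspose, ← Matrix.blockDiagonal'_mul, ← Matrix.blockDiagonal'_one]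
  congr 1
  funext j
  exact (δ j).unitary.2

theorem comul_blockDiagonal' (p q : Σ j, Fin (δ j).n) :
    G.comul (Matrix.blockDiagonal' (fun j => (δ j).u) p q) =
      ∑ r, tmul (Matrix.blockDiagonal' (fun j => (δ j).u) p r)
        (Matrix.blockDiagonal' (fun j => (δ j).u) r q) := by
  obtain ⟨a, x⟩ := p
  obtain ⟨b, y⟩ := q
  rw [Fintype.sum_sigma, Finset.sum_eq_single a]
  · simp only [Matrix.blockDiagonal'_apply_eq]
    by_cases h : a = b
    · subst h
      simp only [Matrix.blockDiagonal'_apply_eq]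
      exact (δ a).isRep.comul_apply x y
    · simp only [Matrix.blockDiagonal'_apply_ne _ _ _ h, map_zero, tmul_zero,
        Finset.sum_const_zero]
  · intro k _ hk
    refine Finset.sum_eq_zero fun z _ => ?_
    rw [Matrix.blockDiagonal'_apply_ne _ _ _ hk.symm, zero_tmul]
  · simp

theorem isSubrep_summand {w : Matrix κ κ A}
    (hw : Equivalent w (Matrix.blockDiagonal' fun j => (δ j).u)) (j : Fin N) :
    G.IsSubrep (δ j).u w := by
  classical
  set B := Matrix.blockDiagonal' fun j => (δ j).u with hB
  let p : (Σ k, Fin (δ k).n) → Prop := fun x => x.1 = j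
  let e : Fin (δ j).n ⊕ Fin (Fintype.card {x // ¬ p x}) ≃ Σ k, Fin (δ k).n :=
    (Equiv.sumCongr (Equiv.sigmaSubtype j).symm (Fintype.equivFin {x // ¬ p x}).symm).trans
      (Equiv.sumCompl p)
  have he1 (x : Fin (δ j).n) : e (Sum.inl x) = ⟨j, x⟩ := rfl
  have he2 (y : Fin (Fintype.card {x // ¬ p x})) : (e (Sum.inr y)).1 ≠ j :=
    ((Fintype.equivFin {x // ¬ p x}).symm y).2
  set w' := B.submatrix (fun y => e (Sum.inr y)) (fun y => e (Sum.inr y)) with hw'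
  have h1 (x : Fin (δ j).n) (y) : B (e (Sum.inl x)) (e (Sum.inr y)) = 0 :=
    Matrix.blockDiagonal'_apply_ne _ _ _ (he2 y).symm
  have h2 (x : Fin (δ j).n) (y) : B (e (Sum.inr y)) (e (Sum.inl x)) = 0 :=
    Matrix.blockDiagonal'_apply_ne _ _ _ (he2 y)
  have hblocks : Matrix.fromBlocks (δ j).u 0 0 w' = B.submatrix e e := by
    refine Matrix.ext fun a b => ?_
    rcases a with a | a <;> rcases b with b | b
    · rw [Matrix.fromBlocks_apply₁₁, Matrix.submatrix_apply, he1, he1, hB,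
        Matrix.blockDiagonal'_apply_eq]
    · rw [Matrix.fromBlocks_apply₁₂, Matrix.submatrix_apply, h1, Matrix.zero_apply]
    · rw [Matrix.fromBlocks_apply₂₁, Matrix.submatrix_apply, h2, Matrix.zero_apply]
    · rfl
  -- The complementary block inherits unitarity from the direct sum, which gives the invertibility
  -- required of a representation.
  have hu1 : w'.conjTranspose * w' = 1 := by
    have h : (B.submatrix e e).conjTranspose * B.submatrix e e = 1 := by
      rw [Matrix.conjTranspose_submatrix, Matrix.submatrix_mul_equiv,
        blockDiagonal'_conjTranspose_mul_self, Matrix.submatrix_one_equiv]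
    rw [← hblocks, Matrix.fromBlocks_conjTranspose, Matrix.fromBlocks_multiply,
      ← Matrix.fromBlocks_one, Matrix.fromBlocks_inj] at h
    simpa using h.2.2.2
  have hu2 : w' * w'.conjTranspose = 1 := by
    have h : B.submatrix e e * (B.submatrix e e).conjTranspose = 1 := by
      rw [Matrix.conjTranspose_submatrix, Matrix.submatrix_mul_equiv,
        blockDiagonal'_mul_conjTranspose_self, Matrix.submatrix_one_equiv]
    rw [← hblocks, Matrix.fromBlocks_conjTranspose, Matrix.fromBlocks_multiply,
      ← Matrix.fromBlocks_one, Matrix.fromBlocks_inj] at h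
    simpa using h.2.2.2
  refine ⟨_, w', ⟨⟨⟨w', w'.conjTranspose, hu2, hu1⟩, rfl⟩, fun y z => ?_⟩, ?_⟩
  · rw [hw', Matrix.submatrix_apply, comul_blockDiagonal', ← Equiv.sum_comp e, Fintype.sum_sum_type]
    simp only [Matrix.submatrix_apply]
    rw [Finset.sum_eq_zero, zero_add]
    intro x _
    exact (congrArg (fun a => tmul a _) (h2 x y)).trans (zero_tmul _)
  · rw [hblocks]
    exact hw.symm.submatrix e

end Summand

end CompactQuantumGroup

/-! ### Frobenius reciprocity and Clebsch-Gordan maps -/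

namespace CompactQuantumGroup

variable {A : Type*} [CStarAlgebra A] [PartialOrder A] [StarOrderedRing A]
  {ι κ : Type*} [Fintype ι] [DecidableEq ι] [Fintype κ] [DecidableEq κ]

/-- Frobenius reciprocity: an intertwiner from `δ` to `ū ⊗ u` gives one from `u` to `u ⊗ δ^c`. -/
theorem IsQSqrt.frobenius_mem_hom {u : Matrix ι ι A} {R : Matrix ι ι ℂ} (hR : IsQSqrt u R)
    {δ : Matrix κ κ A} (hδ : δ ∈ _root_.unitary (Matrix κ κ A)) {V : Matrix (ι × ι) κ ℂ}
    (hV : V ∈ Hom δ ((amp (A := A) R * contra u * amp (A := A) R⁻¹) ⊗ₖ u))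
    {W : Matrix (ι × ι) κ ℂ} (hW : W = (R ⊗ₖ (1 : Matrix ι ι ℂ)) * V) :
    (Matrix.of fun p y => W (y, p.1) p.2 : Matrix (ι × κ) ι ℂ) ∈ Hom u (u ⊗ₖ contra δ) := by
  have hd := (Matrix.isUnit_iff_isUnit_det _).mp hR.posDef.isUnit
  have h0 := hom_mul (hom_conj_kronecker_inv hR.posDef.isUnit) hV
  set V' := (R⁻¹ ⊗ₖ (1 : Matrix ι ι ℂ)) * V with hV'
  have hWV : W = ((R ^ 2) ⊗ₖ (1 : Matrix ι ι ℂ)) * V' := by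
    rw [hV', ← Matrix.mul_assoc, ← Matrix.mul_kronecker_mul, sq, Matrix.mul_assoc,
      Matrix.mul_nonsing_inv R hd, Matrix.mul_one, Matrix.mul_one, hW]
  rw [mem_hom_iff, kronecker_eq_mul] at h0
  -- Multiplication by (u^c)*Q ⊗ 1 cancels the first leg because (u^c)* Q u^c = Q, and leaves the
  -- adjoint of u^c on the other side.
  have h1 : ((1 : Matrix ι ι A) ⊗ₖ u) * amp (A := A) W =
      ((contra u).conjTranspose ⊗ₖ (1 : Matrix ι ι A)) * amp (A := A) W * δ := by
    have h2 := congrArg (fun M => ((contra u).conjTranspose ⊗ₖ (1 : Matrix ι ι A)) *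
      (amp (A := A) (R ^ 2) ⊗ₖ (1 : Matrix ι ι A)) * M) h0
    rw [← Matrix.mul_assoc, ← Matrix.mul_assoc, kronecker_one_mul, kronecker_one_mul,
      hR.contra_conjTranspose_mul] at h2
    rw [hWV, amp_mul, amp_kronecker, amp_one, ← Matrix.mul_assoc,
      kronecker_mul_kronecker (M' := amp (A := A) (R ^ 2)) fun i j k l => commute_amp_apply _ _ _ _,
      Matrix.one_mul, Matrix.mul_one]
    rw [kronecker_mul_kronecker fun i j k l => commute_one_apply _ k l, Matrix.mul_one,
      Matrix.one_mul] at h2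
    rw [h2, ← kronecker_one_mul]
    simp only [Matrix.mul_assoc]
  have hδ2 : δ * δ.conjTranspose = 1 := hδ.2
  have h3 := congrArg (fun M => M * δ.conjTranspose) h1
  rw [Matrix.mul_assoc _ δ, hδ2, Matrix.mul_one, Matrix.mul_assoc] at h3
  rw [mem_hom_iff]
  refine Matrix.ext fun p y => ?_
  have h4 := congrFun (congrFun h3 (y, p.1)) p.2
  rw [one_kronecker_mul_apply, kronecker_one_mul_apply] at h4
  simp only [Matrix.mul_apply, Matrix.conjTranspose_apply, contra, Matrix.map_apply, star_star,
    amp_apply, Finset.mul_sum] at h4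
  simp only [Matrix.mul_apply, Fintype.sum_prod_type, Matrix.kroneckerMap_apply, contra,
    Matrix.map_apply, amp_apply, Matrix.of_apply]
  rw [Finset.sum_congr rfl fun i _ => Algebra.commutes _ _, ← h4]
  refine Finset.sum_congr rfl fun i _ => Finset.sum_congr rfl fun j _ => ?_
  rw [mul_assoc, Algebra.commutes]

theorem ofChoi_smul (c : ℂ) (C : Matrix (ι × κ) (ι × κ) ℂ) : ofChoi (c • C) = c • ofChoi C := by
  refine LinearMap.ext fun X => Matrix.ext fun k l => ?_
  simp only [ofChoi_apply, LinearMap.smul_apply, Matrix.smul_apply, smul_eq_mul, Finset.mul_sum]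
  simp only [mul_left_comm]

section Irrep

variable {G : CompactQuantumGroup A} {α γ : G.Irrep}

/-- Identifies the Choi matrix of the map built from the Frobenius transpose of W; with trivial
modular matrix the quantum trace is the ordinary one. -/
theorem partialQTrace_eq_ofChoi {w : Matrix κ κ A} (hw : qMatrix w = 1)
    (W : Matrix (ι × ι) κ ℂ) (X : Matrix ι ι ℂ) :
    partialQTrace w ((Matrix.of fun p y => W (y, p.1) p.2 : Matrix (ι × κ) ι ℂ) * X *
      (Matrix.of fun p y => W (y, p.1) p.2 : Matrix (ι × κ) ι ℂ).conjTranspose) =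
      ofChoi (W * W.conjTranspose) X := by
  refine Matrix.ext fun i j => ?_
  rw [partialQTrace, hw, Matrix.transpose_one, Matrix.of_apply, Matrix.one_mul, ofChoi_apply]
  simp only [Matrix.trace, Matrix.diag_apply, Matrix.of_apply, Matrix.mul_apply,
    Matrix.conjTranspose_apply, Finset.sum_mul, Finset.mul_sum]
  rw [Finset.sum_comm_three, Finset.sum_comm]
  rw [Finset.sum_comm]
  refine Finset.sum_congr rfl fun a _ => Finset.sum_congr rfl fun b _ =>
    Finset.sum_congr rfl fun c _ => ?_
  ring

theorem IsCGMap.trace_one {β : G.Irrep}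
    {Φ : Matrix (Fin α.n) (Fin α.n) ℂ →ₗ[ℂ] Matrix (Fin β.n) (Fin β.n) ℂ}
    (h : IsCGMap α β γ Φ) (hγ : qMatrix γ.u = 1) : (Φ 1).trace = α.n := by
  obtain ⟨V, -, hV, hΦ⟩ := h
  rw [hΦ, Matrix.mul_one, partialQTrace, hγ, Matrix.transpose_one]
  have h1 : (V * V.conjTranspose).trace = α.n := by
    rw [Matrix.trace_mul_comm, hV, Matrix.trace_one, Fintype.card_fin]
  rw [← h1]
  simp only [Matrix.trace, Matrix.diag_apply, Matrix.of_apply, Matrix.one_mul,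
    Fintype.sum_prod_type]

/-- A summand of `ᾱ ⊗ α` fixed by the modular matrix gives a Clebsch-Gordan map. -/
theorem Irrep.exists_isCGMap [Nontrivial A] (α δ : G.Irrep)
    {V : Matrix (Fin α.n × Fin α.n) (Fin δ.n) ℂ} (hV : V ∈ Hom δ.u (conj α.u ⊗ₖ α.u))
    (hV1 : V.conjTranspose * V = 1)
    (hVR : (((qSqrt α.u) ^ 2)⁻¹ ⊗ₖ ((qSqrt α.u) ^ 2).transpose) * V = V)
    {W : Matrix (Fin α.n × Fin α.n) (Fin δ.n) ℂ}
    (hW : W = (qSqrt α.u ⊗ₖ (1 : Matrix (Fin α.n) (Fin α.n) ℂ)) * V) :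
    ∃ h : contra δ.u ∈ _root_.unitary (Matrix (Fin δ.n) (Fin δ.n) A),
      qMatrix (δ.contragredient h).u = 1 ∧ ∃ τ : ℝ, 0 < τ ∧
      ∃ Ψ, IsCGMap α α (δ.contragredient h) Ψ ∧ ofChoi (W * W.conjTranspose) = τ • Ψ := by
  have h := δ.isQSqrt.contra_mem_unitary
    (α.isQSqrt.contra_conjTranspose_mul_contra α.unitary hV hV1 hVR)
  have hQ : qMatrix (δ.contragredient h).u = 1 := by
    rw [qMatrix, δ.qSqrt_contragredient h, one_pow]
  have hF := α.isQSqrt.frobenius_mem_hom δ.unitary hV hW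
  have hd := (Matrix.isUnit_iff_isUnit_det _).mp α.isQSqrt.posDef.isUnit
  set v : Matrix (Fin α.n × Fin δ.n) (Fin α.n) ℂ := Matrix.of fun p y => W (y, p.1) p.2 with hv
  have hv0 : v ≠ 0 := by
    intro h0
    have hW0 : W = 0 := Matrix.ext fun p t => congrFun (congrFun h0 (p.2, t)) p.1
    have hV0 : V = 0 := by
      have : V = ((qSqrt α.u)⁻¹ ⊗ₖ (1 : Matrix (Fin α.n) (Fin α.n) ℂ)) * W := by
        rw [hW, ← Matrix.mul_assoc, ← Matrix.mul_kronecker_mul, Matrix.nonsing_inv_mul _ hd,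
          Matrix.one_mul, Matrix.one_kronecker_one, Matrix.one_mul]
      rw [this, hW0, Matrix.mul_zero]
    obtain ⟨x⟩ := δ.irreducible.1
    rw [hV0, Matrix.mul_zero] at hV1
    exact zero_ne_one ((congrFun (congrFun hV1 x) x).trans (Matrix.one_apply_eq x))
  obtain ⟨τ, hτ, hvv⟩ := α.irreducible.exists_conjTranspose_mul_self α.unitary
    (kronecker_mem_unitary α.unitary h) hF hv0
  -- Dividing v by √τ makes it isometric and divides the Choi matrix WW* by τ.
  set s : ℝ := Real.sqrt τ with hs
  have hs0 : (s : ℂ) ≠ 0 := by exact_mod_cast (Real.sqrt_pos.mpr hτ).ne'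
  have hss : (s : ℂ) * s = τ := by exact_mod_cast Real.mul_self_sqrt hτ.le
  have hstar : star (s : ℂ)⁻¹ = (s : ℂ)⁻¹ := by
    rw [star_inv₀]; exact congrArg _ (Complex.conj_ofReal s)
  have hτ0 : (τ : ℂ) ≠ 0 := by exact_mod_cast hτ.ne'
  have hsτ : (s : ℂ)⁻¹ * (s : ℂ)⁻¹ = (τ : ℂ)⁻¹ := by rw [← mul_inv, hss]
  refine ⟨h, hQ, τ, hτ,
    τ⁻¹ • ofChoi (W * W.conjTranspose), ⟨(s : ℂ)⁻¹ • v, hom_smul hF _, ?_, fun X => ?_⟩, ?_⟩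
  · change ((s : ℂ)⁻¹ • v).conjTranspose * ((s : ℂ)⁻¹ • v) = 1
    rw [Matrix.conjTranspose_smul, Matrix.smul_mul, Matrix.mul_smul, smul_smul, hvv, smul_smul,
      hstar, hsτ, inv_mul_cancel₀ hτ0, one_smul]
  · have h1 := partialQTrace_eq_ofChoi hQ ((s : ℂ)⁻¹ • W) X
    refine Eq.trans ?_ h1.symm
    change (τ⁻¹ • ofChoi (W * W.conjTranspose)) X =
      ofChoi (((s : ℂ)⁻¹ • W) * ((s : ℂ)⁻¹ • W).conjTranspose) X
    rw [Matrix.conjTranspose_smul, Matrix.smul_mul, Matrix.mul_smul, smul_smul, hstar, hsτ,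
      ofChoi_smul, LinearMap.smul_apply, LinearMap.smul_apply, ← Complex.ofReal_inv,
      Complex.coe_smul]
  · rw [smul_smul, mul_inv_cancel₀ hτ.ne', one_smul]

end Irrep

end CompactQuantumGroup

/-! ### Convex decomposition of covariant channels -/

namespace CompactQuantumGroup

variable {A : Type*} [CStarAlgebra A] [PartialOrder A] [StarOrderedRing A]

/-- Multiplying by R⁻¹ ⊗ Rᵗ removes the factor 1 ⊗ (R⁻¹)ᵗ of L and the R in front of V, as R
commutes with Q⁻¹. -/
theorem kronecker_mul_eq_self {ι μ : Type*} [Fintype ι] [DecidableEq ι] {R : Matrix ι ι ℂ}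
    (hR : IsUnit R) {V : Matrix (ι × ι) μ ℂ}
    (h : ((R⁻¹ * R⁻¹) ⊗ₖ R.transpose - 1 ⊗ₖ R⁻¹.transpose) *
      ((R ⊗ₖ (1 : Matrix ι ι ℂ)) * V) = 0) :
    ((R ^ 2)⁻¹ ⊗ₖ (R ^ 2).transpose) * V = V := by
  have hd := (Matrix.isUnit_iff_isUnit_det _).mp hR
  have e1 : R.transpose * R⁻¹.transpose = 1 := by
    rw [← Matrix.transpose_mul, Matrix.nonsing_inv_mul R hd, Matrix.transpose_one]
  have e2 : R⁻¹ * (R⁻¹ * R⁻¹) * R = (R ^ 2)⁻¹ := by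
    rw [Matrix.mul_assoc, Matrix.mul_assoc, Matrix.nonsing_inv_mul R hd, Matrix.mul_one, sq,
      Matrix.mul_inv_rev]
  have h1 := congrArg (fun M => (R⁻¹ ⊗ₖ R.transpose) * M) h
  rw [← Matrix.mul_assoc, ← Matrix.mul_assoc, Matrix.mul_sub, Matrix.sub_mul, Matrix.sub_mul,
    ← Matrix.mul_kronecker_mul, ← Matrix.mul_kronecker_mul, ← Matrix.mul_kronecker_mul,
    ← Matrix.mul_kronecker_mul, e1, e2, Matrix.mul_one, Matrix.mul_one, Matrix.mul_one,
    Matrix.nonsing_inv_mul R hd, Matrix.one_kronecker_one, Matrix.one_mul, Matrix.mul_zero,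
    sub_eq_zero, ← Matrix.transpose_mul, ← sq] at h1
  exact h1

variable [Nontrivial A] {G : CompactQuantumGroup A} {α : G.Irrep}
  {Φ : Matrix (Fin α.n) (Fin α.n) ℂ →ₗ[ℂ] Matrix (Fin α.n) (Fin α.n) ℂ}

theorem IsCovariant.exists_decomposition (hmf : G.MultiplicityFree (conj α.u ⊗ₖ α.u))
    (hΦ : IsCovariant α.u α.u Φ) (hΦ' : IsCPTP Φ) :
    ∃ (N : ℕ) (δ : Fin N → G.Irrep)
      (V : ∀ j, Matrix (Fin α.n × Fin α.n) (Fin (δ j).n) ℂ) (d : Fin N → ℝ),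
      (∀ j, G.IsSubrep (δ j).u (conj α.u ⊗ₖ α.u)) ∧
      (∀ j, V j ∈ Hom (δ j).u (conj α.u ⊗ₖ α.u)) ∧ (∀ j, (V j).conjTranspose * V j = 1) ∧
      (∀ j, 0 ≤ d j) ∧
      choi Φ = ∑ j, (d j : ℂ) •
        (((qSqrt α.u ⊗ₖ (1 : Matrix (Fin α.n) (Fin α.n) ℂ)) * V j) *
        ((qSqrt α.u ⊗ₖ (1 : Matrix (Fin α.n) (Fin α.n) ℂ)) * V j).conjTranspose) := by
  obtain ⟨N, δ, hδ, hwδ⟩ := hmf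
  have hw : conj α.u ⊗ₖ α.u ∈ _root_.unitary (Matrix (Fin α.n × Fin α.n) (Fin α.n × Fin α.n) A) :=
    kronecker_mem_unitary α.isQSqrt.unitary α.unitary
  obtain ⟨V, hV, hV1, hVs⟩ := exists_isometries hw hδ hwδ
  have hD := hΦ.normalized_choi_mem_hom α.unitary α.isQSqrt
  have hR := α.isQSqrt.posDef
  have hd := (Matrix.isUnit_iff_isUnit_det _).mp hR.isUnit
  have hP : ((qSqrt α.u)⁻¹ ⊗ₖ (1 : Matrix (Fin α.n) (Fin α.n) ℂ)).conjTranspose =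
      (qSqrt α.u)⁻¹ ⊗ₖ 1 := by
    rw [Matrix.conjTranspose_kronecker, Matrix.conjTranspose_one,
      show ((qSqrt α.u)⁻¹).conjTranspose = _ from hR.inv.isHermitian]
  have hP' : (qSqrt α.u ⊗ₖ (1 : Matrix (Fin α.n) (Fin α.n) ℂ)).conjTranspose =
      qSqrt α.u ⊗ₖ 1 := by
    rw [Matrix.conjTranspose_kronecker, Matrix.conjTranspose_one,
      show (qSqrt α.u).conjTranspose = _ from hR.isHermitian]
  have hD0 := (choi_posSemidef hΦ').mul_mul_conjTranspose_same
    ((qSqrt α.u)⁻¹ ⊗ₖ (1 : Matrix (Fin α.n) (Fin α.n) ℂ))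
  rw [hP] at hD0
  obtain ⟨d, hd0, hDd⟩ := exists_spectral_decomposition hw hδ hV hVs hD hD0
  refine ⟨N, δ, V, d, isSubrep_summand δ hwδ, hV, hV1, hd0, ?_⟩
  have e1 : (qSqrt α.u ⊗ₖ (1 : Matrix (Fin α.n) (Fin α.n) ℂ)) * ((qSqrt α.u)⁻¹ ⊗ₖ 1) = 1 := by
    rw [← Matrix.mul_kronecker_mul, Matrix.mul_nonsing_inv _ hd, Matrix.one_mul,
      Matrix.one_kronecker_one]
  have e2 : ((qSqrt α.u)⁻¹ ⊗ₖ (1 : Matrix (Fin α.n) (Fin α.n) ℂ)) * (qSqrt α.u ⊗ₖ 1) = 1 := by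
    rw [← Matrix.mul_kronecker_mul, Matrix.nonsing_inv_mul _ hd, Matrix.one_mul,
      Matrix.one_kronecker_one]
  have h := congrArg (fun M => (qSqrt α.u ⊗ₖ (1 : Matrix (Fin α.n) (Fin α.n) ℂ)) * M *
    (qSqrt α.u ⊗ₖ (1 : Matrix (Fin α.n) (Fin α.n) ℂ))) hDd
  rw [← Matrix.mul_assoc, ← Matrix.mul_assoc, e1, Matrix.one_mul, Matrix.mul_assoc, e2,
    Matrix.mul_one] at h
  rw [h, Matrix.mul_sum, Matrix.sum_mul]
  refine Finset.sum_congr rfl fun j _ => ?_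
  rw [Matrix.mul_smul, Matrix.smul_mul, Matrix.conjTranspose_mul, hP']
  simp only [Matrix.mul_assoc]

/-- Covariant channels are convex combinations of Clebsch-Gordan maps with trivial modular
matrix. -/
theorem IsCovariant.mem_convexHull (hmf : G.MultiplicityFree (conj α.u ⊗ₖ α.u))
    (hΦ : IsCovariant α.u α.u Φ) (hΦ' : IsCPTP Φ) :
    Φ ∈ convexHull ℝ {Ψ | ∃ γ : G.Irrep, G.IsSubrep (conj γ.u) (conj α.u ⊗ₖ α.u) ∧
      qMatrix γ.u = 1 ∧ IsCGMap α α γ Ψ} := by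
  obtain ⟨N, δ, V, d, hsub, hV, hV1, hd0, hC⟩ := hΦ.exists_decomposition hmf hΦ'
  have hn : (α.n : ℂ) ≠ 0 := by exact_mod_cast α.n_pos.ne'
  have hR := α.isQSqrt.posDef
  set S := {Ψ | ∃ γ : G.Irrep, G.IsSubrep (conj γ.u) (conj α.u ⊗ₖ α.u) ∧
      qMatrix γ.u = 1 ∧ IsCGMap α α γ Ψ} with hS
  set W : ∀ j, Matrix (Fin α.n × Fin α.n) (Fin (δ j).n) ℂ :=
    fun j => (qSqrt α.u ⊗ₖ (1 : Matrix (Fin α.n) (Fin α.n) ℂ)) * V j with hW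
  have hL : (((qSqrt α.u)⁻¹ * (qSqrt α.u)⁻¹) ⊗ₖ (qSqrt α.u).transpose -
      1 ⊗ₖ ((qSqrt α.u)⁻¹).transpose).IsHermitian := by
    have hh : (qSqrt α.u).conjTranspose = _ := hR.isHermitian
    have hh' : ((qSqrt α.u)⁻¹).conjTranspose = _ := hR.inv.isHermitian
    rw [Matrix.IsHermitian, Matrix.conjTranspose_sub, Matrix.conjTranspose_kronecker,
      Matrix.conjTranspose_kronecker, Matrix.conjTranspose_mul, hh', Matrix.conjTranspose_one,
      hR.isHermitian.transpose, hR.inv.isHermitian.transpose]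
  have htr := hΦ.trace_sq_mul_choi hΦ'.tp rfl
  rw [hC] at htr
  have key (j : Fin N) : ∃ t : ℝ, 0 ≤ t ∧ ∃ Ψ, (t ≠ 0 → Ψ ∈ S ∧ (Ψ 1).trace = α.n) ∧
      (d j : ℂ) • ofChoi (W j * (W j).conjTranspose) = t • Ψ := by
    -- Summands of weight zero need not have a unitary contragredient. They receive the dummy map 0
    -- with weight 0 and are filtered out at the end.
    by_cases hj : d j = 0
    · exact ⟨0, le_rfl, 0, fun h => absurd rfl h, by rw [hj, Complex.ofReal_zero, zero_smul,
        zero_smul]⟩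
    · have hVR := kronecker_mul_eq_self hR.isUnit (mul_eq_zero_of_trace_eq_zero hd0 hL htr hj)
      obtain ⟨h, hq, τ, hτ, Ψ, hΨ, hWΨ⟩ := α.exists_isCGMap (δ j) (hV j) (hV1 j) hVR (W := W j) rfl
      refine ⟨d j * τ, mul_nonneg (hd0 j) hτ.le, Ψ, fun _ => ⟨⟨_, ?_, hq, hΨ⟩, hΨ.trace_one hq⟩, ?_⟩
      · rw [(δ j).conj_contragredient h]
        exact hsub j
      · refine LinearMap.ext fun X => ?_
        rw [hWΨ, LinearMap.smul_apply, LinearMap.smul_apply, LinearMap.smul_apply, Complex.coe_smul,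
          smul_smul]
  choose t ht0 Ψ hΨ hWΨ using key
  have hsum : Φ = ∑ j, t j • Ψ j := by
    rw [← ofChoi_choi Φ, hC, ofChoi_sum_smul]
    exact Finset.sum_congr rfl fun j _ => hWΨ j
  -- Each map of nonzero weight sends the unit to a matrix of trace n_α, as Φ does.
  have hone : ∑ j, t j = 1 := by
    have h1 := hΦ'.tp 1
    rw [hsum, LinearMap.sum_apply, Matrix.trace_sum, Matrix.trace_one, Fintype.card_fin] at h1
    have h2 (j : Fin N) : ((t j • Ψ j) 1).trace = (t j : ℂ) * α.n := by
      rw [LinearMap.smul_apply, Matrix.trace_smul, ← Complex.coe_smul, smul_eq_mul]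
      by_cases h : t j = 0
      · rw [h, Complex.ofReal_zero, zero_mul, zero_mul]
      · rw [(hΨ j h).2]
    rw [Finset.sum_congr rfl fun j _ => h2 j, ← Finset.sum_mul] at h1
    have h3 := mul_right_cancel₀ hn (h1.trans (one_mul _).symm)
    exact_mod_cast h3
  have hfil : Φ = ∑ j with t j ≠ 0, t j • Ψ j := by
    rw [hsum, Finset.sum_filter_of_ne]
    intro j _ h h0
    exact h (by rw [h0, zero_smul])
  rw [hfil]
  refine (convex_convexHull ℝ S).sum_mem (fun j _ => ht0 j) ?_ fun j hj =>
    subset_convexHull ℝ S (hΨ j (Finset.mem_filter.mp hj).2).1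
  rw [Finset.sum_filter_ne_zero, hone]

end CompactQuantumGroup

end

open CompactQuantumGroup in
theorem mainTheorem7 {A : Type*} [CStarAlgebra A] [PartialOrder A] [StarOrderedRing A]
    [Nontrivial A] (G : CompactQuantumGroup A) :
    (∀ α β : G.Irrep, G.MultiplicityFree (conj α.u ⊗ₖ β.u) →
      (∃ Φ : Matrix (Fin α.n) (Fin α.n) ℂ →ₗ[ℂ] Matrix (Fin β.n) (Fin β.n) ℂ,
        IsCPTP Φ ∧ IsCovariant α.u β.u Φ) →
      α.n * qNorm α.u / qDim α.u ≤ β.n * qNorm β.u / qDim β.u) ∧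
    (∀ α : G.Irrep, G.MultiplicityFree (conj α.u ⊗ₖ α.u) →
      ∀ Φ : Matrix (Fin α.n) (Fin α.n) ℂ →ₗ[ℂ] Matrix (Fin α.n) (Fin α.n) ℂ,
        IsCPTP Φ → IsCovariant α.u α.u Φ →
        Φ ∈ convexHull ℝ {Ψ | ∃ γ : G.Irrep, G.IsSubrep (conj γ.u) (conj α.u ⊗ₖ α.u) ∧
          qMatrix γ.u = 1 ∧ IsCGMap α α γ Ψ}) := by
  exact ⟨fun α β _ ⟨Φ, h1, h2⟩ => h2.norm_qMatrix_le h1,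
    fun α hα Φ h1 h2 => h2.mem_convexHull hα h1⟩
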